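/- Let $n\ge 1$, $\gamma\in(0,\frac n2)$, $s=\frac n2+\gamma$. Let $\mathbb{B}^{n+1}$ be the open unit ball of $\mathbb{R}^{n+1}$ with the hyperbolic metric $g_{\mathbb{B}}=\frac{4}{(1-|x|^2)^2}|dx|^2$, let $\rho(x)=\frac{1-|x|^2}{2}$, let $d\sigma$ be the surface measure of $\mathbb{S}^n=\partial\mathbb{B}^{n+1}$, and let $f\in C^\infty(\mathbb{S}^n)$ be real-valued. Consider the problem $$-\Delta_{g_{\mathbb{B}}}u-s(n-s)u=0\ \text{ in }\mathbb{B}^{n+1},\qquad u=F\rho^{n-s}+H\rho^{s}\ \text{ in }\mathbb{B}^{n+1},\qquad F|_{\mathbb{S}^n}=f,$$ with $F,H\in C^\infty(\overline{\mathbb{B}^{n+1}})$; when $\gamma$ is an integer, the second condition is replaced by $u=F\rho^{n-s}+H\rho^{s}\log\rho$. Then: (i) This problem has exactly one solution $u:\mathbb{B}^{n+1}\to\mathbb{R}$, namely $$u(x)=\pi^{-\frac n2}\,\frac{\Gamma(\frac n2+\gamma)}{\Gamma(\gamma)}\int_{\mathbb{S}^n}\left(\frac{1-|x|^2}{2|x-\xi|^2}\right)^{s}f(\xi)\,d\sigma(\xi).$$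 (ii) If $f=\sum_{l=0}^\infty Y_l$ in $L^2(\mathbb{S}^n)$, where each $Y_l$ is a spherical harmonic of degree $l$ (the restriction to $\mathbb{S}^n$ of a harmonic homogeneous polynomial of degree $l$), then for all $0\le r<1$ and $\xi\in\mathbb{S}^n$ $$u(r\xi)=\rho^{n-s}\sum_{l=0}^\infty\varphi_l(r^2)\,r^l\,Y_l(\xi),\qquad \rho=\frac{1-r^2}{2},$$ the series being absolutely convergent, where $$\varphi_l(z)=\frac{\Gamma(\gamma+\frac12)}{\Gamma(2\gamma)}\,\frac{\Gamma(l+\frac n2+\gamma)}{\Gamma(l+\frac{n+1}2)}\;{}_2F_1\!\left(l+\tfrac n2-\gamma,\ \tfrac12-\gamma;\ l+\tfrac{n+1}2;\ z\right).$$ (iii) $\varphi_l(1)=1$ for every $l\ge 0$. -/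

import Mathlib

open scoped ContDiff Manifold

noncomputable section

/-- Partial derivative `∂u/∂x_i` at `x`. -/
def partialD {d : ℕ} (i : Fin d) (u : EuclideanSpace ℝ (Fin d) → ℝ)
    (x : EuclideanSpace ℝ (Fin d)) : ℝ :=
  fderiv ℝ u x (EuclideanSpace.single i 1)

/-- The Laplace-Beltrami operator of a Riemannian metric `g = (g_{ij})` given in one global
coordinate chart:
`Δ_g u = |g|^{-1/2} ∑_i ∂_i (|g|^{1/2} ∑_j g^{ij} ∂_j u)`. -/
def laplaceBeltrami {d : ℕ} (g : EuclideanSpace ℝ (Fin d) → Matrix (Fin d) (Fin d) ℝ)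
    (u : EuclideanSpace ℝ (Fin d) → ℝ) (x : EuclideanSpace ℝ (Fin d)) : ℝ :=
  (Real.sqrt (g x).det)⁻¹ *
    ∑ i, partialD i (fun y => Real.sqrt (g y).det * ∑ j, (g y)⁻¹ i j * partialD j u y) x

/-- The hyperbolic metric `g_B = 4 / (1 - |x|²)² |dx|²` of the unit ball. -/
def ballMetric (d : ℕ) (x : EuclideanSpace ℝ (Fin d)) : Matrix (Fin d) (Fin d) ℝ :=
  (4 / (1 - ‖x‖ ^ 2) ^ 2) • (1 : Matrix (Fin d) (Fin d) ℝ)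

/-- The defining function `ρ = (1 - |x|²) / 2` of the unit sphere in the unit ball. -/
def defFun {d : ℕ} (x : EuclideanSpace ℝ (Fin d)) : ℝ := (1 - ‖x‖ ^ 2) / 2

open Classical in
/-- The second indicial term: `ρ^s`, except in the resonant case `s ∈ n/2 + ℕ`, where it is
`ρ^s log ρ`. -/
def secondTerm (n : ℕ) (s t : ℝ) : ℝ :=
  if ∃ k : ℕ, s = (n : ℝ) / 2 + k then t ^ s * Real.log t else t ^ s

/-- `u` solves the scattering Poisson problem on the hyperbolic ball with boundary datum `f`:
`-Δ_{g_B} u - s (n - s) u = 0` in the open ball, and `u = F ρ^{n-s} + H ρ^s`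
(`u = F ρ^{n-s} + H ρ^s log ρ` if `s ∈ n/2 + ℕ`) with `F`, `H` smooth on the closed ball
and `F = f` on the sphere. -/
def IsPoissonSolution (n : ℕ) (s : ℝ)
    (f : Metric.sphere (0 : EuclideanSpace ℝ (Fin (n + 1))) 1 → ℝ)
    (u : EuclideanSpace ℝ (Fin (n + 1)) → ℝ) : Prop :=
  (∀ x ∈ Metric.ball (0 : EuclideanSpace ℝ (Fin (n + 1))) 1,
      -laplaceBeltrami (ballMetric (n + 1)) u x - s * (n - s) * u x = 0) ∧
  ∃ F H : EuclideanSpace ℝ (Fin (n + 1)) → ℝ,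
    ContDiffOn ℝ ∞ F (Metric.closedBall 0 1) ∧
    ContDiffOn ℝ ∞ H (Metric.closedBall 0 1) ∧
    (∀ x ∈ Metric.ball (0 : EuclideanSpace ℝ (Fin (n + 1))) 1,
      u x = F x * defFun x ^ ((n : ℝ) - s) + H x * secondTerm n s (defFun x)) ∧
    ∀ ξ : Metric.sphere (0 : EuclideanSpace ℝ (Fin (n + 1))) 1, F ξ = f ξ

/-- The surface measure `dσ` of the unit sphere of `ℝ^{n+1}` (of total mass `(n+1) |B^{n+1}|`). -/
def surfaceMeasure (n : ℕ) :
    MeasureTheory.Measure (Metric.sphere (0 : EuclideanSpace ℝ (Fin (n + 1))) 1) :=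
  (MeasureTheory.volume : MeasureTheory.Measure (EuclideanSpace ℝ (Fin (n + 1)))).toSphere

/-- The generalized Poisson integral
`π^{-n/2} Γ(n/2+γ)/Γ(γ) ∫_S ((1-|x|²) / (2|x-ξ|²))^{n/2+γ} f(ξ) dσ(ξ)`. -/
def poissonIntegral (n : ℕ) (γ : ℝ)
    (f : Metric.sphere (0 : EuclideanSpace ℝ (Fin (n + 1))) 1 → ℝ)
    (x : EuclideanSpace ℝ (Fin (n + 1))) : ℝ :=
  Real.pi ^ (-((n : ℝ) / 2)) * (Real.Gamma ((n : ℝ) / 2 + γ) / Real.Gamma γ) *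
    ∫ ξ, ((1 - ‖x‖ ^ 2) / (2 * ‖x - (ξ : EuclideanSpace ℝ (Fin (n + 1)))‖ ^ 2)) ^
      ((n : ℝ) / 2 + γ) * f ξ ∂(surfaceMeasure n)

/-- `Y` is a spherical harmonic of degree `l`: the restriction to the unit sphere of a harmonic
homogeneous polynomial of degree `l`. -/
def IsSphericalHarmonic (n l : ℕ)
    (Y : Metric.sphere (0 : EuclideanSpace ℝ (Fin (n + 1))) 1 → ℝ) : Prop :=
  ∃ p : MvPolynomial (Fin (n + 1)) ℝ, p.IsHomogeneous l ∧
    ∑ i, MvPolynomial.pderiv i (MvPolynomial.pderiv i p) = 0 ∧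
    ∀ ξ : Metric.sphere (0 : EuclideanSpace ℝ (Fin (n + 1))) 1,
      Y ξ = MvPolynomial.eval (fun i => (ξ : EuclideanSpace ℝ (Fin (n + 1))) i) p

/-- `f = ∑_l Y_l` is an expansion of `f` in spherical harmonics: `Y_l` is a spherical harmonic
of degree `l` and the partial sums converge to `f` in `L²(S^n)`. -/
def IsHarmonicExpansion (n : ℕ)
    (f : Metric.sphere (0 : EuclideanSpace ℝ (Fin (n + 1))) 1 → ℝ)
    (Y : ℕ → Metric.sphere (0 : EuclideanSpace ℝ (Fin (n + 1))) 1 → ℝ) : Prop :=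
  (∀ l, IsSphericalHarmonic n l (Y l)) ∧
  Filter.Tendsto
    (fun N : ℕ => MeasureTheory.eLpNorm
      (fun ξ => f ξ - ∑ l ∈ Finset.range N, Y l ξ) 2 (surfaceMeasure n))
    Filter.atTop (nhds 0)

/-- The radial profile
`φ_l(z) = Γ(γ+1/2)/Γ(2γ) Γ(l+n/2+γ)/Γ(l+(n+1)/2) F(l+n/2-γ, 1/2-γ; l+(n+1)/2; z)`. -/
def radialProfile (n : ℕ) (γ : ℝ) (l : ℕ) (z : ℝ) : ℝ :=
  Real.Gamma (γ + 1 / 2) / Real.Gamma (2 * γ) *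
    (Real.Gamma (l + (n : ℝ) / 2 + γ) / Real.Gamma (l + ((n : ℝ) + 1) / 2)) *
    ordinaryHypergeometric (l + (n : ℝ) / 2 - γ) (1 / 2 - γ) (l + ((n : ℝ) + 1) / 2) z

end

/-! Write p = ρ/|x-ξ|² and L = -Δ_g - s(n-s). A direct computation gives Δ_g p^s = s(s-n) p^s, so
the Poisson integral Pf solves Lu = 0 by differentiation under the integral
(`scatteringOp_poissonIntegral`). Three things remain: uniqueness, boundary values, and smoothness
of F and H up to the sphere.

Uniqueness. Since s(n-s) = n²/4 - γ² > 0, the zeroth-order term has the wrong sign for the usual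
maximum principle. It is replaced by comparison with V = ρ^{n/2-γ} φ_0(|x|²) + ρ^{n/2}: the first
summand is a positive exact solution comparable to ρ^{n-s}, the second a strict supersolution. A
solution w = o(ρ^{n-s}) makes w/V vanish at the boundary, and a positive interior maximum of w/V
contradicts LV > 0 (`eq_zero_of_scatteringOp_eq_zero`).

Boundary values. For h harmonic and homogeneous of degree l, ρ^{n-s} φ_l(|x|²) h solves Lu = 0
exactly because φ_l solves a hypergeometric equation, and φ_l(1) = 1 is Gauss's summation theorem.
By rotation invariance and uniqueness on smaller balls, P1 = ρ^{n-s} φ_0 (`poissonIntegral_one`).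
The total mass of the kernel being known, an approximate-identity argument gives Pf/ρ^{n-s} → f
(`tendsto_poissonIntegral`). Uniqueness then evaluates P on spherical harmonics
(`poissonIntegral_of_harmonic`). For a general f the L² expansion passes through P pointwise, since
the kernel is bounded for fixed x; Euler's integral bounds φ_l(z)/φ_l(z') uniformly in l, so the
series is dominated by a geometric one (`poissonIntegral_harmonicExpansion`).

Smoothness. After a rotation and a cutoff, the part of f away from a boundary point contributes a
smooth multiple of ρ^s there. Stereographic projection turns the other part into y^s ∫ φ(z) (y² +
|x'-z|²)^{-s} dz on a half-space. By Gaussian subordination the Fourier transform of (ε + |z|²)^{-s}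
is a constant times ε^{-γ} k(ε π²|ζ|²), where k is a Bessel-type integral. The ODE of k gives k(w) =
a(w) + w^γ b(w), with a factor log w in the second term when γ is an integer, a and b having bounded
derivatives of all orders (`exists_boundedDerivs_splitting`). Integration against the rapidly
decaying transform of φ preserves this structure (`exists_contDiff_integral_add_norm_sq_rpow`), and
with ε = y² it becomes the form required of u. A partition of unity glues the local pairs (F, H),
because the condition on a pair is affine at each point. -/

noncomputable section

open Filter Topology

/-! ### Coordinate calculus for the Euclidean Laplacian and the Euler field. -/

section PartialDerivatives

variable {d : ℕ} {u v : EuclideanSpace ℝ (Fin d) → ℝ} {x : EuclideanSpace ℝ (Fin d)}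

theorem partialD_congr (i : Fin d) (h : u =ᶠ[𝓝 x] v) : partialD i u x = partialD i v x := by
  simp only [partialD, h.fderiv_eq]

theorem partialD_eventuallyEq (i : Fin d) (h : u =ᶠ[𝓝 x] v) :
    partialD i u =ᶠ[𝓝 x] partialD i v := by
  filter_upwards [h.eventuallyEq_nhds] with y hy using partialD_congr i hy

theorem contDiffAt_partialD {m n : WithTop ℕ∞} (i : Fin d) (h : ContDiffAt ℝ n u x)
    (hmn : m + 1 ≤ n) : ContDiffAt ℝ m (partialD i u) x :=
  (h.fderiv_right hmn).clm_apply contDiffAt_const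

theorem partialD_add (i : Fin d) (hu : DifferentiableAt ℝ u x) (hv : DifferentiableAt ℝ v x) :
    partialD i (fun y => u y + v y) x = partialD i u x + partialD i v x := by
  simp only [partialD, fderiv_fun_add hu hv, FunLike.coe_add, Pi.add_apply]

theorem partialD_mul (i : Fin d) (hu : DifferentiableAt ℝ u x) (hv : DifferentiableAt ℝ v x) :
    partialD i (fun y => u y * v y) x = u x * partialD i v x + v x * partialD i u x := by
  simp [partialD, fderiv_fun_mul hu hv]

theorem partialD_const_mul (i : Fin d) (c : ℝ) (hu : DifferentiableAt ℝ u x) :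
    partialD i (fun y => c * u y) x = c * partialD i u x := by
  simp [partialD, fderiv_const_mul hu]

theorem partialD_comp (i : Fin d) {φ : ℝ → ℝ} {φ' : ℝ} (hφ : HasDerivAt φ φ' (u x))
    (hu : DifferentiableAt ℝ u x) :
    partialD i (fun y => φ (u y)) x = φ' * partialD i u x := by
  have h := hφ.comp_hasFDerivAt x hu.hasFDerivAt
  have h' : fderiv ℝ (fun y => φ (u y)) x = φ' • fderiv ℝ u x := h.fderiv
  simp [partialD, h']

theorem partialD_coord (i j : Fin d) :
    partialD i (fun y : EuclideanSpace ℝ (Fin d) => y j) x = if j = i then 1 else 0 := by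
  have h : fderiv ℝ (fun y : EuclideanSpace ℝ (Fin d) => y j) x = EuclideanSpace.proj j :=
    (EuclideanSpace.proj j : EuclideanSpace ℝ (Fin d) →L[ℝ] ℝ).hasFDerivAt.fderiv
  rw [partialD, h]
  simp

theorem partialD_const (i : Fin d) (c : ℝ) :
    partialD i (fun _ : EuclideanSpace ℝ (Fin d) => c) x = 0 := by
  simp [partialD]

theorem partialD_norm_sub_sq (i : Fin d) (ξ : EuclideanSpace ℝ (Fin d)) :
    partialD i (fun y => ‖y - ξ‖ ^ 2) x = 2 * (x i - ξ i) := by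
  have h : HasFDerivAt (fun y : EuclideanSpace ℝ (Fin d) => ‖y - ξ‖ ^ 2)
      (2 • (innerSL ℝ (x - ξ)).comp (ContinuousLinearMap.id ℝ _)) x :=
    ((hasFDerivAt_id x).sub_const ξ).norm_sq
  simp [partialD, h.fderiv, EuclideanSpace.inner_single_right]

theorem partialD_norm_sq (i : Fin d) :
    partialD i (fun y : EuclideanSpace ℝ (Fin d) => ‖y‖ ^ 2) x = 2 * x i := by
  simpa using partialD_norm_sub_sq (x := x) i 0

/-- The Euclidean Laplacian. -/
def lap (u : EuclideanSpace ℝ (Fin d) → ℝ) (x : EuclideanSpace ℝ (Fin d)) : ℝ :=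
  ∑ i, partialD i (partialD i u) x

/-- The Euler field `∑ x_i ∂_i`. -/
def eulerD (u : EuclideanSpace ℝ (Fin d) → ℝ) (x : EuclideanSpace ℝ (Fin d)) : ℝ :=
  ∑ i, x i * partialD i u x

theorem lap_congr (h : u =ᶠ[𝓝 x] v) : lap u x = lap v x :=
  Finset.sum_congr rfl fun i _ => partialD_congr i (partialD_eventuallyEq i h)

theorem eulerD_congr (h : u =ᶠ[𝓝 x] v) : eulerD u x = eulerD v x :=
  Finset.sum_congr rfl fun i _ => by rw [partialD_congr i h]

theorem ContDiffAt.eventually_differentiableAt {n : WithTop ℕ∞} (h : ContDiffAt ℝ n u x)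
    (hn : n = 1 ∨ n = 2) :
    ∀ᶠ y in 𝓝 x, DifferentiableAt ℝ u y := by
  have h1 : ContDiffAt ℝ 1 u x := by
    rcases hn with rfl | rfl
    · exact h
    · exact h.of_le one_le_two
  filter_upwards [h1.eventually (by simp)] with y hy using hy.differentiableAt one_ne_zero

theorem ContDiffAt.differentiableAt_partialD (h : ContDiffAt ℝ 2 u x) (i : Fin d) :
    DifferentiableAt ℝ (partialD i u) x :=
  (contDiffAt_partialD (m := 1) i h (by norm_num)).differentiableAt one_ne_zero

theorem lap_add (hu : ContDiffAt ℝ 2 u x) (hv : ContDiffAt ℝ 2 v x) :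
    lap (fun y => u y + v y) x = lap u x + lap v x := by
  rw [lap, lap, lap, ← Finset.sum_add_distrib]
  refine Finset.sum_congr rfl fun i _ => ?_
  have h : partialD i (fun y => u y + v y) =ᶠ[𝓝 x] fun y => partialD i u y + partialD i v y := by
    filter_upwards [hu.eventually_differentiableAt (.inr rfl),
      hv.eventually_differentiableAt (.inr rfl)] with y h1 h2 using partialD_add i h1 h2
  rw [partialD_congr i h, partialD_add i (hu.differentiableAt_partialD i)
    (hv.differentiableAt_partialD i)]

theorem lap_const_mul (c : ℝ) (hu : ContDiffAt ℝ 2 u x) :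
    lap (fun y => c * u y) x = c * lap u x := by
  rw [lap, lap, Finset.mul_sum]
  refine Finset.sum_congr rfl fun i _ => ?_
  have h : partialD i (fun y => c * u y) =ᶠ[𝓝 x] fun y => c * partialD i u y := by
    filter_upwards [hu.eventually_differentiableAt (.inr rfl)] with y h1
      using partialD_const_mul i c h1
  rw [partialD_congr i h, partialD_const_mul i c (hu.differentiableAt_partialD i)]

theorem lap_mul (hu : ContDiffAt ℝ 2 u x) (hv : ContDiffAt ℝ 2 v x) :
    lap (fun y => u y * v y) x =
      u x * lap v x + 2 * ∑ i, partialD i u x * partialD i v x + v x * lap u x := by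
  rw [lap, lap, lap, Finset.mul_sum, Finset.mul_sum, Finset.mul_sum, ← Finset.sum_add_distrib,
    ← Finset.sum_add_distrib]
  refine Finset.sum_congr rfl fun i _ => ?_
  have h : partialD i (fun y => u y * v y) =ᶠ[𝓝 x]
      fun y => u y * partialD i v y + v y * partialD i u y := by
    filter_upwards [hu.eventually_differentiableAt (.inr rfl),
      hv.eventually_differentiableAt (.inr rfl)] with y h1 h2 using partialD_mul i h1 h2
  have du := (hu.eventually_differentiableAt (.inr rfl)).self_of_nhds
  have dv := (hv.eventually_differentiableAt (.inr rfl)).self_of_nhds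
  have du' := hu.differentiableAt_partialD i
  have dv' := hv.differentiableAt_partialD i
  rw [partialD_congr i h, partialD_add i (du.fun_mul dv') (dv.fun_mul du'), partialD_mul i du dv',
    partialD_mul i dv du']
  ring

theorem lap_comp {φ φ' : ℝ → ℝ} {φ'' : ℝ} (hu : ContDiffAt ℝ 2 u x)
    (h1 : ∀ᶠ t in 𝓝 (u x), HasDerivAt φ (φ' t) t) (h2 : HasDerivAt φ' φ'' (u x)) :
    lap (fun y => φ (u y)) x = φ'' * ∑ i, partialD i u x ^ 2 + φ' (u x) * lap u x := by
  rw [lap, lap, Finset.mul_sum, Finset.mul_sum, ← Finset.sum_add_distrib]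
  refine Finset.sum_congr rfl fun i _ => ?_
  have du := (hu.eventually_differentiableAt (.inr rfl)).self_of_nhds
  have h : partialD i (fun y => φ (u y)) =ᶠ[𝓝 x] fun y => φ' (u y) * partialD i u y := by
    filter_upwards [hu.eventually_differentiableAt (.inr rfl),
      du.continuousAt.eventually h1] with y h3 h4 using partialD_comp i h4 h3
  have dφ : DifferentiableAt ℝ (fun y => φ' (u y)) x := h2.differentiableAt.comp x du
  rw [partialD_congr i h, partialD_mul i dφ (hu.differentiableAt_partialD i),
    partialD_comp i h2 du]
  ring

theorem eulerD_mul (hu : DifferentiableAt ℝ u x) (hv : DifferentiableAt ℝ v x) :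
    eulerD (fun y => u y * v y) x = u x * eulerD v x + v x * eulerD u x := by
  simp only [eulerD, partialD_mul _ hu hv, Finset.mul_sum, ← Finset.sum_add_distrib]
  exact Finset.sum_congr rfl fun i _ => by ring

theorem eulerD_add (hu : DifferentiableAt ℝ u x) (hv : DifferentiableAt ℝ v x) :
    eulerD (fun y => u y + v y) x = eulerD u x + eulerD v x := by
  simp only [eulerD, partialD_add _ hu hv, ← Finset.sum_add_distrib]
  exact Finset.sum_congr rfl fun i _ => by ring

theorem eulerD_const_mul (c : ℝ) (hu : DifferentiableAt ℝ u x) :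
    eulerD (fun y => c * u y) x = c * eulerD u x := by
  simp only [eulerD, partialD_const_mul _ c hu, Finset.mul_sum]
  exact Finset.sum_congr rfl fun i _ => by ring

theorem eulerD_comp {φ : ℝ → ℝ} {φ' : ℝ} (hφ : HasDerivAt φ φ' (u x))
    (hu : DifferentiableAt ℝ u x) :
    eulerD (fun y => φ (u y)) x = φ' * eulerD u x := by
  simp only [eulerD, partialD_comp _ hφ hu, Finset.mul_sum]
  exact Finset.sum_congr rfl fun i _ => by ring

theorem lap_norm_sub_sq (ξ : EuclideanSpace ℝ (Fin d)) :
    lap (fun y => ‖y - ξ‖ ^ 2) x = 2 * d := by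
  have h (i : Fin d) : partialD i (fun y : EuclideanSpace ℝ (Fin d) => ‖y - ξ‖ ^ 2) =
      fun y => 2 * (y i + -ξ i) := by
    funext y; rw [partialD_norm_sub_sq]; ring
  have h2 (i : Fin d) : partialD i (fun y : EuclideanSpace ℝ (Fin d) => 2 * (y i + -ξ i)) x = 2 := by
    have hd : DifferentiableAt ℝ (fun y : EuclideanSpace ℝ (Fin d) => y i) x := by fun_prop
    rw [partialD_const_mul i 2 (hd.fun_add (differentiableAt_const _)),
      partialD_add i hd (differentiableAt_const _), partialD_coord, partialD_const]
    simp
  simp [lap, h, h2, mul_comm]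

theorem lap_norm_sq : lap (fun y : EuclideanSpace ℝ (Fin d) => ‖y‖ ^ 2) x = 2 * d := by
  simpa using lap_norm_sub_sq (x := x) 0

theorem eulerD_norm_sq : eulerD (fun y : EuclideanSpace ℝ (Fin d) => ‖y‖ ^ 2) x = 2 * ‖x‖ ^ 2 := by
  simp only [eulerD, partialD_norm_sq]
  rw [EuclideanSpace.real_norm_sq_eq, Finset.mul_sum]
  exact Finset.sum_congr rfl fun i _ => by ring

end PartialDerivatives

/-! ### The hyperbolic Laplacian in Euclidean coordinates. -/

section ConformalLaplacian

variable {d : ℕ} {x : EuclideanSpace ℝ (Fin d)}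

theorem defFun_pos (hx : ‖x‖ < 1) : 0 < defFun x := by
  have : ‖x‖ ^ 2 < 1 := by nlinarith [norm_nonneg x]
  rw [defFun]; linarith

theorem contDiff_defFun {m : WithTop ℕ∞} :
    ContDiff ℝ m (defFun : EuclideanSpace ℝ (Fin d) → ℝ) := by
  unfold defFun
  exact (contDiff_const.sub (contDiff_norm_sq ℝ)).div_const _

theorem partialD_defFun (i : Fin d) : partialD i defFun x = -x i := by
  have h : (defFun : EuclideanSpace ℝ (Fin d) → ℝ) = fun y => (-1 / 2) * ‖y‖ ^ 2 + 1 / 2 := by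
    funext y; rw [defFun]; ring
  have hd : DifferentiableAt ℝ (fun y : EuclideanSpace ℝ (Fin d) => ‖y‖ ^ 2) x :=
    (contDiff_norm_sq ℝ (n := 1)).differentiable one_ne_zero x
  rw [h, partialD_add i (hd.const_mul _) (differentiableAt_const _), partialD_const_mul i _ hd,
    partialD_norm_sq, partialD_const]
  ring

theorem ballMetric_eq (hx : ‖x‖ < 1) :
    ballMetric d x = (defFun x ^ 2)⁻¹ • (1 : Matrix (Fin d) (Fin d) ℝ) := by
  have h := (defFun_pos hx).ne'
  have h2 : (1 - ‖x‖ ^ 2) = 2 * defFun x := by rw [defFun]; ring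
  rw [ballMetric, h2]
  congr 1
  field_simp
  norm_num

theorem sqrt_det_ballMetric (hx : ‖x‖ < 1) :
    Real.sqrt (ballMetric d x).det = (defFun x ^ d)⁻¹ := by
  have h := defFun_pos hx
  rw [ballMetric_eq hx, Matrix.det_smul, Matrix.det_one, mul_one, Fintype.card_fin,
    show ((defFun x ^ 2)⁻¹) ^ d = ((defFun x ^ d)⁻¹) ^ 2 by
      rw [inv_pow, inv_pow, ← pow_mul, ← pow_mul, mul_comm],
    Real.sqrt_sq (by positivity)]

theorem ballMetric_inv (hx : ‖x‖ < 1) :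
    (ballMetric d x)⁻¹ = (defFun x ^ 2) • (1 : Matrix (Fin d) (Fin d) ℝ) := by
  have h := (defFun_pos hx).ne'
  apply Matrix.inv_eq_right_inv
  rw [ballMetric_eq hx, smul_mul_smul_comm, one_mul, inv_mul_cancel₀ (by positivity), one_smul]

/-- The hyperbolic Laplacian of the ball in Euclidean terms:
`Δ_g = ρ² Δ + (d - 2) ρ x·∇`. -/
theorem laplaceBeltrami_ballMetric {u : EuclideanSpace ℝ (Fin d) → ℝ} (hx : ‖x‖ < 1)
    (hu : ContDiffAt ℝ 2 u x) :
    laplaceBeltrami (ballMetric d) u x =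
      defFun x ^ 2 * lap u x + (d - 2) * defFun x * eulerD u x := by
  have hρ := defFun_pos hx
  have hev : ∀ᶠ y in 𝓝 x, ‖y‖ < 1 := continuous_norm.continuousAt.eventually_lt
    continuousAt_const hx
  -- Since √|g| = ρ^{-d} and g^{ij} = ρ² δ_{ij}, the flux is φ(ρ) ∂_i u. The quotient form of
  -- ρ^{2-d} avoids truncated subtraction for d > 2.
  set φ : ℝ → ℝ := fun t => t ^ 2 / t ^ d
  have hφ : HasDerivAt φ ((2 - d) * defFun x / defFun x ^ d) (defFun x) := by
    have := ((hasDerivAt_pow 2 (defFun x)).div (hasDerivAt_pow d (defFun x)) (by positivity))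
    refine this.congr_deriv ?_
    -- At d = 0 the exponent d - 1 is truncated, but the factor d vanishes.
    have h3 : (d : ℝ) * defFun x ^ (d - 1) * defFun x ^ 2 = d * defFun x ^ d * defFun x := by
      rcases d with _ | d
      · simp
      · simp [pow_succ]; ring
    field_simp
    simp only [Nat.cast_ofNat]
    linear_combination -h3
  have hcomp : DifferentiableAt ℝ (fun y => φ (defFun y)) x :=
    hφ.differentiableAt.comp x ((contDiff_defFun (m := 1)).differentiable one_ne_zero x)
  have key (i : Fin d) : partialD i (fun y => Real.sqrt (ballMetric d y).det *
      ∑ j, (ballMetric d y)⁻¹ i j * partialD j u y) x =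
      φ (defFun x) * partialD i (partialD i u) x +
        partialD i u x * ((2 - d) * defFun x / defFun x ^ d * (-x i)) := by
    have h : (fun y => Real.sqrt (ballMetric d y).det *
        ∑ j, (ballMetric d y)⁻¹ i j * partialD j u y) =ᶠ[𝓝 x]
        fun y => φ (defFun y) * partialD i u y := by
      filter_upwards [hev] with y hy
      rw [sqrt_det_ballMetric hy, ballMetric_inv hy]
      simp [Matrix.smul_apply, Matrix.one_apply, φ]
      ring
    rw [partialD_congr i h, partialD_mul i hcomp (hu.differentiableAt_partialD i),
      partialD_comp i hφ ((contDiff_defFun (m := 1)).differentiable one_ne_zero x),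
      partialD_defFun]
  rw [laplaceBeltrami, sqrt_det_ballMetric hx, Finset.sum_congr rfl fun i _ => key i,
    Finset.sum_add_distrib, ← Finset.mul_sum, ← lap, eulerD]
  have h2 : ∑ i, partialD i u x * ((2 - d) * defFun x / defFun x ^ d * (-x i)) =
      (d - 2) * defFun x / defFun x ^ d * ∑ i, x i * partialD i u x := by
    rw [Finset.mul_sum]
    exact Finset.sum_congr rfl fun i _ => by ring
  rw [h2]
  simp only [φ]
  field_simp

/-- The operator `-Δ_g - s (n - s)` of the hyperbolic ball of dimension `n + 1`. -/
def scatteringOp (n : ℕ) (s : ℝ) (u : EuclideanSpace ℝ (Fin (n + 1)) → ℝ)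
    (x : EuclideanSpace ℝ (Fin (n + 1))) : ℝ :=
  -laplaceBeltrami (ballMetric (n + 1)) u x - s * (n - s) * u x

variable {n : ℕ} {s : ℝ} {u v : EuclideanSpace ℝ (Fin (n + 1)) → ℝ}
  {x : EuclideanSpace ℝ (Fin (n + 1))}

theorem scatteringOp_eq (hx : ‖x‖ < 1) (hu : ContDiffAt ℝ 2 u x) :
    scatteringOp n s u x =
      -(defFun x ^ 2 * lap u x + (n - 1) * defFun x * eulerD u x) - s * (n - s) * u x := by
  rw [scatteringOp, laplaceBeltrami_ballMetric hx hu]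
  push_cast
  ring

theorem scatteringOp_congr (hx : ‖x‖ < 1) (hu : ContDiffAt ℝ 2 u x) (h : u =ᶠ[𝓝 x] v) :
    scatteringOp n s v x = scatteringOp n s u x := by
  rw [scatteringOp_eq hx hu, scatteringOp_eq hx (hu.congr_of_eventuallyEq h.symm), lap_congr h,
    eulerD_congr h, h.self_of_nhds]

theorem scatteringOp_add (hx : ‖x‖ < 1) (hu : ContDiffAt ℝ 2 u x) (hv : ContDiffAt ℝ 2 v x) :
    scatteringOp n s (fun y => u y + v y) x = scatteringOp n s u x + scatteringOp n s v x := by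
  rw [scatteringOp_eq hx (hu.add hv), scatteringOp_eq hx hu, scatteringOp_eq hx hv, lap_add hu hv,
    eulerD_add (hu.differentiableAt two_ne_zero) (hv.differentiableAt two_ne_zero)]
  ring

theorem scatteringOp_const_mul (c : ℝ) (hx : ‖x‖ < 1) (hu : ContDiffAt ℝ 2 u x) :
    scatteringOp n s (fun y => c * u y) x = c * scatteringOp n s u x := by
  rw [scatteringOp_eq hx (contDiffAt_const.mul hu), scatteringOp_eq hx hu, lap_const_mul c hu,
    eulerD_const_mul c (hu.differentiableAt two_ne_zero)]
  ring

theorem scatteringOp_sub (hx : ‖x‖ < 1) (hu : ContDiffAt ℝ 2 u x) (hv : ContDiffAt ℝ 2 v x) :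
    scatteringOp n s (fun y => u y - v y) x = scatteringOp n s u x - scatteringOp n s v x := by
  have h : (fun y => u y - v y) = fun y => u y + (-1) * v y := by funext y; ring
  rw [h, scatteringOp_add hx hu (contDiffAt_const.mul hv), scatteringOp_const_mul _ hx hv]
  ring

end ConformalLaplacian

end

noncomputable section

open Filter Topology

/-! ### Powers of the Poisson kernel solve the equation. -/

section PoissonKernel

variable {n : ℕ} {s : ℝ} {x ξ : EuclideanSpace ℝ (Fin (n + 1))}

theorem lap_defFun {d : ℕ} {x : EuclideanSpace ℝ (Fin d)} : lap defFun x = -(d : ℝ) := by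
  have h (i : Fin d) : partialD i (defFun : EuclideanSpace ℝ (Fin d) → ℝ) =
      fun y => (-1) * y i := by funext y; rw [partialD_defFun]; ring
  have hd (i : Fin d) : DifferentiableAt ℝ (fun y : EuclideanSpace ℝ (Fin d) => y i) x := by
    fun_prop
  have h2 (i : Fin d) : partialD i (fun y : EuclideanSpace ℝ (Fin d) => (-1) * y i) x = -1 := by
    rw [partialD_const_mul _ _ (hd _), partialD_coord]
    simp
  rw [lap, Finset.sum_congr rfl fun i _ => by rw [h, h2]]
  simp

/-- The Poisson kernel `ρ(x) / |x - ξ|²` of the ball. -/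
def ballKernel {d : ℕ} (ξ x : EuclideanSpace ℝ (Fin d)) : ℝ := defFun x * (‖x - ξ‖ ^ 2)⁻¹

theorem ballKernel_pos {d : ℕ} {x ξ : EuclideanSpace ℝ (Fin d)} (hx : ‖x‖ < 1) (hξ : ‖ξ‖ = 1) :
    0 < ballKernel ξ x := by
  have h : 0 < ‖x - ξ‖ := norm_pos_iff.2 (sub_ne_zero.2 (by rintro rfl; exact hx.ne hξ))
  have := defFun_pos hx
  unfold ballKernel
  positivity

/-- `Δ_g p^s = s (s - n) p^s` for the Poisson kernel `p`. -/
theorem scatteringOp_ballKernel_rpow (hx : ‖x‖ < 1) (hξ : ‖ξ‖ = 1) :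
    scatteringOp n s (fun y => ballKernel ξ y ^ s) x = 0 := by
  have hne : 0 < ‖x - ξ‖ := norm_pos_iff.2 (sub_ne_zero.2 (by rintro rfl; exact hx.ne hξ))
  have hD : 0 < ‖x - ξ‖ ^ 2 := by positivity
  have hp := ballKernel_pos hx hξ
  have cD : ContDiffAt ℝ 2 (fun y => ‖y - ξ‖ ^ 2) x :=
    ((contDiff_id.sub contDiff_const).norm_sq ℝ).contDiffAt
  have cI : ContDiffAt ℝ 2 (fun y => (‖y - ξ‖ ^ 2)⁻¹) x := cD.inv hD.ne'
  have cρ : ContDiffAt ℝ 2 (defFun : EuclideanSpace ℝ (Fin (n + 1)) → ℝ) x :=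
    contDiff_defFun.contDiffAt
  have dD := cD.differentiableAt two_ne_zero
  have dI := cI.differentiableAt two_ne_zero
  have dρ := cρ.differentiableAt two_ne_zero
  have cp : ContDiffAt ℝ 2 (ballKernel ξ) x := cρ.mul cI
  have hinv : ∀ t : ℝ, t ≠ 0 → HasDerivAt (fun t : ℝ => t⁻¹) (-(t ^ 2)⁻¹) t :=
    fun t ht => hasDerivAt_inv ht
  have hpI (i) : partialD i (fun y => (‖y - ξ‖ ^ 2)⁻¹) x =
      -((‖x - ξ‖ ^ 2) ^ 2)⁻¹ * (2 * (x i - ξ i)) := by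
    rw [partialD_comp i (hinv _ hD.ne') dD, partialD_norm_sub_sq]
  have hp_i (i) : partialD i (ballKernel ξ) x =
      defFun x * (-((‖x - ξ‖ ^ 2) ^ 2)⁻¹ * (2 * (x i - ξ i))) + (‖x - ξ‖ ^ 2)⁻¹ * (-x i) := by
    unfold ballKernel
    rw [partialD_mul i dρ dI, hpI, partialD_defFun]
  have hlapI : lap (fun y => (‖y - ξ‖ ^ 2)⁻¹) x =
      (2 * ((‖x - ξ‖ ^ 2) ^ 3)⁻¹) * (4 * ‖x - ξ‖ ^ 2) -
        ((‖x - ξ‖ ^ 2) ^ 2)⁻¹ * (2 * (n + 1)) := by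
    have h2 : HasDerivAt (fun t : ℝ => -(t ^ 2)⁻¹) (2 * ((‖x - ξ‖ ^ 2) ^ 3)⁻¹) (‖x - ξ‖ ^ 2) := by
      refine ((hasDerivAt_pow 2 (‖x - ξ‖ ^ 2)).fun_inv (by positivity)).fun_neg.congr_deriv ?_
      field_simp
      norm_num
      ring
    rw [lap_comp (φ' := fun t => -(t ^ 2)⁻¹) cD
      ((isOpen_ne.eventually_mem hD.ne').mono fun t ht => hinv t ht) h2, lap_norm_sub_sq]
    simp only [partialD_norm_sub_sq]
    have : ∑ i, (2 * (x i - ξ i)) ^ 2 = 4 * ‖x - ξ‖ ^ 2 := by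
      rw [EuclideanSpace.real_norm_sq_eq, Finset.mul_sum]
      exact Finset.sum_congr rfl fun i _ => by simp; ring
    rw [this]
    push_cast
    ring
  -- With D = |x-ξ|², the inner products of x and ξ are functions of ρ and D alone, so the gradient,
  -- Euler derivative and Laplacian of the kernel become rational in ρ and D.
  have hX : ∑ i, x i * x i = 1 - 2 * defFun x := by
    have := EuclideanSpace.real_norm_sq_eq x
    simp only [pow_two] at this
    rw [← this, defFun]; ring
  have hΞ : ∑ i, ξ i * ξ i = 1 := by
    have := EuclideanSpace.real_norm_sq_eq ξ
    simp only [pow_two] at this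
    rw [← this, hξ]; ring
  have hQ : ∑ i, x i * ξ i = (2 - 2 * defFun x - ‖x - ξ‖ ^ 2) / 2 := by
    have h1 := EuclideanSpace.real_norm_sq_eq (x - ξ)
    have h2 : ∑ i, (x - ξ) i ^ 2 = ∑ i, x i * x i - 2 * ∑ i, x i * ξ i + ∑ i, ξ i * ξ i := by
      rw [Finset.mul_sum, ← Finset.sum_sub_distrib, ← Finset.sum_add_distrib]
      exact Finset.sum_congr rfl fun i _ => by simp; ring
    rw [hX, hΞ] at h2
    linarith
  -- This says ρ|∇p| = p: the hyperbolic gradient of p has length p. Combined with Δ_g p = (1-n)p it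
  -- yields s(s-1) + s(1-n) = s(s-n) for the power p^s.
  have hgrad : ∑ i, partialD i (ballKernel ξ) x ^ 2 = ((‖x - ξ‖ ^ 2) ^ 2)⁻¹ := by
    have : ∀ i, partialD i (ballKernel ξ) x ^ 2 =
        (2 * defFun x * ((‖x - ξ‖ ^ 2) ^ 2)⁻¹ + (‖x - ξ‖ ^ 2)⁻¹) ^ 2 * (x i * x i)
        + (-2 * (2 * defFun x * ((‖x - ξ‖ ^ 2) ^ 2)⁻¹ + (‖x - ξ‖ ^ 2)⁻¹) *
          (2 * defFun x * ((‖x - ξ‖ ^ 2) ^ 2)⁻¹)) * (x i * ξ i)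
        + (2 * defFun x * ((‖x - ξ‖ ^ 2) ^ 2)⁻¹) ^ 2 * (ξ i * ξ i) := by
      intro i; rw [hp_i]; ring
    rw [Finset.sum_congr rfl fun i _ => this i, Finset.sum_add_distrib, Finset.sum_add_distrib,
      ← Finset.mul_sum, ← Finset.mul_sum, ← Finset.mul_sum, hX, hΞ, hQ]
    generalize ‖x - ξ‖ ^ 2 = D at hD
    field_simp
    ring
  have heul : eulerD (ballKernel ξ) x =
      -2 * defFun x * ((‖x - ξ‖ ^ 2) ^ 2)⁻¹ * ((‖x - ξ‖ ^ 2 - 2 * defFun x) / 2) -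
        (‖x - ξ‖ ^ 2)⁻¹ * (1 - 2 * defFun x) := by
    have : ∀ i, x i * partialD i (ballKernel ξ) x =
        -(2 * defFun x * ((‖x - ξ‖ ^ 2) ^ 2)⁻¹ + (‖x - ξ‖ ^ 2)⁻¹) * (x i * x i)
        + (2 * defFun x * ((‖x - ξ‖ ^ 2) ^ 2)⁻¹) * (x i * ξ i) := by
      intro i; rw [hp_i]; ring
    rw [eulerD, Finset.sum_congr rfl fun i _ => this i, Finset.sum_add_distrib, ← Finset.mul_sum,
      ← Finset.mul_sum, hX, hQ]
    ring
  have hlap : lap (ballKernel ξ) x = defFun x * ((8 - 2 * (n + 1)) * ((‖x - ξ‖ ^ 2) ^ 2)⁻¹) +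
      4 * ((‖x - ξ‖ ^ 2) ^ 2)⁻¹ * ((‖x - ξ‖ ^ 2 - 2 * defFun x) / 2) -
        (n + 1) * (‖x - ξ‖ ^ 2)⁻¹ := by
    have h0 : lap (ballKernel ξ) x = lap (fun y => defFun y * (‖y - ξ‖ ^ 2)⁻¹) x := rfl
    have : ∀ i, partialD i defFun x * partialD i (fun y => (‖y - ξ‖ ^ 2)⁻¹) x =
        2 * ((‖x - ξ‖ ^ 2) ^ 2)⁻¹ * (x i * x i) + -2 * ((‖x - ξ‖ ^ 2) ^ 2)⁻¹ * (x i * ξ i) := by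
      intro i; rw [hpI, partialD_defFun]; ring
    rw [h0, lap_mul cρ cI, hlapI, lap_defFun, Finset.sum_congr rfl fun i _ => this i,
      Finset.sum_add_distrib, ← Finset.mul_sum, ← Finset.mul_sum, hX, hQ]
    push_cast
    generalize ‖x - ξ‖ ^ 2 = D at hD
    field_simp
    ring
  have hφ1 : ∀ t : ℝ, 0 < t → HasDerivAt (fun t : ℝ => t ^ s) (s * t ^ (s - 1)) t :=
    fun t ht => Real.hasDerivAt_rpow_const (.inl ht.ne')
  have hφ2 : HasDerivAt (fun t : ℝ => s * t ^ (s - 1))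
      (s * ((s - 1) * ballKernel ξ x ^ (s - 1 - 1))) (ballKernel ξ x) :=
    (Real.hasDerivAt_rpow_const (.inl hp.ne')).const_mul s
  have cps : ContDiffAt ℝ 2 (fun y => ballKernel ξ y ^ s) x := cp.rpow_const_of_ne hp.ne'
  rw [scatteringOp_eq hx cps, lap_comp (φ' := fun t => s * t ^ (s - 1)) cp
    ((lt_mem_nhds hp).mono fun t ht => hφ1 t ht) hφ2,
    eulerD_comp (hφ1 _ hp) (cp.differentiableAt two_ne_zero), hgrad, hlap, heul,
    Real.rpow_sub_one hp.ne', Real.rpow_sub_one hp.ne']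
  have hρ := defFun_pos hx
  generalize ballKernel ξ x ^ s = P
  unfold ballKernel
  generalize ‖x - ξ‖ ^ 2 = D at hD
  generalize defFun x = ρ at hρ
  field_simp
  ring

end PoissonKernel

/-! ### Separation of variables: a radial factor times a homogeneous harmonic function. -/

section RadialTimesHarmonic

variable {n : ℕ} {s : ℝ} {h : EuclideanSpace ℝ (Fin (n + 1)) → ℝ}
  {x : EuclideanSpace ℝ (Fin (n + 1))} {g g' : ℝ → ℝ} {g'' l : ℝ}

/-- The gradient of g(|x|²) is radial, so the cross term 2∇g·∇h involves only the Euler derivative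
of h, equal to l h. The operator therefore acts on g as an ordinary differential operator in z =
|x|². -/
theorem scatteringOp_radial_mul (hx : ‖x‖ < 1) (hh : ContDiffAt ℝ 2 h x) (hlap : lap h x = 0)
    (heul : eulerD h x = l * h x) (cg : ContDiffAt ℝ 2 g (‖x‖ ^ 2))
    (h1 : ∀ᶠ t in 𝓝 (‖x‖ ^ 2), HasDerivAt g (g' t) t) (h2 : HasDerivAt g' g'' (‖x‖ ^ 2)) :
    scatteringOp n s (fun y => g (‖y‖ ^ 2) * h y) x =
      -(defFun x ^ 2 * (4 * ‖x‖ ^ 2 * g'' + (2 * (n + 1) + 4 * l) * g' (‖x‖ ^ 2)) +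
        (n - 1) * defFun x * (2 * ‖x‖ ^ 2 * g' (‖x‖ ^ 2) + l * g (‖x‖ ^ 2)) +
          s * (n - s) * g (‖x‖ ^ 2)) * h x := by
  have cN : ContDiffAt ℝ 2 (fun y : EuclideanSpace ℝ (Fin (n + 1)) => ‖y‖ ^ 2) x :=
    (contDiff_norm_sq ℝ).contDiffAt
  have cgN : ContDiffAt ℝ 2 (fun y : EuclideanSpace ℝ (Fin (n + 1)) => g (‖y‖ ^ 2)) x :=
    ContDiffAt.comp x cg cN
  have dN := cN.differentiableAt two_ne_zero
  have dg := cgN.differentiableAt two_ne_zero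
  have dh := hh.differentiableAt two_ne_zero
  have e1 : ∑ i, partialD i (fun y : EuclideanSpace ℝ (Fin (n + 1)) => ‖y‖ ^ 2) x ^ 2 =
      4 * ‖x‖ ^ 2 := by
    simp only [partialD_norm_sq]
    rw [EuclideanSpace.real_norm_sq_eq, Finset.mul_sum]
    exact Finset.sum_congr rfl fun i _ => by ring
  have e2 : ∑ i, partialD i (fun y : EuclideanSpace ℝ (Fin (n + 1)) => g (‖y‖ ^ 2)) x *
      partialD i h x = 2 * g' (‖x‖ ^ 2) * (l * h x) := by
    rw [← heul, eulerD, Finset.mul_sum]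
    refine Finset.sum_congr rfl fun i _ => ?_
    rw [partialD_comp i h1.self_of_nhds dN, partialD_norm_sq]
    ring
  rw [scatteringOp_eq hx (cgN.mul hh), lap_mul cgN hh, lap_comp cN h1 h2, e1, e2, lap_norm_sq,
    eulerD_mul dg dh, eulerD_comp h1.self_of_nhds dN, eulerD_norm_sq, hlap, heul]
  push_cast
  ring

/-- If `φ` solves the hypergeometric equation with parameters `l + n/2 - γ`, `1/2 - γ`,
`l + (n+1)/2`, then `ρ^{n/2-γ} φ(|x|²) h` solves the scattering equation for every harmonic `h`
that is homogeneous of degree `l`. -/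
theorem scatteringOp_profile_mul {γ : ℝ} (hs : s = n / 2 + γ) {φ φ' : ℝ → ℝ} {φ'' : ℝ}
    (hx : ‖x‖ < 1) (hh : ContDiffAt ℝ 2 h x) (hlap : lap h x = 0) (heul : eulerD h x = l * h x)
    (cφ : ContDiffAt ℝ 2 φ (‖x‖ ^ 2)) (h1 : ∀ᶠ t in 𝓝 (‖x‖ ^ 2), HasDerivAt φ (φ' t) t)
    (h2 : HasDerivAt φ' φ'' (‖x‖ ^ 2)) :
    scatteringOp n s (fun y => defFun y ^ ((n : ℝ) / 2 - γ) * φ (‖y‖ ^ 2) * h y) x =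
      -(2 * defFun x ^ ((n : ℝ) / 2 - γ + 1) * (‖x‖ ^ 2 * (1 - ‖x‖ ^ 2) * φ'' +
        (l + (n + 1) / 2 - (l + n / 2 - γ + (1 / 2 - γ) + 1) * ‖x‖ ^ 2) * φ' (‖x‖ ^ 2) -
        (l + n / 2 - γ) * (1 / 2 - γ) * φ (‖x‖ ^ 2))) * h x := by
  set a : ℝ := (n : ℝ) / 2 - γ with ha
  have hρ := defFun_pos hx
  have hρ' : (1 - ‖x‖ ^ 2) / 2 = defFun x := rfl
  have hd (t : ℝ) : HasDerivAt (fun t : ℝ => (1 - t) / 2) (-1 / 2) t :=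
    ((hasDerivAt_id t).const_sub 1).div_const 2
  have hr (b t : ℝ) (ht : 0 < (1 - t) / 2) : HasDerivAt (fun t : ℝ => ((1 - t) / 2) ^ b)
      (-b / 2 * ((1 - t) / 2) ^ (b - 1)) t :=
    ((hd t).rpow_const (.inl ht.ne')).congr_deriv (by ring)
  have hev : ∀ᶠ t in 𝓝 (‖x‖ ^ 2), 0 < (1 - t) / 2 :=
    (hd _).continuousAt.eventually (lt_mem_nhds (show 0 < (1 - ‖x‖ ^ 2) / 2 from hρ))
  have H1 : ∀ᶠ t in 𝓝 (‖x‖ ^ 2), HasDerivAt (fun t : ℝ => ((1 - t) / 2) ^ a * φ t)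
      (-a / 2 * ((1 - t) / 2) ^ (a - 1) * φ t + ((1 - t) / 2) ^ a * φ' t) t := by
    filter_upwards [hev, h1] with t ht h1t using (hr a t ht).mul h1t
  have H2 := (((hr (a - 1) _ hev.self_of_nhds).const_mul (-a / 2)).mul h1.self_of_nhds).add
    ((hr a _ hev.self_of_nhds).mul h2)
  have hC : ContDiffAt ℝ 2 (fun t : ℝ => ((1 - t) / 2) ^ a * φ t) (‖x‖ ^ 2) := by
    refine ContDiffAt.mul (ContDiffAt.rpow_const_of_ne ?_ hev.self_of_nhds.ne') cφ
    fun_prop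
  refine (scatteringOp_radial_mul (g := fun t => ((1 - t) / 2) ^ a * φ t) hx hh hlap heul hC H1
    H2).trans ?_
  simp only [hρ', Real.rpow_sub_one hρ.ne', Real.rpow_add_one hρ.ne']
  -- Eliminating |x|² in favour of ρ, and γ in favour of a = n/2 - γ, leaves an identity of rational
  -- expressions.
  have hz : ‖x‖ ^ 2 = 1 - 2 * defFun x := by rw [defFun]; ring
  simp only [hz]
  rw [hs]
  have hγ : γ = n / 2 - a := by rw [ha]; ring
  generalize defFun x ^ a = P
  generalize φ (1 - 2 * defFun x) = f0
  generalize φ' (1 - 2 * defFun x) = f1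
  generalize defFun x = ρ at hρ
  rw [hγ]
  field_simp
  ring

theorem lap_const {d : ℕ} {x : EuclideanSpace ℝ (Fin d)} (c : ℝ) : lap (fun _ => c) x = 0 := by
  have h (i : Fin d) : partialD i (fun _ : EuclideanSpace ℝ (Fin d) => c) = fun _ => 0 := by
    funext y; exact partialD_const i c
  simp [lap, h, partialD_const]

/-- `ρ^{n/2}` is a strict supersolution of the scattering equation. -/
theorem scatteringOp_defFun_rpow {γ : ℝ} (hs : s = n / 2 + γ) (hx : ‖x‖ < 1) :
    scatteringOp n s (fun y => defFun y ^ ((n : ℝ) / 2)) x =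
      γ ^ 2 * defFun x ^ ((n : ℝ) / 2) + n / 2 * defFun x ^ ((n : ℝ) / 2 + 1) := by
  have hρ := defFun_pos hx
  have hρ' : (1 - ‖x‖ ^ 2) / 2 = defFun x := rfl
  -- For γ = 0, l = 0, φ = 1 only the zeroth-order term with coefficient (n/2)(1/2) survives.
  -- Passing from s = n/2 to n/2 + γ lowers s(n-s) by γ², which gives the other summand.
  have h := scatteringOp_profile_mul (γ := 0) (φ := fun _ => 1) (φ' := fun _ => 0) (φ'' := 0)
    (h := fun _ => 1) (l := 0) (s := n / 2 + 0) (x := x) rfl hx contDiffAt_const (lap_const 1)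
    (by simp [eulerD, partialD_const]) contDiffAt_const
    (Eventually.of_forall fun t => hasDerivAt_const t 1) (hasDerivAt_const _ _)
  simp only [sub_zero, mul_one, add_zero] at h
  have h0 : scatteringOp n s (fun y => defFun y ^ ((n : ℝ) / 2)) x =
      scatteringOp n (n / 2) (fun y => defFun y ^ ((n : ℝ) / 2)) x +
        γ ^ 2 * defFun x ^ ((n : ℝ) / 2) := by
    simp only [scatteringOp, hs]
    ring
  rw [h0, h]
  ring

end RadialTimesHarmonic

end

noncomputable section

open Filter Topology MeasureTheory

/-! ### Termwise differentiation of real power series. -/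

section RealPowerSeries

/-- Tangent-line inequality for the convex function t ↦ t^{j+1}. It bounds the differentiated series
at radius r by the original one at a larger radius r'. -/
theorem succ_mul_pow_mul_sub_le {r r' : ℝ} (hr : 0 ≤ r) (h : r ≤ r') (j : ℕ) :
    (j + 1) * r ^ j * (r' - r) + r ^ (j + 1) ≤ r' ^ (j + 1) := by
  induction j with
  | zero => simp
  | succ j ih =>
    have h1 := mul_le_mul_of_nonneg_left ih (hr.trans h)
    have h2 : 0 ≤ (j + 1) * r ^ j * (r' - r) * (r' - r) :=
      mul_nonneg (mul_nonneg (by positivity) (sub_nonneg.2 h)) (sub_nonneg.2 h)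
    push_cast
    calc _ = r' * ((j + 1) * r ^ j * (r' - r) + r ^ (j + 1)) -
          (j + 1) * r ^ j * (r' - r) * (r' - r) := by ring
      _ ≤ r' * r' ^ (j + 1) := by linarith
      _ = _ := by ring

variable {c : ℕ → ℝ} {R : ℝ}

/-- The power series with coefficients `c` converges absolutely on `|x| < R`. -/
def ConvergesOn (c : ℕ → ℝ) (R : ℝ) : Prop :=
  ∀ r, 0 ≤ r → r < R → Summable fun j => |c j| * r ^ j

theorem ConvergesOn.summable (h : ConvergesOn c R) {x : ℝ} (hx : |x| < R) :
    Summable fun j => c j * x ^ j := by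
  refine Summable.of_norm ?_
  simpa [abs_mul] using h |x| (abs_nonneg x) hx

theorem ConvergesOn.deriv (h : ConvergesOn c R) :
    ConvergesOn (fun j => (j + 1) * c (j + 1)) R := by
  intro r hr hrR
  obtain ⟨r', h1, h2⟩ := exists_between hrR
  have hδ : 0 < r' - r := sub_pos.2 h1
  have hs := ((summable_nat_add_iff 1).2 (h r' (hr.trans h1.le) h2)).mul_right (r' - r)⁻¹
  refine hs.of_nonneg_of_le (fun j => by positivity) fun j => ?_
  rw [← div_eq_mul_inv, le_div_iff₀ hδ, abs_mul, abs_of_nonneg (by positivity : (0:ℝ) ≤ j + 1)]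
  have h3 := succ_mul_pow_mul_sub_le hr h1.le j
  have h4 : 0 ≤ r ^ (j + 1) := by positivity
  calc _ = |c (j + 1)| * ((j + 1) * r ^ j * (r' - r)) := by ring
    _ ≤ _ := mul_le_mul_of_nonneg_left (by linarith) (abs_nonneg _)

theorem ConvergesOn.hasDerivAt (h : ConvergesOn c R) {x : ℝ} (hx : |x| < R) :
    HasDerivAt (fun x => ∑' j, c j * x ^ j) (∑' j, (j + 1) * c (j + 1) * x ^ j) x := by
  obtain ⟨r, h1, h2⟩ := exists_between hx
  have hr : 0 ≤ r := (abs_nonneg x).trans h1.le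
  have hsum : Summable fun j : ℕ => (j : ℝ) * |c j| * r ^ (j - 1) := by
    rw [← summable_nat_add_iff 1]
    refine (h.deriv r hr h2).congr fun j => ?_
    rw [abs_mul, abs_of_nonneg (by positivity : (0:ℝ) ≤ j + 1)]
    simp
  have key := hasDerivAt_tsum_of_isPreconnected (g := fun j x => c j * x ^ j)
    (g' := fun j x => c j * (j * x ^ (j - 1))) (y₀ := x) (y := x) hsum
    (Metric.isOpen_ball (x := (0 : ℝ)) (ε := r)) (convex_ball _ _).isPreconnected
    (fun j y _ => (hasDerivAt_pow j y).const_mul (c j)) ?_ (by simpa using h1) (h.summable hx)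
    (by simpa using h1)
  · refine key.congr_deriv ?_
    have hs : Summable fun j : ℕ => c j * (j * x ^ (j - 1)) := by
      refine Summable.of_norm_bounded hsum fun j => ?_
      rw [norm_mul, norm_mul, norm_pow, Real.norm_natCast, Real.norm_eq_abs, Real.norm_eq_abs,
        mul_left_comm, ← mul_assoc]
      gcongr
    rw [hs.tsum_eq_zero_add]
    simp only [Nat.cast_zero, zero_mul, mul_zero, zero_add]
    refine tsum_congr fun j => ?_
    push_cast
    ring
  · intro j y hy
    rw [norm_mul, norm_mul, norm_pow, Real.norm_natCast, Real.norm_eq_abs, Real.norm_eq_abs,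
      mul_left_comm, ← mul_assoc]
    have : |y| ≤ r := by simpa using (mem_ball_zero_iff.1 hy).le
    gcongr

theorem ConvergesOn.contDiffOn (h : ConvergesOn c R) (N : ℕ) :
    ContDiffOn ℝ N (fun x => ∑' j, c j * x ^ j) (Metric.ball 0 R) := by
  induction N generalizing c with
  | zero =>
    exact contDiffOn_zero.2 fun x hx =>
      (h.hasDerivAt (by simpa using hx)).continuousAt.continuousWithinAt
  | succ N ih =>
    push_cast
    rw [contDiffOn_succ_iff_deriv_of_isOpen Metric.isOpen_ball]
    refine ⟨fun x hx => (h.hasDerivAt (by simpa using hx)).differentiableAt.differentiableWithinAt,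
      by simp, (ih h.deriv).congr fun x hx => (h.hasDerivAt (by simpa using hx)).deriv⟩

theorem ConvergesOn.contDiffOn_infty (h : ConvergesOn c R) :
    ContDiffOn ℝ ∞ (fun x => ∑' j, c j * x ^ j) (Metric.ball 0 R) :=
  _root_.contDiffOn_infty.2 h.contDiffOn

/-- The factor x restores the exponent lost by differentiation, so the terms of an ODE can be
compared coefficient by coefficient. -/
theorem ConvergesOn.mul_hasSum (h : ConvergesOn c R) {x : ℝ} (hx : |x| < R) :
    HasSum (fun j : ℕ => (j : ℝ) * c j * x ^ j) (x * ∑' j : ℕ, (j + 1) * c (j + 1) * x ^ j) := by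
  rw [← hasSum_nat_add_iff' 1]
  simp only [Finset.range_one, Finset.sum_singleton, Nat.cast_zero, zero_mul, sub_zero]
  refine ((h.deriv.summable hx).hasSum.mul_left x).congr_fun fun j => ?_
  push_cast
  ring

end RealPowerSeries

/-! ### A convergence test for the boundary of the disc. -/

section Raabe

/-- Raabe's test, in telescoped form. -/
theorem summable_of_raabe {t : ℕ → ℝ} (ht : ∀ k, 0 ≤ t k) {d : ℝ} (hd : 0 < d)
    (h : ∀ᶠ k : ℕ in atTop, d * t k ≤ k * t k - (k + 1) * t (k + 1)) : Summable t := by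
  obtain ⟨K, hK⟩ := eventually_atTop.1 h
  rw [← summable_nat_add_iff K]
  refine summable_of_sum_range_le (c := K * t K / d) (fun _ => ht _) fun N => ?_
  rw [le_div_iff₀ hd, mul_comm, Finset.mul_sum]
  have : ∀ N : ℕ, ∑ k ∈ Finset.range N, d * t (k + K) ≤ K * t K - (N + K : ℕ) * t (N + K) := by
    intro N
    induction N with
    | zero => simp
    | succ N ih =>
      rw [Finset.sum_range_succ]
      have := hK (N + K) (by omega)
      rw [show N + 1 + K = N + K + 1 by omega]
      push_cast at this ih ⊢
      linarith
  refine (this N).trans ?_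
  have := ht (N + K)
  have : (0 : ℝ) ≤ (N + K : ℕ) * t (N + K) := by positivity
  linarith

end Raabe

/-! ### The hypergeometric series and its differential equation. -/

section Hypergeometric

variable {a b c : ℝ}

theorem hypCoeff_succ (hc : 0 < c) (k : ℕ) :
    (k + 1) * (c + k) * ordinaryHypergeometricCoefficient a b c (k + 1) =
      (a + k) * (b + k) * ordinaryHypergeometricCoefficient a b c k := by
  have h1 : (ascPochhammer ℝ k).eval c ≠ 0 := (ascPochhammer_pos k c hc).ne'
  have h2 : c + k ≠ 0 := by positivity
  simp only [ordinaryHypergeometricCoefficient, ascPochhammer_succ_eval, Nat.factorial_succ]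
  push_cast
  field_simp

theorem hypergeometric_eq (z : ℝ) : ordinaryHypergeometric a b c z =
    ∑' k, ordinaryHypergeometricCoefficient a b c k * z ^ k := by
  rw [ordinaryHypergeometric_eq_tsum]
  simp only [smul_eq_mul]

/-- The coefficient ratio gives k - (a+k)(b+k)/(c+k) → c-a-b > 0, and Raabe's test applies with half
of this limit. Convergence at z = 1 is needed for the boundary value of φ_l. -/
theorem summable_abs_hypCoeff (hc : 0 < c) (h : 0 < c - a - b) :
    Summable fun k => |ordinaryHypergeometricCoefficient a b c k| := by
  refine summable_of_raabe (fun _ => abs_nonneg _) (half_pos h) ?_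
  have e1 : ∀ᶠ k : ℕ in atTop, -a ≤ k := tendsto_natCast_atTop_atTop.eventually_ge_atTop _
  have e2 : ∀ᶠ k : ℕ in atTop, -b ≤ k := tendsto_natCast_atTop_atTop.eventually_ge_atTop _
  -- This threshold is the solution in k of ((c-a-b)/2)(c+k) ≤ (c-a-b)k - ab.
  have e3 : ∀ᶠ k : ℕ in atTop, (a * b + (c - a - b) / 2 * c) / ((c - a - b) / 2) ≤ k :=
    tendsto_natCast_atTop_atTop.eventually_ge_atTop _
  filter_upwards [e1, e2, e3] with k h1 h2 h3
  have hck : 0 < c + k := by positivity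
  have hs : (k + 1) * |ordinaryHypergeometricCoefficient a b c (k + 1)| =
      (a + k) * (b + k) / (c + k) * |ordinaryHypergeometricCoefficient a b c k| := by
    have := congrArg abs (hypCoeff_succ (a := a) (b := b) hc k)
    generalize ordinaryHypergeometricCoefficient a b c (k + 1) = t' at *
    generalize ordinaryHypergeometricCoefficient a b c k = t at *
    rw [abs_mul, abs_mul, abs_mul, abs_mul, abs_of_nonneg (by linarith : 0 ≤ a + k),
      abs_of_nonneg (by linarith : 0 ≤ b + k), abs_of_pos hck,
      abs_of_pos (by positivity : (0 : ℝ) < k + 1)] at this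
    field_simp
    linarith
  rw [hs, ← sub_mul]
  refine mul_le_mul_of_nonneg_right ?_ (abs_nonneg _)
  rw [le_sub_iff_add_le, ← le_sub_iff_add_le', div_le_iff₀ hck]
  rw [div_le_iff₀ (half_pos h)] at h3
  nlinarith

theorem convergesOn_hypCoeff (hc : 0 < c) (h : 0 < c - a - b) :
    ConvergesOn (ordinaryHypergeometricCoefficient a b c) 1 := fun r hr h1 =>
  (summable_abs_hypCoeff hc h).of_nonneg_of_le (fun _ => by positivity)
    fun k => mul_le_of_le_one_right (abs_nonneg _) (pow_le_one₀ hr h1.le)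

theorem continuousOn_hypergeometric (hc : 0 < c) (h : 0 < c - a - b) :
    ContinuousOn (ordinaryHypergeometric a b c : ℝ → ℝ) (Set.Icc 0 1) := by
  have : (ordinaryHypergeometric a b c : ℝ → ℝ) =
      fun z => ∑' k, ordinaryHypergeometricCoefficient a b c k * z ^ k :=
    funext hypergeometric_eq
  rw [this]
  refine continuousOn_tsum (u := fun k => |ordinaryHypergeometricCoefficient a b c k|)
    (fun k => by fun_prop) (summable_abs_hypCoeff hc h) fun k z hz => ?_
  rw [norm_mul, norm_pow, Real.norm_eq_abs, Real.norm_eq_abs, abs_of_nonneg hz.1]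
  exact mul_le_of_le_one_right (abs_nonneg _) (pow_le_one₀ hz.1 hz.2)

/-- Termwise derivative of the hypergeometric series. -/
def hypDeriv (a b c z : ℝ) : ℝ :=
  ∑' k : ℕ, (k + 1) * ordinaryHypergeometricCoefficient a b c (k + 1) * z ^ k

/-- Termwise second derivative of the hypergeometric series. -/
def hypDeriv₂ (a b c z : ℝ) : ℝ :=
  ∑' k : ℕ, (k + 1) * (((k + 1 : ℕ) + 1) * ordinaryHypergeometricCoefficient a b c (k + 1 + 1)) *
    z ^ k

theorem hasDerivAt_hypergeometric (hc : 0 < c) (h : 0 < c - a - b) {z : ℝ} (hz : |z| < 1) :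
    HasDerivAt (ordinaryHypergeometric a b c) (hypDeriv a b c z) z := by
  have : (ordinaryHypergeometric a b c : ℝ → ℝ) =
      fun z => ∑' k, ordinaryHypergeometricCoefficient a b c k * z ^ k :=
    funext hypergeometric_eq
  rw [this]
  exact (convergesOn_hypCoeff hc h).hasDerivAt hz

theorem hasDerivAt_hypDeriv (hc : 0 < c) (h : 0 < c - a - b) {z : ℝ} (hz : |z| < 1) :
    HasDerivAt (hypDeriv a b c) (hypDeriv₂ a b c z) z :=
  (convergesOn_hypCoeff hc h).deriv.hasDerivAt hz

theorem contDiffOn_hypergeometric (hc : 0 < c) (h : 0 < c - a - b) :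
    ContDiffOn ℝ ∞ (ordinaryHypergeometric a b c : ℝ → ℝ) (Metric.ball 0 1) :=
  (convergesOn_hypCoeff hc h).contDiffOn_infty.congr fun z _ => hypergeometric_eq z

/-- The hypergeometric differential equation. -/
theorem hypergeometric_ode (hc : 0 < c) (h : 0 < c - a - b) {z : ℝ} (hz : |z| < 1) :
    z * (1 - z) * hypDeriv₂ a b c z + (c - (a + b + 1) * z) * hypDeriv a b c z -
      a * b * ordinaryHypergeometric a b c z = 0 := by
  have H := convergesOn_hypCoeff hc h
  set t := ordinaryHypergeometricCoefficient a b c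
  have s0 : HasSum (fun k => t k * z ^ k) (ordinaryHypergeometric a b c z) := by
    rw [hypergeometric_eq]; exact (H.summable hz).hasSum
  have s1 : HasSum (fun k : ℕ => (k + 1) * t (k + 1) * z ^ k) (hypDeriv a b c z) :=
    (H.deriv.summable hz).hasSum
  have s2 : HasSum (fun k : ℕ => (k : ℝ) * t k * z ^ k) (z * hypDeriv a b c z) := H.mul_hasSum hz
  have s3 : HasSum (fun k : ℕ => (k : ℝ) * ((k + 1) * t (k + 1)) * z ^ k)
    (z * hypDeriv₂ a b c z) := H.deriv.mul_hasSum hz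
  have s4 : HasSum (fun k : ℕ => (k : ℝ) * (k - 1) * t k * z ^ k)
      (z * (z * hypDeriv₂ a b c z)) := by
    rw [← hasSum_nat_add_iff' 1]
    simp only [Finset.range_one, Finset.sum_singleton, Nat.cast_zero, zero_mul, sub_zero]
    refine (s3.mul_left z).congr_fun fun k => ?_
    push_cast
    ring
  have key := (((s3.sub s4).add (s1.mul_left c)).sub (s2.mul_left (a + b + 1))).sub
    (s0.mul_left (a * b))
  -- The coefficient of z^k in the equation is exactly the two-term recursion `hypCoeff_succ`.
  have hz0 : ∀ k : ℕ, (k : ℝ) * ((k + 1) * t (k + 1)) * z ^ k - k * (k - 1) * t k * z ^ k +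
      c * ((k + 1) * t (k + 1) * z ^ k) - (a + b + 1) * (k * t k * z ^ k) -
        a * b * (t k * z ^ k) = 0 := by
    intro k
    have := hypCoeff_succ (a := a) (b := b) hc k
    linear_combination z ^ k * this
  have := key.unique (by simpa only [hz0] using hasSum_zero)
  linear_combination this

end Hypergeometric

end

noncomputable section

open Filter Topology MeasureTheory

/-! ### Euler's integral, Gauss's sum and bounds uniform in the degree. -/

section EulerIntegral

theorem integrableOn_beta {p q : ℝ} (hp : 0 < p) (hq : 0 < q) :
    IntegrableOn (fun t : ℝ => t ^ (p - 1) * (1 - t) ^ (q - 1)) (Set.Ioo 0 1) := by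
  have h := Complex.betaIntegral_convergent (u := p) (v := q) (by simpa) (by simpa)
  rw [intervalIntegrable_iff_integrableOn_Ioo_of_le zero_le_one] at h
  refine (Integrable.re h).congr ?_
  filter_upwards [ae_restrict_mem measurableSet_Ioo] with t ht
  have h1 : (t : ℂ) ^ ((p : ℂ) - 1) = ((t ^ (p - 1) : ℝ) : ℂ) := by
    rw [Complex.ofReal_cpow ht.1.le]; simp
  have h2 : (1 - (t : ℂ)) ^ ((q : ℂ) - 1) = (((1 - t) ^ (q - 1) : ℝ) : ℂ) := by
    rw [Complex.ofReal_cpow (sub_nonneg.2 ht.2.le)]; simp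
  rw [h1, h2, ← Complex.ofReal_mul]
  exact Complex.ofReal_re _

theorem integral_beta {p q : ℝ} (hp : 0 < p) (hq : 0 < q) :
    ∫ t in Set.Ioo (0 : ℝ) 1, t ^ (p - 1) * (1 - t) ^ (q - 1) =
      Real.Gamma p * Real.Gamma q / Real.Gamma (p + q) := by
  have h := Complex.betaIntegral_eq_Gamma_mul_div p q (by simpa) (by simpa)
  rw [Complex.betaIntegral, intervalIntegral.integral_of_le zero_le_one,
    integral_Ioc_eq_integral_Ioo, ← Complex.ofReal_add, Complex.Gamma_ofReal, Complex.Gamma_ofReal,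
    Complex.Gamma_ofReal] at h
  have h3 : ∫ t in Set.Ioo (0 : ℝ) 1, (t : ℂ) ^ ((p : ℂ) - 1) * (1 - (t : ℂ)) ^ ((q : ℂ) - 1) =
      ∫ t in Set.Ioo (0 : ℝ) 1, ((t ^ (p - 1) * (1 - t) ^ (q - 1) : ℝ) : ℂ) := by
    refine setIntegral_congr_fun measurableSet_Ioo fun t ht => ?_
    have h1 : (t : ℂ) ^ ((p : ℂ) - 1) = ((t ^ (p - 1) : ℝ) : ℂ) := by
      rw [Complex.ofReal_cpow ht.1.le]; simp
    have h2 : (1 - (t : ℂ)) ^ ((q : ℂ) - 1) = (((1 - t) ^ (q - 1) : ℝ) : ℂ) := by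
      rw [Complex.ofReal_cpow (sub_nonneg.2 ht.2.le)]; simp
    simp only [h1, h2, ← Complex.ofReal_mul]
  rw [h3, integral_complex_ofReal] at h
  exact_mod_cast h

theorem Gamma_add_nat {p : ℝ} (hp : 0 < p) (k : ℕ) :
    Real.Gamma (p + k) = (ascPochhammer ℝ k).eval p * Real.Gamma p := by
  induction k with
  | zero => simp
  | succ k ih =>
    rw [Nat.cast_succ, ← add_assoc, Real.Gamma_add_one (by positivity), ih,
      ascPochhammer_succ_eval]
    ring

theorem hasSum_one_sub_rpow_neg (b : ℝ) {x : ℝ} (hx : |x| < 1) :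
    HasSum (fun k : ℕ => (k.factorial : ℝ)⁻¹ * (ascPochhammer ℝ k).eval b * x ^ k)
      ((1 - x) ^ (-b)) := by
  have h := (Real.one_div_one_sub_rpow_hasFPowerSeriesOnBall_zero b).hasSum (y := x)
    (by simpa [enorm_eq_nnnorm, ← NNReal.coe_lt_coe] using hx)
  simp only [zero_add, FormalMultilinearSeries.ofScalars_apply_eq, smul_eq_mul] at h
  rw [one_div, ← Real.rpow_neg (by linarith [(abs_lt.1 hx).2])] at h
  refine h.congr_fun fun k => ?_
  congr 1
  have h2 := Ring.factorial_nsmul_multichoose_eq_ascPochhammer b k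
  rw [Polynomial.ascPochhammer_smeval_eq_eval, Ring.multichoose_eq, nsmul_eq_mul] at h2
  rw [← h2]
  have := Nat.factorial_ne_zero k
  field_simp

variable {a b c : ℝ}

/-- Euler's integral for the hypergeometric function on `[0, 1]`. -/
theorem hypergeometric_euler (ha : 0 < a) (hac : 0 < c - a) (h : 0 < c - a - b) {z : ℝ}
    (hz : z ∈ Set.Icc (0 : ℝ) 1) :
    ∫ t in Set.Ioo (0 : ℝ) 1, t ^ (a - 1) * (1 - t) ^ (c - a - 1) * (1 - z * t) ^ (-b) =
      Real.Gamma a * Real.Gamma (c - a) / Real.Gamma c * ordinaryHypergeometric a b c z := by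
  have hc : 0 < c := by linarith
  set B := Real.Gamma a * Real.Gamma (c - a) / Real.Gamma c with hB
  have hBpos : 0 < B := div_pos (mul_pos (Real.Gamma_pos_of_pos ha) (Real.Gamma_pos_of_pos hac))
    (Real.Gamma_pos_of_pos hc)
  set F : ℕ → ℝ → ℝ := fun k t => ((k.factorial : ℝ)⁻¹ * (ascPochhammer ℝ k).eval b * z ^ k) *
    (t ^ (a + k - 1) * (1 - t) ^ (c - a - 1)) with hF
  have hI (k : ℕ) : IntegrableOn (fun t : ℝ => t ^ (a + k - 1) * (1 - t) ^ (c - a - 1))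
      (Set.Ioo 0 1) := integrableOn_beta (by positivity) hac
  have hFint (k : ℕ) : IntegrableOn (F k) (Set.Ioo 0 1) := (hI k).const_mul _
  have hval (k : ℕ) : ∫ t in Set.Ioo (0 : ℝ) 1, t ^ (a + k - 1) * (1 - t) ^ (c - a - 1) =
      B * ((ascPochhammer ℝ k).eval a * ((ascPochhammer ℝ k).eval c)⁻¹) := by
    rw [integral_beta (by positivity) hac, show a + k + (c - a) = c + k by ring,
      Gamma_add_nat ha, Gamma_add_nat hc, hB]
    have := (ascPochhammer_pos k c hc).ne'
    have := (Real.Gamma_pos_of_pos hc).ne'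
    field_simp
  have hFval (k : ℕ) : ∫ t in Set.Ioo (0 : ℝ) 1, F k t =
      B * (ordinaryHypergeometricCoefficient a b c k * z ^ k) := by
    rw [hF, integral_const_mul, hval, ordinaryHypergeometricCoefficient]
    ring
  -- Only the scalar prefactor of F k can be negative, so ∫|F k| = |∫ F k|. Interchanging sum and
  -- integral thus needs only absolute summability of the hypergeometric series, which holds up to
  -- and including z = 1.
  have hFnorm (k : ℕ) : ∫ t in Set.Ioo (0 : ℝ) 1, ‖F k t‖ =
      B * |ordinaryHypergeometricCoefficient a b c k * z ^ k| := by
    have : ∀ t ∈ Set.Ioo (0 : ℝ) 1, ‖F k t‖ =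
        |(k.factorial : ℝ)⁻¹ * (ascPochhammer ℝ k).eval b * z ^ k| *
          (t ^ (a + k - 1) * (1 - t) ^ (c - a - 1)) := by
      intro t ht
      rw [hF, norm_mul, Real.norm_eq_abs, Real.norm_of_nonneg]
      have := ht.1.le
      have := sub_nonneg.2 ht.2.le
      positivity
    rw [setIntegral_congr_fun measurableSet_Ioo this, integral_const_mul, hval,
      ordinaryHypergeometricCoefficient, ← abs_of_pos (ascPochhammer_pos k a ha),
      ← abs_of_pos (inv_pos.2 (ascPochhammer_pos k c hc)), mul_left_comm, ← abs_mul, ← abs_mul]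
    congr 2
    simp only [abs_of_pos (ascPochhammer_pos k a ha),
      abs_of_pos (inv_pos.2 (ascPochhammer_pos k c hc))]
    ring
  have hsum : Summable fun k => ∫ t in Set.Ioo (0 : ℝ) 1, ‖F k t‖ := by
    simp only [hFnorm]
    refine Summable.mul_left B ?_
    refine (summable_abs_hypCoeff hc h).of_nonneg_of_le (fun _ => abs_nonneg _) fun k => ?_
    rw [abs_mul, abs_pow, abs_of_nonneg hz.1]
    exact mul_le_of_le_one_right (abs_nonneg _) (pow_le_one₀ hz.1 hz.2)
  have hpt : ∀ t ∈ Set.Ioo (0 : ℝ) 1, HasSum (fun k => F k t)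
      (t ^ (a - 1) * (1 - t) ^ (c - a - 1) * (1 - z * t) ^ (-b)) := by
    intro t ht
    have hzt : |z * t| < 1 := by
      rw [abs_mul, abs_of_nonneg hz.1, abs_of_pos ht.1]
      nlinarith [hz.1, hz.2, ht.1, ht.2]
    refine ((hasSum_one_sub_rpow_neg b hzt).mul_left _).congr_fun fun k => ?_
    simp only [hF]
    rw [show a + k - 1 = a - 1 + k by ring, Real.rpow_add_natCast ht.1.ne', mul_pow]
    ring
  have key := hasSum_integral_of_summable_integral_norm hFint hsum
  have hcongr : ∫ t in Set.Ioo (0 : ℝ) 1, ∑' k, F k t = ∫ t in Set.Ioo (0 : ℝ) 1,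
      t ^ (a - 1) * (1 - t) ^ (c - a - 1) * (1 - z * t) ^ (-b) :=
    setIntegral_congr_fun measurableSet_Ioo fun t ht => (hpt t ht).tsum_eq
  rw [← hcongr, ← key.tsum_eq, hypergeometric_eq, ← tsum_mul_left]
  exact tsum_congr hFval

/-- Gauss's summation theorem. -/
theorem hypergeometric_one (ha : 0 < a) (hac : 0 < c - a) (h : 0 < c - a - b) :
    ordinaryHypergeometric a b c (1 : ℝ) =
      Real.Gamma c * Real.Gamma (c - a - b) / (Real.Gamma (c - a) * Real.Gamma (c - b)) := by
  have h1 := hypergeometric_euler ha hac h (z := 1) (by simp)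
  have h2 : ∫ t in Set.Ioo (0 : ℝ) 1, t ^ (a - 1) * (1 - t) ^ (c - a - 1) * (1 - 1 * t) ^ (-b) =
      ∫ t in Set.Ioo (0 : ℝ) 1, t ^ (a - 1) * (1 - t) ^ (c - a - b - 1) := by
    refine setIntegral_congr_fun measurableSet_Ioo fun t ht => ?_
    simp only [one_mul]
    rw [mul_assoc, ← Real.rpow_add (sub_pos.2 ht.2)]
    ring_nf
  rw [h2, integral_beta ha h, show a + (c - a - b) = c - b by ring] at h1
  have g1 := (Real.Gamma_pos_of_pos ha).ne'
  have g2 := (Real.Gamma_pos_of_pos hac).ne'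
  have g3 := (Real.Gamma_pos_of_pos (by linarith : 0 < c)).ne'
  have g4 := (Real.Gamma_pos_of_pos (by linarith : 0 < c - b)).ne'
  field_simp at h1 ⊢
  linarith

/-- The exponent γ - 1/2 met below has either sign. Taking the maximum (or minimum) with 1 treats
both cases at once, for the base 1 - zt between 1 - z and 1. -/
theorem rpow_le_max_one {x y b : ℝ} (hx : 0 < x) (hxy : x ≤ y) (hy : y ≤ 1) :
    y ^ b ≤ max 1 (x ^ b) := by
  rcases le_total 0 b with hb | hb
  · exact le_max_of_le_left (Real.rpow_le_one (hx.le.trans hxy) hy hb)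
  · exact le_max_of_le_right (Real.rpow_le_rpow_of_nonpos hx hxy hb)

theorem min_one_le_rpow {x y b : ℝ} (hx : 0 < x) (hxy : x ≤ y) (hy : y ≤ 1) :
    min 1 (x ^ b) ≤ y ^ b := by
  rcases le_total 0 b with hb | hb
  · exact min_le_of_right_le (Real.rpow_le_rpow hx.le hxy hb)
  · exact min_le_of_left_le (Real.one_le_rpow_of_pos_of_le_one_of_nonpos (hx.trans_le hxy) hy hb)

theorem integrableOn_euler (ha : 0 < a) (hac : 0 < c - a) {z : ℝ} (hz : z ∈ Set.Ico (0 : ℝ) 1) :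
    IntegrableOn (fun t : ℝ => t ^ (a - 1) * (1 - t) ^ (c - a - 1) * (1 - z * t) ^ (-b))
      (Set.Ioo 0 1) := by
  refine Integrable.mono' ((integrableOn_beta ha hac).mul_const (max 1 ((1 - z) ^ (-b))))
    (Measurable.aestronglyMeasurable (by fun_prop)) ?_
  filter_upwards [ae_restrict_mem measurableSet_Ioo] with t ht
  have h1 := ht.1.le
  have h2 := sub_nonneg.2 ht.2.le
  have h3 : 1 - z ≤ 1 - z * t := by nlinarith [hz.1, ht.2]
  have h4 : 0 < 1 - z := by linarith [hz.2]
  have h5 : 0 ≤ 1 - z * t := h4.le.trans h3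
  rw [Real.norm_of_nonneg (by positivity)]
  exact mul_le_mul_of_nonneg_left (rpow_le_max_one h4 h3 (by nlinarith [hz.1])) (by positivity)

/-- Euler's integral is an average of (1 - zt)^{-b} against a beta probability density in t. The
resulting bounds do not depend on a and c, hence later not on l. -/
theorem hypergeometric_le (ha : 0 < a) (hac : 0 < c - a) (h : 0 < c - a - b) {z : ℝ}
    (hz : z ∈ Set.Ico (0 : ℝ) 1) :
    ordinaryHypergeometric a b c z ≤ max 1 ((1 - z) ^ (-b)) := by
  have hc : 0 < c := by linarith
  have hB : 0 < Real.Gamma a * Real.Gamma (c - a) / Real.Gamma c :=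
    div_pos (mul_pos (Real.Gamma_pos_of_pos ha) (Real.Gamma_pos_of_pos hac))
      (Real.Gamma_pos_of_pos hc)
  have h1 := integrableOn_euler (b := b) ha hac hz
  have h2 := hypergeometric_euler ha hac h (Set.Ico_subset_Icc_self hz)
  refine le_of_mul_le_mul_left ?_ hB
  rw [← h2]
  have h3 := integral_beta ha hac
  rw [show a + (c - a) = c by ring] at h3
  rw [← h3, ← integral_mul_const]
  refine setIntegral_mono_on h1 ((integrableOn_beta ha hac).mul_const _) measurableSet_Ioo
    fun t ht => mul_le_mul_of_nonneg_left (rpow_le_max_one ?_ ?_ ?_) ?_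
  · linarith [hz.2]
  · nlinarith [hz.1, ht.2]
  · nlinarith [hz.1, ht.1]
  · have := ht.1.le
    have := sub_nonneg.2 ht.2.le
    positivity

theorem le_hypergeometric (ha : 0 < a) (hac : 0 < c - a) (h : 0 < c - a - b) {z : ℝ}
    (hz : z ∈ Set.Ico (0 : ℝ) 1) :
    min 1 ((1 - z) ^ (-b)) ≤ ordinaryHypergeometric a b c z := by
  have hc : 0 < c := by linarith
  have hB : 0 < Real.Gamma a * Real.Gamma (c - a) / Real.Gamma c :=
    div_pos (mul_pos (Real.Gamma_pos_of_pos ha) (Real.Gamma_pos_of_pos hac))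
      (Real.Gamma_pos_of_pos hc)
  have h1 := integrableOn_euler (b := b) ha hac hz
  have h2 := hypergeometric_euler ha hac h (Set.Ico_subset_Icc_self hz)
  refine le_of_mul_le_mul_left ?_ hB
  rw [← h2]
  have h3 := integral_beta ha hac
  rw [show a + (c - a) = c by ring] at h3
  rw [← h3, ← integral_mul_const]
  refine setIntegral_mono_on ((integrableOn_beta ha hac).mul_const _) h1 measurableSet_Ioo
    fun t ht => mul_le_mul_of_nonneg_left (min_one_le_rpow ?_ ?_ ?_) ?_
  · linarith [hz.2]
  · nlinarith [hz.1, ht.2]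
  · nlinarith [hz.1, ht.1]
  · have := ht.1.le
    have := sub_nonneg.2 ht.2.le
    positivity

end EulerIntegral

/-! ### The radial profiles φ_l. -/

section RadialProfile

variable {n : ℕ} {γ : ℝ} (l : ℕ)

/-- The normalising constant of `radialProfile`. -/
def profileConst (n : ℕ) (γ : ℝ) (l : ℕ) : ℝ :=
  Real.Gamma (γ + 1 / 2) / Real.Gamma (2 * γ) *
    (Real.Gamma (l + (n : ℝ) / 2 + γ) / Real.Gamma (l + ((n : ℝ) + 1) / 2))

theorem profileConst_pos (hγ : 0 < γ) : 0 < profileConst n γ l := by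
  have h1 := Real.Gamma_pos_of_pos (by linarith : 0 < γ + 1 / 2)
  have h2 := Real.Gamma_pos_of_pos (by linarith : 0 < 2 * γ)
  have h3 := Real.Gamma_pos_of_pos (by positivity : 0 < l + (n : ℝ) / 2 + γ)
  have h4 := Real.Gamma_pos_of_pos (by positivity : 0 < l + ((n : ℝ) + 1) / 2)
  unfold profileConst
  positivity

theorem radialProfile_eq (z : ℝ) : radialProfile n γ l z = profileConst n γ l *
    ordinaryHypergeometric (l + (n : ℝ) / 2 - γ) (1 / 2 - γ) (l + ((n : ℝ) + 1) / 2) z := rfl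

/-- Here c-a = γ + 1/2, c-a-b = 2γ and c-b = l + n/2 + γ, so the normalising constant is the
reciprocal of Gauss's value. The bound γ < n/2 gives a > 0 even for l = 0. -/
theorem radialProfile_one (hγ : 0 < γ) (hγn : γ < (n : ℝ) / 2) : radialProfile n γ l 1 = 1 := by
  have hl : (0 : ℝ) ≤ l := by positivity
  have e1 : l + ((n : ℝ) + 1) / 2 - (l + (n : ℝ) / 2 - γ) = γ + 1 / 2 := by ring
  have e2 : γ + 1 / 2 - (1 / 2 - γ) = 2 * γ := by ring
  have e3 : l + ((n : ℝ) + 1) / 2 - (1 / 2 - γ) = l + (n : ℝ) / 2 + γ := by ring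
  rw [radialProfile_eq, hypergeometric_one (by linarith) (by rw [e1]; linarith)
    (by rw [e1, e2]; linarith), e1, e2, e3, profileConst]
  have h1 := (Real.Gamma_pos_of_pos (by linarith : 0 < γ + 1 / 2)).ne'
  have h2 := (Real.Gamma_pos_of_pos (by linarith : 0 < 2 * γ)).ne'
  have h3 := (Real.Gamma_pos_of_pos (by positivity : 0 < l + (n : ℝ) / 2 + γ)).ne'
  have h4 := (Real.Gamma_pos_of_pos (by positivity : 0 < l + ((n : ℝ) + 1) / 2)).ne'
  field_simp

theorem continuousOn_radialProfile (hγ : 0 < γ) :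
    ContinuousOn (radialProfile n γ l) (Set.Icc 0 1) :=
  (continuousOn_hypergeometric (by positivity) (by ring_nf; positivity)).const_smul
    (profileConst n γ l)

theorem contDiffOn_radialProfile (hγ : 0 < γ) :
    ContDiffOn ℝ ∞ (radialProfile n γ l) (Metric.ball 0 1) :=
  (contDiffOn_hypergeometric (by positivity) (by ring_nf; positivity)).const_smul
    (profileConst n γ l)

theorem radialProfile_pos (hγ : 0 < γ) (hγn : γ < (n : ℝ) / 2) {z : ℝ}
    (hz : z ∈ Set.Icc (0 : ℝ) 1) : 0 < radialProfile n γ l z := by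
  rcases hz.2.eq_or_lt with rfl | h1
  · rw [radialProfile_one l hγ hγn]; exact one_pos
  have hl : (0 : ℝ) ≤ l := by positivity
  refine mul_pos (profileConst_pos l hγ) (lt_of_lt_of_le ?_ (le_hypergeometric (by linarith)
    (by ring_nf; positivity) (by ring_nf; positivity) ⟨hz.1, h1⟩))
  have := Real.rpow_pos_of_pos (sub_pos.2 h1) (-(1 / 2 - γ))
  positivity

/-- The normalising constants cancel and Euler's bounds are free of l, so one M serves all degrees.
This compares the harmonic series at two radii without estimating the Y_l. -/
theorem exists_radialProfile_le (hγ : 0 < γ) (hγn : γ < (n : ℝ) / 2) {z z' : ℝ}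
    (hz : z ∈ Set.Ico (0 : ℝ) 1) (hz' : z' ∈ Set.Ico (0 : ℝ) 1) :
    ∃ M : ℝ, 0 < M ∧ ∀ l, radialProfile n γ l z ≤ M * radialProfile n γ l z' := by
  have h1 := Real.rpow_pos_of_pos (sub_pos.2 hz'.2) (-(1 / 2 - γ))
  have hm : 0 < min 1 ((1 - z') ^ (-(1 / 2 - γ))) := by positivity
  have hM : 0 < max 1 ((1 - z) ^ (-(1 / 2 - γ))) := lt_max_of_lt_left one_pos
  refine ⟨max 1 ((1 - z) ^ (-(1 / 2 - γ))) / min 1 ((1 - z') ^ (-(1 / 2 - γ))), by positivity,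
    fun l => ?_⟩
  have hl : (0 : ℝ) ≤ l := by positivity
  have h2 := hypergeometric_le (a := l + (n : ℝ) / 2 - γ) (b := 1 / 2 - γ)
    (c := l + ((n : ℝ) + 1) / 2) (by linarith) (by ring_nf; positivity) (by ring_nf; positivity) hz
  have h3 := le_hypergeometric (a := l + (n : ℝ) / 2 - γ) (b := 1 / 2 - γ)
    (c := l + ((n : ℝ) + 1) / 2) (by linarith) (by ring_nf; positivity) (by ring_nf; positivity) hz'
  rw [radialProfile_eq, radialProfile_eq, mul_left_comm]
  refine mul_le_mul_of_nonneg_left (h2.trans ?_) (profileConst_pos l hγ).le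
  rw [div_mul_eq_mul_div, le_div_iff₀ hm]
  exact mul_le_mul_of_nonneg_left h3 hM.le

/-- `ρ^{n/2-γ} φ_l(|x|²) h` solves the scattering equation for `h` harmonic of degree `l`. -/
theorem scatteringOp_radialProfile_mul {s : ℝ} (hs : s = n / 2 + γ) (hγ : 0 < γ)
    {h : EuclideanSpace ℝ (Fin (n + 1)) → ℝ} {x : EuclideanSpace ℝ (Fin (n + 1))}
    (hx : ‖x‖ < 1) (hh : ContDiffAt ℝ 2 h x) (hlap : lap h x = 0)
    (heul : eulerD h x = l * h x) :
    scatteringOp n s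
      (fun y => defFun y ^ ((n : ℝ) / 2 - γ) * radialProfile n γ l (‖y‖ ^ 2) * h y) x = 0 := by
  have hx2 : ‖x‖ ^ 2 < 1 := by nlinarith [norm_nonneg x]
  have hz : |‖x‖ ^ 2| < 1 := by rwa [abs_of_nonneg (by positivity)]
  set a : ℝ := l + (n : ℝ) / 2 - γ with ha
  set b : ℝ := 1 / 2 - γ with hb
  set c : ℝ := l + ((n : ℝ) + 1) / 2 with hc
  have hcpos : 0 < c := by positivity
  have hcab : 0 < c - a - b := by rw [ha, hb, hc]; ring_nf; positivity
  have hmem : Metric.ball (0 : ℝ) 1 ∈ 𝓝 (‖x‖ ^ 2) :=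
    Metric.isOpen_ball.mem_nhds (by rw [mem_ball_zero_iff]; exact hz)
  rw [scatteringOp_profile_mul (φ' := fun z => profileConst n γ l * hypDeriv a b c z)
    (φ'' := profileConst n γ l * hypDeriv₂ a b c (‖x‖ ^ 2)) (l := l) hs hx hh hlap heul
    (((contDiffOn_radialProfile l hγ).contDiffAt hmem).of_le (by norm_cast)) ?_
    ((hasDerivAt_hypDeriv hcpos hcab hz).const_mul _)]
  · have := hypergeometric_ode (a := a) (b := b) (c := c) hcpos hcab hz
    rw [radialProfile_eq]
    linear_combination -2 * defFun x ^ ((n : ℝ) / 2 - γ + 1) * profileConst n γ l * h x * this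
  · filter_upwards [hmem] with z hz
    exact (hasDerivAt_hypergeometric hcpos hcab (by simpa using hz)).const_mul _

end RadialProfile

end

noncomputable section

open Filter Topology MeasureTheory

/-! ### Second-order conditions at a local maximum. -/

section SecondDerivativeTest

variable {d : ℕ} {u : EuclideanSpace ℝ (Fin d) → ℝ} {x : EuclideanSpace ℝ (Fin d)}

/-- A positive second derivative would make t a local minimum too; the function would be locally
constant and its second derivative zero. -/
theorem deriv_deriv_nonpos_of_isLocalMax {g : ℝ → ℝ} {t : ℝ} (h : IsLocalMax g t)
    (hc : ContinuousAt g t) : deriv (deriv g) t ≤ 0 := by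
  by_contra! hpos
  have hmin := isLocalMin_of_deriv_deriv_pos hpos h.deriv_eq_zero hc
  have hconst : g =ᶠ[𝓝 t] fun _ => g t := by
    filter_upwards [h, hmin] with y h1 h2 using le_antisymm h1 h2
  have h1 : deriv g =ᶠ[𝓝 t] fun _ => 0 := by
    filter_upwards [hconst.eventuallyEq_nhds] with y hy
    rw [hy.deriv_eq]; simp
  rw [h1.deriv_eq] at hpos
  simp at hpos

theorem partialD_partialD_nonpos_of_isLocalMax (hu : ContDiffAt ℝ 2 u x) (h : IsLocalMax u x)
    (i : Fin d) : partialD i (partialD i u) x ≤ 0 := by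
  set e : EuclideanSpace ℝ (Fin d) := EuclideanSpace.single i 1
  have hline (t : ℝ) : HasDerivAt (fun t : ℝ => x + t • e) e t := by
    simpa using ((hasDerivAt_id t).smul_const e).const_add x
  have hl0 : x + (0 : ℝ) • e = x := by simp
  have hcont : Tendsto (fun t : ℝ => x + t • e) (𝓝 0) (𝓝 x) := by
    simpa [ContinuousAt, hl0] using (hline 0).continuousAt
  have hpd {v : EuclideanSpace ℝ (Fin d) → ℝ} {t : ℝ} (hv : DifferentiableAt ℝ v (x + t • e)) :
      HasDerivAt (fun t : ℝ => v (x + t • e)) (partialD i v (x + t • e)) t :=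
    hv.hasFDerivAt.comp_hasDerivAt t (hline t)
  have h1 : deriv (fun t : ℝ => u (x + t • e)) =ᶠ[𝓝 0] fun t => partialD i u (x + t • e) := by
    filter_upwards [hcont.eventually (hu.eventually_differentiableAt (.inr rfl))] with t ht
    exact (hpd ht).deriv
  have h2 : deriv (deriv (fun t : ℝ => u (x + t • e))) 0 = partialD i (partialD i u) x := by
    rw [h1.deriv_eq, (hpd (by rw [hl0]; exact hu.differentiableAt_partialD i)).deriv, hl0]
  rw [← h2]
  refine deriv_deriv_nonpos_of_isLocalMax ?_ ?_
  · have : ∀ᶠ t in 𝓝 (0 : ℝ), u (x + t • e) ≤ u x := hcont.eventually h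
    simpa [IsLocalMax, IsMaxFilter] using this
  · exact (hpd (t := 0) (by rw [hl0]; exact hu.differentiableAt two_ne_zero)).continuousAt

theorem lap_nonpos_of_isLocalMax (hu : ContDiffAt ℝ 2 u x) (h : IsLocalMax u x) : lap u x ≤ 0 :=
  Finset.sum_nonpos fun i _ => partialD_partialD_nonpos_of_isLocalMax hu h i

theorem eulerD_eq_zero_of_isLocalMax (h : IsLocalMax u x) : eulerD u x = 0 := by
  simp [eulerD, partialD, h.fderiv_eq_zero]

end SecondDerivativeTest

/-! ### Maximum principle and uniqueness. -/

section MaximumPrinciple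

variable {n : ℕ} {γ s R : ℝ} {w : EuclideanSpace ℝ (Fin (n + 1)) → ℝ}

/-- The positive radial solution of the scattering equation. -/
def radialSolution (n : ℕ) (γ : ℝ) (x : EuclideanSpace ℝ (Fin (n + 1))) : ℝ :=
  defFun x ^ ((n : ℝ) / 2 - γ) * radialProfile n γ 0 (‖x‖ ^ 2)

theorem norm_sq_mem_Ico {d : ℕ} {x : EuclideanSpace ℝ (Fin d)} (hx : ‖x‖ < 1) :
    ‖x‖ ^ 2 ∈ Set.Ico (0 : ℝ) 1 :=
  ⟨by positivity, by nlinarith [norm_nonneg x]⟩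

theorem contDiffAt_radialProfile_norm_sq {d : ℕ} (l : ℕ) (hγ : 0 < γ)
    {x : EuclideanSpace ℝ (Fin d)} (hx : ‖x‖ < 1) :
    ContDiffAt ℝ ∞ (fun y => radialProfile n γ l (‖y‖ ^ 2)) x := by
  have hz := norm_sq_mem_Ico hx
  have hmem : Metric.ball (0 : ℝ) 1 ∈ 𝓝 (‖x‖ ^ 2) := Metric.isOpen_ball.mem_nhds
    (by rw [mem_ball_zero_iff, Real.norm_of_nonneg hz.1]; exact hz.2)
  exact ContDiffAt.comp (g := radialProfile n γ l) x ((contDiffOn_radialProfile l hγ).contDiffAt hmem)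
    (contDiff_norm_sq ℝ).contDiffAt

theorem contDiffAt_defFun_rpow {d : ℕ} {m : WithTop ℕ∞} (a : ℝ)
    {x : EuclideanSpace ℝ (Fin d)} (hx : ‖x‖ < 1) :
    ContDiffAt ℝ m (fun y => defFun y ^ a) x :=
  contDiff_defFun.contDiffAt.rpow_const_of_ne (defFun_pos hx).ne'

theorem contDiffAt_radialSolution (hγ : 0 < γ) {x : EuclideanSpace ℝ (Fin (n + 1))}
    (hx : ‖x‖ < 1) : ContDiffAt ℝ ∞ (radialSolution n γ) x :=
  (contDiffAt_defFun_rpow _ hx).mul (contDiffAt_radialProfile_norm_sq 0 hγ hx)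

theorem radialSolution_pos (hγ : 0 < γ) (hγn : γ < (n : ℝ) / 2)
    {x : EuclideanSpace ℝ (Fin (n + 1))} (hx : ‖x‖ < 1) : 0 < radialSolution n γ x :=
  mul_pos (Real.rpow_pos_of_pos (defFun_pos hx) _)
    (radialProfile_pos 0 hγ hγn (Set.Ico_subset_Icc_self (norm_sq_mem_Ico hx)))

theorem scatteringOp_radialSolution (hs : s = n / 2 + γ) (hγ : 0 < γ)
    {x : EuclideanSpace ℝ (Fin (n + 1))} (hx : ‖x‖ < 1) :
    scatteringOp n s (radialSolution n γ) x = 0 := by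
  have := scatteringOp_radialProfile_mul (h := fun _ => 1) 0 hs hγ hx contDiffAt_const
    (lap_const 1) (by simp [eulerD, partialD_const])
  simp only [mul_one] at this
  exact this

theorem exists_forall_le_radialProfile (hγ : 0 < γ) (hγn : γ < (n : ℝ) / 2) :
    ∃ m : ℝ, 0 < m ∧ ∀ z ∈ Set.Icc (0 : ℝ) 1, m ≤ radialProfile n γ 0 z := by
  obtain ⟨z, hz, hmin⟩ := isCompact_Icc.exists_isMinOn (Set.nonempty_Icc.2 zero_le_one)
    (continuousOn_radialProfile (n := n) 0 hγ)
  exact ⟨_, radialProfile_pos 0 hγ hγn hz, fun y hy => hmin hy⟩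

/-- If w/V has a positive interior maximum c, then w - cV has a local maximum with value 0, where
the operator is nonnegative; but it equals -c LV < 0 there. Radii R < 1 are allowed because the
Poisson integral of 1 is identified by comparison on smaller balls, before its boundary behaviour is
known. -/
theorem nonpos_of_scatteringOp_eq_zero (hs : s = n / 2 + γ) (hγ : 0 < γ)
    (hγn : γ < (n : ℝ) / 2) (hR0 : 0 < R) (hR1 : R ≤ 1)
    (hw : ∀ x ∈ Metric.ball 0 R, ContDiffAt ℝ 2 w x)
    (hL : ∀ x ∈ Metric.ball 0 R, scatteringOp n s w x = 0)
    (hb : ∀ ξ, ‖ξ‖ = R → Tendsto (fun x => w x / defFun x ^ ((n : ℝ) / 2 - γ))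
      (𝓝[Metric.ball 0 R] ξ) (𝓝 0)) :
    ∀ x ∈ Metric.ball 0 R, w x ≤ 0 := by
  intro x₁ hx₁
  by_contra! hpos
  obtain ⟨m, hm, hmle⟩ := exists_forall_le_radialProfile hγ hγn
  have hn : (0 : ℝ) < n / 2 := hγ.trans hγn
  -- The radial solution keeps V above a multiple of ρ^{n/2-γ}, so w/V tends to 0 at the boundary;
  -- the summand ρ^{n/2} makes the supersolution strict.
  set V : EuclideanSpace ℝ (Fin (n + 1)) → ℝ :=
    fun x => radialSolution n γ x + defFun x ^ ((n : ℝ) / 2) with hV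
  have hlt {x : EuclideanSpace ℝ (Fin (n + 1))} (hx : x ∈ Metric.ball 0 R) : ‖x‖ < 1 :=
    (mem_ball_zero_iff.1 hx).trans_le hR1
  have cR {x : EuclideanSpace ℝ (Fin (n + 1))} (hx : ‖x‖ < 1) :
      ContDiffAt ℝ 2 (radialSolution n γ) x :=
    (contDiffAt_radialSolution hγ hx).of_le (by norm_cast)
  have cV {x : EuclideanSpace ℝ (Fin (n + 1))} (hx : ‖x‖ < 1) : ContDiffAt ℝ 2 V x :=
    (cR hx).add (contDiffAt_defFun_rpow _ hx)
  have hVpos {x : EuclideanSpace ℝ (Fin (n + 1))} (hx : ‖x‖ < 1) : 0 < V x :=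
    add_pos (radialSolution_pos hγ hγn hx) (Real.rpow_pos_of_pos (defFun_pos hx) _)
  have hLV {x : EuclideanSpace ℝ (Fin (n + 1))} (hx : ‖x‖ < 1) : 0 < scatteringOp n s V x := by
    have hρ := defFun_pos hx
    rw [hV, scatteringOp_add hx (cR hx) (contDiffAt_defFun_rpow _ hx),
      scatteringOp_radialSolution hs hγ hx, scatteringOp_defFun_rpow hs hx]
    positivity
  have hratio {x : EuclideanSpace ℝ (Fin (n + 1))} (hx : ‖x‖ < 1) :
      |w x / V x| ≤ |w x / defFun x ^ ((n : ℝ) / 2 - γ)| * m⁻¹ := by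
    have hρ := Real.rpow_pos_of_pos (defFun_pos hx) ((n : ℝ) / 2 - γ)
    rw [abs_div, abs_div, abs_of_pos (hVpos hx), abs_of_pos hρ, ← div_eq_mul_inv,
      div_div]
    refine div_le_div_of_nonneg_left (abs_nonneg _) (by positivity) ?_
    have h1 := hmle _ (Set.Ico_subset_Icc_self (norm_sq_mem_Ico hx))
    have h2 := Real.rpow_pos_of_pos (defFun_pos hx) ((n : ℝ) / 2)
    have h3 := mul_le_mul_of_nonneg_left h1 hρ.le
    simp only [hV, radialSolution]
    linarith
  classical
  -- Extending w/V by 0 gives a continuous function on the compact closed ball, so a maximum is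
  -- attained; if it is positive, it lies in the interior.
  set Q : EuclideanSpace ℝ (Fin (n + 1)) → ℝ := fun x => if ‖x‖ < R then w x / V x else 0 with hQ
  have hQc : ContinuousOn Q (Metric.closedBall 0 R) := by
    intro x hx
    rcases (mem_closedBall_zero_iff.1 hx).lt_or_eq with h | h
    · have hxb : x ∈ Metric.ball 0 R := mem_ball_zero_iff.2 h
      have hev : Q =ᶠ[𝓝 x] fun x => w x / V x := by
        filter_upwards [Metric.isOpen_ball.mem_nhds hxb] with y hy
        simp only [hQ, if_pos (mem_ball_zero_iff.1 hy)]
      have hc : ContinuousAt (fun x => w x / V x) x :=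
        (hw x hxb).continuousAt.div₀ (cV (hlt hxb)).continuousAt (hVpos (hlt hxb)).ne'
      exact (hc.congr hev.symm).continuousWithinAt
    · have hQx : Q x = 0 := by simp [hQ, h]
      rw [ContinuousWithinAt, hQx, Metric.tendsto_nhds]
      intro ε hε
      have h1 := (Metric.tendsto_nhds.1 (hb x h)) (ε * m) (by positivity)
      rw [eventually_nhdsWithin_iff] at h1 ⊢
      filter_upwards [h1] with y hy _
      by_cases hyR : ‖y‖ < R
      · have h2 := hy (mem_ball_zero_iff.2 hyR)
        rw [Real.dist_eq, sub_zero] at h2 ⊢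
        simp only [hQ, if_pos hyR]
        refine (hratio (hyR.trans_le hR1)).trans_lt ?_
        rwa [← div_eq_mul_inv, div_lt_iff₀ hm]
      · simpa [hQ, hyR] using hε
  obtain ⟨x₀, hx₀, hmax⟩ := (isCompact_closedBall (0 : EuclideanSpace ℝ (Fin (n + 1))) R).exists_isMaxOn
    ⟨0, by simp [hR0.le]⟩ hQc
  have hQ1 : 0 < Q x₁ := by
    simp only [hQ, if_pos (mem_ball_zero_iff.1 hx₁)]
    exact div_pos hpos (hVpos (hlt hx₁))
  have hc : 0 < Q x₀ := hQ1.trans_le (hmax (Metric.ball_subset_closedBall hx₁))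
  have hx₀R : ‖x₀‖ < R := by
    by_contra h
    simp [hQ, h] at hc
  have hx₀b : x₀ ∈ Metric.ball 0 R := mem_ball_zero_iff.2 hx₀R
  have hx₀1 := hlt hx₀b
  set c := Q x₀
  have hcw : w x₀ = c * V x₀ := by
    have : c = w x₀ / V x₀ := if_pos hx₀R
    rw [this, div_mul_cancel₀ _ (hVpos hx₀1).ne']
  have cH : ContDiffAt ℝ 2 (fun x => w x - c * V x) x₀ :=
    (hw x₀ hx₀b).sub (contDiffAt_const.mul (cV hx₀1))
  have hloc : IsLocalMax (fun x => w x - c * V x) x₀ := by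
    filter_upwards [Metric.isOpen_ball.mem_nhds hx₀b] with y hy
    have h1 : Q y ≤ c := hmax (Metric.ball_subset_closedBall hy)
    simp only [hQ, if_pos (mem_ball_zero_iff.1 hy)] at h1
    rw [div_le_iff₀ (hVpos (hlt hy))] at h1
    rw [hcw]
    linarith
  have h1 : scatteringOp n s (fun x => w x - c * V x) x₀ = 0 - c * scatteringOp n s V x₀ := by
    rw [scatteringOp_sub hx₀1 (hw x₀ hx₀b) (contDiffAt_const.mul (cV hx₀1)), hL x₀ hx₀b,
      scatteringOp_const_mul c hx₀1 (cV hx₀1)]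
  have h2 := lap_nonpos_of_isLocalMax cH hloc
  rw [scatteringOp_eq hx₀1 cH, eulerD_eq_zero_of_isLocalMax hloc, hcw] at h1
  have h3 := mul_pos hc (hLV hx₀1)
  have h4 := mul_nonpos_of_nonneg_of_nonpos (sq_nonneg (defFun x₀)) h2
  linarith

/-- Uniqueness for the scattering equation in a ball of radius `R ≤ 1`. -/
theorem eq_zero_of_scatteringOp_eq_zero (hs : s = n / 2 + γ) (hγ : 0 < γ)
    (hγn : γ < (n : ℝ) / 2) (hR0 : 0 < R) (hR1 : R ≤ 1)
    (hw : ∀ x ∈ Metric.ball 0 R, ContDiffAt ℝ 2 w x)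
    (hL : ∀ x ∈ Metric.ball 0 R, scatteringOp n s w x = 0)
    (hb : ∀ ξ, ‖ξ‖ = R → Tendsto (fun x => w x / defFun x ^ ((n : ℝ) / 2 - γ))
      (𝓝[Metric.ball 0 R] ξ) (𝓝 0)) :
    ∀ x ∈ Metric.ball 0 R, w x = 0 := by
  intro x hx
  refine le_antisymm (nonpos_of_scatteringOp_eq_zero hs hγ hγn hR0 hR1 hw hL hb x hx) ?_
  have h := nonpos_of_scatteringOp_eq_zero (w := fun x => (-1) * w x) hs hγ hγn hR0 hR1
    (fun x hx => contDiffAt_const.mul (hw x hx))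
    (fun x hx => by
      rw [scatteringOp_const_mul _ ((mem_ball_zero_iff.1 hx).trans_le hR1) (hw x hx), hL x hx,
        mul_zero])
    (fun ξ hξ => by simpa [neg_div] using (hb ξ hξ).const_mul (-1)) x hx
  linarith

end MaximumPrinciple

end

noncomputable section

open Filter Topology MeasureTheory

/-! ### Smooth dependence of integrals over a compact space. -/

section CompactParametricIntegral

set_option linter.unusedSectionVars false

variable {X Y F T : Type} [NormedAddCommGroup X] [NormedSpace ℝ X] [ProperSpace X]
  [NormedAddCommGroup Y] [NormedSpace ℝ Y] [NormedAddCommGroup F] [NormedSpace ℝ F]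
  [TopologicalSpace T] [CompactSpace T] [MeasurableSpace T] [BorelSpace T]
  [SecondCountableTopology T]
  {μ : Measure T} [IsFiniteMeasure μ] {ι : T → Y} {f : T → ℝ}
  {U : Set X} {W : Set (X × Y)} {K : X × Y → F}

/-- The partial derivative in the first variable. -/
def fderivFst (K : X × Y → F) (p : X × Y) : X →L[ℝ] F :=
  (fderiv ℝ K p).comp (ContinuousLinearMap.inl ℝ X Y)

theorem contDiffOn_fderivFst (hW : IsOpen W) (hK : ContDiffOn ℝ ∞ K W) :
    ContDiffOn ℝ ∞ (fderivFst K) W :=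
  (hK.fderiv_of_isOpen hW (by norm_cast)).clm_comp contDiffOn_const

theorem hasFDerivAt_comp_prodMk_left (hW : IsOpen W) (hK : ContDiffOn ℝ ∞ K W) {p : X × Y} (hp : p ∈ W) :
    HasFDerivAt (fun x => K (x, p.2)) (fderivFst K p) p.1 := by
  have h : HasFDerivAt K (fderiv ℝ K p) (p.1, p.2) :=
    ((hK.contDiffAt (hW.mem_nhds hp)).differentiableAt (by simp)).hasFDerivAt
  exact h.comp p.1 (hasFDerivAt_prodMk_left p.1 p.2)

theorem integrable_of_continuous_weight (hf : Continuous f) (hι : Continuous ι)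
    (hK : ContinuousOn K W) {x : X} (hx : ∀ t, (x, ι t) ∈ W) :
    Integrable (fun t => f t • K (x, ι t)) μ := by
  have h1 : Continuous fun t => K (x, ι t) := hK.comp_continuous (by fun_prop) hx
  exact (hf.smul h1).integrable_of_hasCompactSupport (HasCompactSupport.of_compactSpace _)

/-- On a compact ball of parameters times the compact space T, the weight and the differentiated
kernel are bounded by continuity; a constant dominates because μ is finite. -/
theorem hasFDerivAt_integral_of_compact (hU : IsOpen U) (hW : IsOpen W) (hf : Continuous f)
    (hι : Continuous ι) (hUW : ∀ x ∈ U, ∀ t, (x, ι t) ∈ W) (hK : ContDiffOn ℝ ∞ K W)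
    {x : X} (hx : x ∈ U) :
    HasFDerivAt (fun x => ∫ t, f t • K (x, ι t) ∂μ) (∫ t, f t • fderivFst K (x, ι t) ∂μ) x := by
  obtain ⟨δ, hδ, hball⟩ := Metric.nhds_basis_closedBall.mem_iff.1 (hU.mem_nhds hx)
  have hK' := (contDiffOn_fderivFst hW hK).continuousOn
  have hcomp : ContinuousOn (fun p : X × T => fderivFst K (p.1, ι p.2))
      (Metric.closedBall x δ ×ˢ Set.univ) :=
    hK'.comp (by fun_prop) fun p hp => hUW p.1 (hball hp.1) p.2
  obtain ⟨C, hC⟩ := ((isCompact_closedBall x δ).prod isCompact_univ).exists_bound_of_continuousOn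
    hcomp
  obtain ⟨M, hM⟩ := isCompact_univ.exists_bound_of_continuousOn hf.continuousOn
  refine hasFDerivAt_integral_of_dominated_of_fderiv_le (Metric.ball_mem_nhds x hδ)
    (bound := fun _ => M * C) (F' := fun x t => f t • fderivFst K (x, ι t)) ?_ ?_ ?_ ?_ ?_ ?_
  · filter_upwards [hU.mem_nhds hx] with y hy
    exact (integrable_of_continuous_weight hf hι hK.continuousOn (hUW y hy)).aestronglyMeasurable
  · exact integrable_of_continuous_weight hf hι hK.continuousOn (hUW x hx)
  · exact (integrable_of_continuous_weight hf hι hK' (hUW x hx)).aestronglyMeasurable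
  · refine Eventually.of_forall fun t y hy => ?_
    rw [norm_smul]
    exact mul_le_mul (hM t trivial) (hC (y, t) ⟨Metric.ball_subset_closedBall hy, trivial⟩)
      (norm_nonneg _) ((norm_nonneg _).trans (hM t trivial))
  · exact integrable_const _
  · refine Eventually.of_forall fun t y hy => ?_
    exact (hasFDerivAt_comp_prodMk_left hW hK
      (hUW y (hball (Metric.ball_subset_closedBall hy)) t)).const_smul (f t)

/-- The derivative is an integral of the same kind with kernel values in X →L[ℝ] F, so the induction
on the order runs over all target spaces F. -/
theorem contDiffOn_integral_of_compact (hU : IsOpen U) (hW : IsOpen W) (hf : Continuous f)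
    (hι : Continuous ι) (hUW : ∀ x ∈ U, ∀ t, (x, ι t) ∈ W) (hK : ContDiffOn ℝ ∞ K W) :
    ContDiffOn ℝ ∞ (fun x => ∫ t, f t • K (x, ι t) ∂μ) U := by
  refine _root_.contDiffOn_infty.2 fun N => ?_
  induction N generalizing F with
  | zero =>
    exact contDiffOn_zero.2 fun x hx => (hasFDerivAt_integral_of_compact hU hW hf hι hUW hK
      hx).continuousAt.continuousWithinAt
  | succ N ih =>
    push_cast
    rw [contDiffOn_succ_iff_fderiv_of_isOpen hU]
    have h := fun x hx => hasFDerivAt_integral_of_compact (μ := μ) hU hW hf hι hUW hK (x := x) hx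
    exact ⟨fun x hx => (h x hx).differentiableAt.differentiableWithinAt, by simp,
      (ih (contDiffOn_fderivFst hW hK)).congr fun x hx => (h x hx).fderiv⟩

end CompactParametricIntegral

/-! ### The scattering operator commutes with the integral. -/

section DifferentiationUnderIntegral

variable {n : ℕ} {Y T : Type} [NormedAddCommGroup Y] [NormedSpace ℝ Y]
  [TopologicalSpace T] [CompactSpace T] [MeasurableSpace T] [BorelSpace T]
  [SecondCountableTopology T]
  {μ : Measure T} [IsFiniteMeasure μ] {ι : T → Y} {f : T → ℝ}
  {U : Set (EuclideanSpace ℝ (Fin (n + 1)))} {W : Set (EuclideanSpace ℝ (Fin (n + 1)) × Y)}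
  {K : EuclideanSpace ℝ (Fin (n + 1)) × Y → ℝ}

theorem contDiffOn_partialD_fst (hW : IsOpen W) (hK : ContDiffOn ℝ ∞ K W) (i : Fin (n + 1)) :
    ContDiffOn ℝ ∞ (fun p => partialD i (fun x => K (x, p.2)) p.1) W :=
  ((contDiffOn_fderivFst hW hK).clm_apply
    (contDiffOn_const (c := EuclideanSpace.single i (1 : ℝ)))).congr fun p hp => by
      rw [partialD, (hasFDerivAt_comp_prodMk_left hW hK hp).fderiv]

theorem partialD_integral (hU : IsOpen U) (hW : IsOpen W) (hf : Continuous f)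
    (hι : Continuous ι) (hUW : ∀ x ∈ U, ∀ t, (x, ι t) ∈ W) (hK : ContDiffOn ℝ ∞ K W)
    {x : EuclideanSpace ℝ (Fin (n + 1))} (hx : x ∈ U) (i : Fin (n + 1)) :
    partialD i (fun x => ∫ t, f t * K (x, ι t) ∂μ) x =
      ∫ t, f t * partialD i (fun x => K (x, ι t)) x ∂μ := by
  have h := hasFDerivAt_integral_of_compact (μ := μ) hU hW hf hι hUW hK hx
  simp only [smul_eq_mul] at h
  rw [partialD, h.fderiv, ContinuousLinearMap.integral_apply
    (integrable_of_continuous_weight hf hι (contDiffOn_fderivFst hW hK).continuousOn (hUW x hx))]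
  refine integral_congr_ae (Eventually.of_forall fun t => ?_)
  simp only [partialD]
  rw [(hasFDerivAt_comp_prodMk_left hW hK (hUW x hx t)).fderiv]
  rfl

theorem scatteringOp_integral {s : ℝ} (hU : IsOpen U) (hW : IsOpen W) (hf : Continuous f)
    (hι : Continuous ι) (hUW : ∀ x ∈ U, ∀ t, (x, ι t) ∈ W) (hK : ContDiffOn ℝ ∞ K W)
    {x : EuclideanSpace ℝ (Fin (n + 1))} (hx : x ∈ U) (hx1 : ‖x‖ < 1) :
    scatteringOp n s (fun x => ∫ t, f t * K (x, ι t) ∂μ) x =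
      ∫ t, f t * scatteringOp n s (fun x => K (x, ι t)) x ∂μ := by
  have hc : ContDiffAt ℝ 2 (fun x => ∫ t, f t * K (x, ι t) ∂μ) x :=
    ((contDiffOn_integral_of_compact (μ := μ) hU hW hf hι hUW hK).contDiffAt
      (hU.mem_nhds hx)).of_le (by norm_cast)
  have hKt (t : T) : ContDiffAt ℝ 2 (fun x => K (x, ι t)) x := by
    have h1 : ContDiffAt ℝ 2 K (x, ι t) :=
      (hK.contDiffAt (hW.mem_nhds (hUW x hx t))).of_le (by norm_cast)
    exact h1.comp x (contDiffAt_id.prodMk contDiffAt_const)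
  have hD (i : Fin (n + 1)) : partialD i (fun x => ∫ t, f t * K (x, ι t) ∂μ) =ᶠ[𝓝 x]
      fun x => ∫ t, f t * partialD i (fun x => K (x, ι t)) x ∂μ := by
    filter_upwards [hU.mem_nhds hx] with y hy using partialD_integral hU hW hf hι hUW hK hy i
  have hDD (i : Fin (n + 1)) :
      partialD i (partialD i (fun x => ∫ t, f t * K (x, ι t) ∂μ)) x =
        ∫ t, f t * partialD i (partialD i (fun x => K (x, ι t))) x ∂μ := by
    rw [partialD_congr i (hD i)]
    exact partialD_integral hU hW hf hι hUW (contDiffOn_partialD_fst hW hK i) hx i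
  have I0 : Integrable (fun t => f t * K (x, ι t)) μ :=
    integrable_of_continuous_weight hf hι hK.continuousOn (hUW x hx)
  have I1 (i : Fin (n + 1)) :
      Integrable (fun t => f t * partialD i (fun x => K (x, ι t)) x) μ :=
    integrable_of_continuous_weight hf hι (contDiffOn_partialD_fst hW hK i).continuousOn (hUW x hx)
  have I2 (i : Fin (n + 1)) :
      Integrable (fun t => f t * partialD i (partialD i (fun x => K (x, ι t))) x) μ :=
    integrable_of_continuous_weight hf hι
      (contDiffOn_partialD_fst hW (contDiffOn_partialD_fst hW hK i) i).continuousOn (hUW x hx)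
  have hlap : lap (fun x => ∫ t, f t * K (x, ι t) ∂μ) x =
      ∫ t, f t * lap (fun x => K (x, ι t)) x ∂μ := by
    simp only [lap, Finset.mul_sum, hDD]
    rw [integral_finsetSum _ fun i _ => I2 i]
  have heul : eulerD (fun x => ∫ t, f t * K (x, ι t) ∂μ) x =
      ∫ t, f t * eulerD (fun x => K (x, ι t)) x ∂μ := by
    simp only [eulerD, Finset.mul_sum, (hD _).self_of_nhds, ← integral_const_mul]
    rw [← integral_finsetSum _ fun i _ => (I1 i).const_mul _]
    refine integral_congr_ae (Eventually.of_forall fun t => Finset.sum_congr rfl fun i _ => ?_)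
    ring
  have I3 : Integrable (fun t => f t * lap (fun x => K (x, ι t)) x) μ := by
    simp only [lap, Finset.mul_sum]
    exact integrable_finsetSum _ fun i _ => I2 i
  have I4 : Integrable (fun t => f t * eulerD (fun x => K (x, ι t)) x) μ := by
    simp only [eulerD, Finset.mul_sum]
    refine integrable_finsetSum _ fun i _ => ((I1 i).const_mul (x i)).congr ?_
    exact Eventually.of_forall fun t => by ring
  rw [scatteringOp_eq hx1 hc, hlap, heul]
  simp only [scatteringOp_eq hx1 (hKt _)]
  rw [← integral_const_mul, ← integral_const_mul, ← integral_const_mul, ← integral_add (I3.const_mul _)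
    (I4.const_mul _), ← integral_neg, ← integral_sub ((I3.const_mul _).fun_add (I4.const_mul _)).fun_neg
    (I0.const_mul _)]
  exact integral_congr_ae (Eventually.of_forall fun t => by ring)

end DifferentiationUnderIntegral

/-! ### The Poisson integral is a smooth solution in the open ball. -/

section PoissonIntegral

variable {n : ℕ} {γ s : ℝ} {f : Metric.sphere (0 : EuclideanSpace ℝ (Fin (n + 1))) 1 → ℝ}

instance : IsFiniteMeasure (surfaceMeasure n) := by unfold surfaceMeasure; infer_instance

/-- The normalising constant of the Poisson integral. -/
def poissonConst (n : ℕ) (γ : ℝ) : ℝ :=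
  Real.pi ^ (-((n : ℝ) / 2)) * (Real.Gamma ((n : ℝ) / 2 + γ) / Real.Gamma γ)

theorem poissonConst_pos (hγ : 0 < γ) : 0 < poissonConst n γ := by
  have h1 := Real.Gamma_pos_of_pos hγ
  have h2 := Real.Gamma_pos_of_pos (by positivity : 0 < (n : ℝ) / 2 + γ)
  have := Real.pi_pos
  unfold poissonConst
  positivity

theorem poissonIntegral_eq (x : EuclideanSpace ℝ (Fin (n + 1))) :
    poissonIntegral n γ f x = poissonConst n γ *
      ∫ ξ, f ξ * ballKernel (ξ : EuclideanSpace ℝ (Fin (n + 1))) x ^ ((n : ℝ) / 2 + γ)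
        ∂(surfaceMeasure n) := by
  rw [poissonIntegral, poissonConst]
  congr 1
  refine integral_congr_ae (Eventually.of_forall fun ξ => ?_)
  simp only [ballKernel, defFun]
  rw [mul_comm (f ξ), ← div_div, div_eq_mul_inv (_ / _) (_ ^ 2)]

/-- The domain of smoothness of the Poisson kernel. -/
def kernelDomain (n : ℕ) :
    Set (EuclideanSpace ℝ (Fin (n + 1)) × EuclideanSpace ℝ (Fin (n + 1))) :=
  {p | ‖p.1‖ < 1 ∧ p.1 ≠ p.2}

theorem isOpen_kernelDomain : IsOpen (kernelDomain n) :=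
  (isOpen_lt continuous_fst.norm continuous_const).inter
    (isOpen_ne_fun continuous_fst continuous_snd)

theorem mem_kernelDomain {x : EuclideanSpace ℝ (Fin (n + 1))} (hx : ‖x‖ < 1)
    (ξ : Metric.sphere (0 : EuclideanSpace ℝ (Fin (n + 1))) 1) :
    (x, (ξ : EuclideanSpace ℝ (Fin (n + 1)))) ∈ kernelDomain n :=
  ⟨hx, fun h => hx.ne (by
    rw [show x = (ξ : EuclideanSpace ℝ (Fin (n + 1))) from h]; simp)⟩

theorem contDiffOn_ballKernel_rpow (s : ℝ) :
    ContDiffOn ℝ ∞ (fun p : EuclideanSpace ℝ (Fin (n + 1)) × EuclideanSpace ℝ (Fin (n + 1)) =>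
      ballKernel p.2 p.1 ^ s) (kernelDomain n) := by
  intro p hp
  have h0 : 0 < ‖p.1 - p.2‖ := norm_pos_iff.2 (sub_ne_zero.2 hp.2)
  have h1 : ContDiffAt ℝ ∞ (fun p : EuclideanSpace ℝ (Fin (n + 1)) ×
      EuclideanSpace ℝ (Fin (n + 1)) => ballKernel p.2 p.1) p := by
    unfold ballKernel
    refine ContDiffAt.mul (contDiff_defFun.contDiffAt.comp p contDiffAt_fst) (ContDiffAt.inv ?_ ?_)
    · exact ((contDiff_fst.sub contDiff_snd).norm_sq ℝ).contDiffAt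
    · positivity
  refine (h1.rpow_const_of_ne (ne_of_gt ?_)).contDiffWithinAt
  have := defFun_pos hp.1
  unfold ballKernel
  positivity

theorem contDiffOn_poissonIntegral (hf : Continuous f) :
    ContDiffOn ℝ ∞ (poissonIntegral n γ f) (Metric.ball 0 1) := by
  have h := contDiffOn_integral_of_compact (μ := surfaceMeasure n) Metric.isOpen_ball
    isOpen_kernelDomain hf continuous_subtype_val
    (fun x hx => mem_kernelDomain (mem_ball_zero_iff.1 hx))
    (contDiffOn_ballKernel_rpow (n := n) ((n : ℝ) / 2 + γ))
  exact (contDiffOn_const.mul h).congr fun x _ => by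
    rw [poissonIntegral_eq]
    rfl

theorem contDiffAt_poissonIntegral (hf : Continuous f) {x : EuclideanSpace ℝ (Fin (n + 1))}
    (hx : ‖x‖ < 1) : ContDiffAt ℝ ∞ (poissonIntegral n γ f) x :=
  (contDiffOn_poissonIntegral hf).contDiffAt
    (Metric.isOpen_ball.mem_nhds (mem_ball_zero_iff.2 hx))

theorem scatteringOp_poissonIntegral (hs : s = n / 2 + γ) (hf : Continuous f)
    {x : EuclideanSpace ℝ (Fin (n + 1))} (hx : ‖x‖ < 1) :
    scatteringOp n s (poissonIntegral n γ f) x = 0 := by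
  have hx' : x ∈ Metric.ball (0 : EuclideanSpace ℝ (Fin (n + 1))) 1 := mem_ball_zero_iff.2 hx
  have hW := fun (y : EuclideanSpace ℝ (Fin (n + 1))) (hy : y ∈ Metric.ball 0 1) =>
    mem_kernelDomain (mem_ball_zero_iff.1 hy)
  have h := contDiffOn_integral_of_compact (μ := surfaceMeasure n) Metric.isOpen_ball
    isOpen_kernelDomain hf continuous_subtype_val hW
    (contDiffOn_ballKernel_rpow (n := n) ((n : ℝ) / 2 + γ))
  have h2 := scatteringOp_integral (s := s) (μ := surfaceMeasure n) Metric.isOpen_ball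
    isOpen_kernelDomain hf continuous_subtype_val hW
    (contDiffOn_ballKernel_rpow (n := n) ((n : ℝ) / 2 + γ)) hx' hx
  have h3 : poissonIntegral n γ f = fun x => poissonConst n γ *
      ∫ ξ, f ξ * ballKernel (ξ : EuclideanSpace ℝ (Fin (n + 1))) x ^ ((n : ℝ) / 2 + γ)
        ∂(surfaceMeasure n) := funext poissonIntegral_eq
  simp only [smul_eq_mul] at h
  rw [h3, scatteringOp_const_mul _ hx
    ((h.contDiffAt (Metric.isOpen_ball.mem_nhds hx')).of_le (by norm_cast)), h2]
  have h4 (ξ : Metric.sphere (0 : EuclideanSpace ℝ (Fin (n + 1))) 1) : scatteringOp n s (fun x =>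
      ballKernel (ξ : EuclideanSpace ℝ (Fin (n + 1))) x ^ ((n : ℝ) / 2 + γ)) x = 0 := by
    rw [← hs]
    exact scatteringOp_ballKernel_rpow hx (by simp)
  simp [h4]

end PoissonIntegral

end

noncomputable section

open Filter Topology MeasureTheory

/-! ### Rotation invariance of the surface measure. -/

section Rotation

variable {n : ℕ}

/-- The action of a linear isometry on the unit sphere. -/
def sphereMap (R : EuclideanSpace ℝ (Fin (n + 1)) ≃ₗᵢ[ℝ] EuclideanSpace ℝ (Fin (n + 1)))
    (ξ : Metric.sphere (0 : EuclideanSpace ℝ (Fin (n + 1))) 1) :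
    Metric.sphere (0 : EuclideanSpace ℝ (Fin (n + 1))) 1 :=
  ⟨R ξ, by simp⟩

theorem continuous_sphereMap
    (R : EuclideanSpace ℝ (Fin (n + 1)) ≃ₗᵢ[ℝ] EuclideanSpace ℝ (Fin (n + 1))) :
    Continuous (sphereMap R) :=
  (R.continuous.comp continuous_subtype_val).subtype_mk _

open scoped Pointwise in
theorem measurePreserving_sphereMap
    (R : EuclideanSpace ℝ (Fin (n + 1)) ≃ₗᵢ[ℝ] EuclideanSpace ℝ (Fin (n + 1))) :
    MeasurePreserving (sphereMap R) (surfaceMeasure n) (surfaceMeasure n) := by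
  refine ⟨(continuous_sphereMap R).measurable, ?_⟩
  ext t ht
  rw [Measure.map_apply (continuous_sphereMap R).measurable ht, surfaceMeasure,
    Measure.toSphere_apply' _ ht,
    Measure.toSphere_apply' _ ((continuous_sphereMap R).measurable ht)]
  congr 1
  -- `toSphere` measures a set through the volume of the cone over it; the cone over a preimage
  -- under R is the preimage of the cone, and R preserves volume.
  have h : Set.Ioo (0 : ℝ) 1 • ((fun ξ : Metric.sphere (0 : EuclideanSpace ℝ (Fin (n + 1))) 1 =>
      (ξ : EuclideanSpace ℝ (Fin (n + 1)))) '' (sphereMap R ⁻¹' t)) =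
      R ⁻¹' (Set.Ioo (0 : ℝ) 1 • ((fun ξ : Metric.sphere (0 : EuclideanSpace ℝ (Fin (n + 1))) 1 =>
      (ξ : EuclideanSpace ℝ (Fin (n + 1)))) '' t)) := by
    ext y
    simp only [Set.mem_smul, Set.mem_image, Set.mem_preimage]
    constructor
    · rintro ⟨r, hr, _, ⟨ξ, hξ, rfl⟩, rfl⟩
      exact ⟨r, hr, _, ⟨_, hξ, rfl⟩, by simp [sphereMap]⟩
    · rintro ⟨r, hr, _, ⟨ξ, hξ, rfl⟩, h⟩
      refine ⟨r, hr, _, ⟨sphereMap R.symm ξ, ?_, rfl⟩, ?_⟩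
      · have : sphereMap R (sphereMap R.symm ξ) = ξ := by ext1; simp [sphereMap]
        rwa [this]
      · apply R.injective
        rw [← h]
        simp [sphereMap]
  rw [h]
  exact R.measurePreserving.measure_preimage_equiv (f := R.toHomeomorph.toMeasurableEquiv) _

theorem integral_sphereMap
    (R : EuclideanSpace ℝ (Fin (n + 1)) ≃ₗᵢ[ℝ] EuclideanSpace ℝ (Fin (n + 1)))
    (g : Metric.sphere (0 : EuclideanSpace ℝ (Fin (n + 1))) 1 → ℝ) :
    ∫ ξ, g (sphereMap R ξ) ∂(surfaceMeasure n) = ∫ ξ, g ξ ∂(surfaceMeasure n) := by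
  let h : Metric.sphere (0 : EuclideanSpace ℝ (Fin (n + 1))) 1 ≃ₜ
      Metric.sphere (0 : EuclideanSpace ℝ (Fin (n + 1))) 1 :=
    { toFun := sphereMap R
      invFun := sphereMap R.symm
      left_inv := fun ξ => by ext1; simp [sphereMap]
      right_inv := fun ξ => by ext1; simp [sphereMap]
      continuous_toFun := continuous_sphereMap R
      continuous_invFun := continuous_sphereMap R.symm }
  exact (measurePreserving_sphereMap R).integral_comp h.measurableEmbedding g

theorem exists_linearIsometryEquiv {x y : EuclideanSpace ℝ (Fin (n + 1))} (h : ‖x‖ = ‖y‖) :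
    ∃ R : EuclideanSpace ℝ (Fin (n + 1)) ≃ₗᵢ[ℝ] EuclideanSpace ℝ (Fin (n + 1)), R x = y :=
  ⟨_, Submodule.reflection_sub h⟩

end Rotation

/-! ### The Poisson integral of the constant 1. -/

section PoissonIntegralOne

variable {n : ℕ} {γ s : ℝ}

theorem poissonIntegral_one_eq_of_norm_eq {x y : EuclideanSpace ℝ (Fin (n + 1))}
    (h : ‖x‖ = ‖y‖) :
    poissonIntegral n γ (fun _ => 1) x = poissonIntegral n γ (fun _ => 1) y := by
  obtain ⟨R, rfl⟩ := exists_linearIsometryEquiv h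
  rw [poissonIntegral_eq, poissonIntegral_eq,
    ← integral_sphereMap R fun ξ : Metric.sphere (0 : EuclideanSpace ℝ (Fin (n + 1))) 1 =>
      1 * ballKernel (ξ : EuclideanSpace ℝ (Fin (n + 1))) (R x) ^ ((n : ℝ) / 2 + γ)]
  congr 1
  refine integral_congr_ae (Eventually.of_forall fun ξ => ?_)
  have h1 : ‖R x - R ξ‖ = ‖x - ξ‖ := by rw [← map_sub, R.norm_map]
  simp [ballKernel, defFun, sphereMap, h1]

theorem surfaceMeasure_real_univ : (surfaceMeasure n).real Set.univ =
    2 * Real.pi ^ (((n : ℝ) + 1) / 2) / Real.Gamma (((n : ℝ) + 1) / 2) := by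
  have hg : 0 < Real.Gamma (((n : ℝ) + 1) / 2) := Real.Gamma_pos_of_pos (by positivity)
  rw [surfaceMeasure, Measure.toSphere_real_apply_univ, finrank_euclideanSpace_fin, Measure.real,
    EuclideanSpace.volume_ball, Fintype.card_fin, ENNReal.toReal_mul]
  have h1 : (ENNReal.ofReal 1 ^ (n + 1)).toReal = 1 := by simp
  have h2 : √Real.pi ^ (n + 1) = Real.pi ^ (((n : ℝ) + 1) / 2) := by
    rw [Real.sqrt_eq_rpow, ← Real.rpow_natCast, ← Real.rpow_mul Real.pi_pos.le]
    push_cast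
    ring_nf
  rw [h1, h2, one_mul, ENNReal.toReal_ofReal (by
    have := Real.Gamma_pos_of_pos (by positivity : 0 < ((n + 1 : ℕ) : ℝ) / 2 + 1)
    have := Real.pi_pos
    positivity)]
  push_cast
  rw [Real.Gamma_add_one (by positivity)]
  field_simp

/-- At the origin the kernel is constant, so the integral is (1/2)^{n/2+γ} times the area of the
sphere. Legendre's duplication formula for Γ(γ) Γ(γ+1/2) matches it with the constant of φ_0. -/
theorem poissonIntegral_one_zero (hγ : 0 < γ) :
    poissonIntegral n γ (fun _ => 1) 0 = radialSolution n γ 0 := by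
  have hp := Real.pi_pos
  have hk : ∀ ξ : Metric.sphere (0 : EuclideanSpace ℝ (Fin (n + 1))) 1,
      ballKernel (ξ : EuclideanSpace ℝ (Fin (n + 1))) 0 = 1 / 2 := by
    intro ξ
    simp [ballKernel, defFun]
  have h0 : (defFun (0 : EuclideanSpace ℝ (Fin (n + 1)))) = 1 / 2 := by simp [defFun]
  have hdup := Real.Gamma_mul_Gamma_add_half γ
  rw [poissonIntegral_eq]
  simp only [hk, one_mul, integral_const, smul_eq_mul]
  rw [surfaceMeasure_real_univ, radialSolution, h0, poissonConst, radialProfile_eq, profileConst]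
  simp only [norm_zero, ne_eq, OfNat.ofNat_ne_zero, not_false_eq_true, zero_pow,
    ordinaryHypergeometric_zero, mul_one, Nat.cast_zero, zero_add]
  have h1 := Real.Gamma_pos_of_pos hγ
  have h2 := Real.Gamma_pos_of_pos (by linarith : 0 < 2 * γ)
  have h3 := Real.Gamma_pos_of_pos (by positivity : 0 < ((n : ℝ) + 1) / 2)
  have h4 : Real.Gamma (γ + 1 / 2) =
      Real.Gamma (2 * γ) * 2 ^ (1 - 2 * γ) * √Real.pi / Real.Gamma γ := by
    rw [eq_div_iff h1.ne', ← hdup]; ring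
  have h5 : Real.pi ^ (((n : ℝ) + 1) / 2) = Real.pi ^ ((n : ℝ) / 2) * √Real.pi := by
    rw [Real.sqrt_eq_rpow, ← Real.rpow_add hp]; ring_nf
  have h6 : (1 / 2 : ℝ) ^ ((n : ℝ) / 2 - γ) = (1 / 2) ^ ((n : ℝ) / 2 + γ) * 2 ^ (2 * γ) := by
    rw [show (2 : ℝ) ^ (2 * γ) = (1 / 2 : ℝ) ^ (-(2 * γ)) by
      rw [one_div, Real.inv_rpow two_pos.le, Real.rpow_neg two_pos.le, inv_inv],
      ← Real.rpow_add (by norm_num)]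
    ring_nf
  have h7 : (2 : ℝ) ^ (1 - 2 * γ) = 2 / 2 ^ (2 * γ) := by
    rw [Real.rpow_sub two_pos, Real.rpow_one]
  rw [h4, h5, h6, h7, Real.rpow_neg hp.le]
  have := Real.rpow_pos_of_pos hp ((n : ℝ) / 2)
  have := Real.rpow_pos_of_pos two_pos (2 * γ)
  field_simp

/-- The Poisson integral of `1` is the radial solution. -/
theorem poissonIntegral_one (hγ : 0 < γ) (hγn : γ < (n : ℝ) / 2)
    {x : EuclideanSpace ℝ (Fin (n + 1))} (hx : ‖x‖ < 1) :
    poissonIntegral n γ (fun _ => 1) x = radialSolution n γ x := by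
  rcases eq_or_ne x 0 with rfl | hx0
  · exact poissonIntegral_one_zero hγ
  set P := poissonIntegral n γ (fun _ => 1) with hP
  have hr : 0 < ‖x‖ := norm_pos_iff.2 hx0
  -- The factor 1 + c makes (1+c)·`radialSolution` agree with P at x, hence by rotation invariance
  -- on the whole sphere of radius |x|. Uniqueness in that ball extends the equality to the centre,
  -- where both functions are known to agree, forcing c = 0.
  set c := (P x - radialSolution n γ x) / radialSolution n γ x with hc
  have hx' := radialSolution_pos hγ hγn hx
  have cP {y : EuclideanSpace ℝ (Fin (n + 1))} (hy : ‖y‖ < 1) : ContDiffAt ℝ 2 P y :=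
    (contDiffAt_poissonIntegral continuous_const hy).of_le (by norm_cast)
  have cR {y : EuclideanSpace ℝ (Fin (n + 1))} (hy : ‖y‖ < 1) :
      ContDiffAt ℝ 2 (radialSolution n γ) y :=
    (contDiffAt_radialSolution hγ hy).of_le (by norm_cast)
  have hlt {y : EuclideanSpace ℝ (Fin (n + 1))} (hy : y ∈ Metric.ball 0 ‖x‖) : ‖y‖ < 1 :=
    (mem_ball_zero_iff.1 hy).trans hx
  have key := eq_zero_of_scatteringOp_eq_zero (w := fun y => P y - (1 + c) * radialSolution n γ y)
    (n := n) rfl hγ hγn hr hx.le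
    (fun y hy => (cP (hlt hy)).sub (contDiffAt_const.mul (cR (hlt hy))))
    (fun y hy => by
      rw [scatteringOp_sub (hlt hy) (cP (hlt hy)) (contDiffAt_const.mul (cR (hlt hy))),
        scatteringOp_const_mul _ (hlt hy) (cR (hlt hy)), scatteringOp_radialSolution rfl hγ (hlt hy),
        scatteringOp_poissonIntegral rfl continuous_const (hlt hy)]
      ring)
    (fun ξ hξ => by
      have hξ1 : ‖ξ‖ < 1 := hξ ▸ hx
      have hv : P ξ - (1 + c) * radialSolution n γ ξ = 0 := by
        have h1 : P ξ = P x := poissonIntegral_one_eq_of_norm_eq hξ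
        have h2 : radialSolution n γ ξ = radialSolution n γ x := by
          simp [radialSolution, defFun, hξ]
        rw [h1, h2, hc]
        field_simp
        ring
      have hcont : ContinuousAt (fun y => (P y - (1 + c) * radialSolution n γ y) /
          defFun y ^ ((n : ℝ) / 2 - γ)) ξ :=
        ((cP hξ1).sub (contDiffAt_const.mul (cR hξ1))).continuousAt.div₀
          (contDiffAt_defFun_rpow (m := 1) _ hξ1).continuousAt
          (Real.rpow_pos_of_pos (defFun_pos hξ1) _).ne'
      have := hcont.tendsto.mono_left (nhdsWithin_le_nhds (s := Metric.ball 0 ‖x‖))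
      rwa [hv, zero_div] at this)
  have h0 := key 0 (by simpa using hr)
  simp only [hP] at h0
  rw [poissonIntegral_one_zero hγ] at h0
  have h1 := radialSolution_pos hγ hγn (x := (0 : EuclideanSpace ℝ (Fin (n + 1)))) (by simp)
  have h2 : c = 0 := by
    by_contra hne
    exact (mul_ne_zero hne h1.ne') (by linarith)
  rw [hc, div_eq_zero_iff] at h2
  rcases h2 with h2 | h2
  · linarith
  · exact absurd h2 hx'.ne'

end PoissonIntegralOne

end

noncomputable section

open Filter Topology MeasureTheory

/-! ### Boundary values of the Poisson integral. -/

section ApproximateIdentity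

variable {n : ℕ} {γ s : ℝ} {f : Metric.sphere (0 : EuclideanSpace ℝ (Fin (n + 1))) 1 → ℝ}

theorem integrable_mul_ballKernel_rpow (hf : Continuous f)
    {x : EuclideanSpace ℝ (Fin (n + 1))} (hx : ‖x‖ < 1) (s : ℝ) :
    Integrable (fun ξ => f ξ * ballKernel (ξ : EuclideanSpace ℝ (Fin (n + 1))) x ^ s)
      (surfaceMeasure n) :=
  integrable_of_continuous_weight (X := EuclideanSpace ℝ (Fin (n + 1)))
    (K := fun p : EuclideanSpace ℝ (Fin (n + 1)) × EuclideanSpace ℝ (Fin (n + 1)) =>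
      ballKernel p.2 p.1 ^ s)
    hf continuous_subtype_val (contDiffOn_ballKernel_rpow s).continuousOn (mem_kernelDomain hx)

theorem tendsto_defFun {ξ : EuclideanSpace ℝ (Fin (n + 1))} (hξ : ‖ξ‖ = 1) :
    Tendsto defFun (𝓝[Metric.ball 0 1] ξ) (𝓝 0) := by
  have h : Tendsto defFun (𝓝 ξ) (𝓝 (defFun ξ)) :=
    (contDiff_defFun (m := 0)).continuous.tendsto ξ
  have h0 : defFun ξ = 0 := by simp [defFun, hξ]
  rw [h0] at h
  exact h.mono_left nhdsWithin_le_nhds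

theorem tendsto_radialProfile (l : ℕ) (hγ : 0 < γ) (hγn : γ < (n : ℝ) / 2)
    {ξ : EuclideanSpace ℝ (Fin (n + 1))} (hξ : ‖ξ‖ = 1) :
    Tendsto (fun x => radialProfile n γ l (‖x‖ ^ 2)) (𝓝[Metric.ball 0 1] ξ) (𝓝 1) := by
  have h1 := continuousOn_radialProfile (n := n) l hγ 1 (by simp)
  rw [ContinuousWithinAt, radialProfile_one l hγ hγn] at h1
  refine h1.comp (tendsto_nhdsWithin_iff.2 ⟨?_, ?_⟩)
  · have : Tendsto (fun x : EuclideanSpace ℝ (Fin (n + 1)) => ‖x‖ ^ 2) (𝓝 ξ) (𝓝 (‖ξ‖ ^ 2)) :=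
      ((continuous_norm.pow 2).tendsto ξ)
    rw [hξ, one_pow] at this
    exact this.mono_left nhdsWithin_le_nhds
  · filter_upwards [self_mem_nhdsWithin] with x hx
    exact Set.Ico_subset_Icc_self (norm_sq_mem_Ico (mem_ball_zero_iff.1 hx))

theorem tendsto_defFun_rpow {b : ℝ} (hb : 0 < b) {ξ : EuclideanSpace ℝ (Fin (n + 1))}
    (hξ : ‖ξ‖ = 1) : Tendsto (fun x => defFun x ^ b) (𝓝[Metric.ball 0 1] ξ) (𝓝 0) := by
  have := (Real.continuousAt_rpow_const 0 b (.inr hb.le)).tendsto.comp (tendsto_defFun hξ)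
  rwa [Real.zero_rpow hb.ne'] at this

/-- The normalised Poisson integral attains its boundary values. -/
theorem tendsto_poissonIntegral (hγ : 0 < γ) (hγn : γ < (n : ℝ) / 2) (hf : Continuous f)
    (ξ₀ : Metric.sphere (0 : EuclideanSpace ℝ (Fin (n + 1))) 1) :
    Tendsto (fun x => poissonIntegral n γ f x / defFun x ^ ((n : ℝ) / 2 - γ))
      (𝓝[Metric.ball 0 1] (ξ₀ : EuclideanSpace ℝ (Fin (n + 1)))) (𝓝 (f ξ₀)) := by
  have hξ₀ : ‖(ξ₀ : EuclideanSpace ℝ (Fin (n + 1)))‖ = 1 := by simp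
  set s : ℝ := (n : ℝ) / 2 + γ with hs
  have hs0 : 0 < s := by linarith
  have hC := poissonConst_pos (n := n) hγ
  have hP1 {x : EuclideanSpace ℝ (Fin (n + 1))} (hx : ‖x‖ < 1) : poissonConst n γ *
      ∫ ξ, ballKernel (ξ : EuclideanSpace ℝ (Fin (n + 1))) x ^ s ∂(surfaceMeasure n) =
      defFun x ^ ((n : ℝ) / 2 - γ) * radialProfile n γ 0 (‖x‖ ^ 2) := by
    have := poissonIntegral_one hγ hγn hx
    rw [poissonIntegral_eq] at this
    simpa [radialSolution] using this
  have hφ := tendsto_radialProfile 0 hγ hγn hξ₀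
  -- Since P1 = ρ^{n/2-γ} φ_0, subtracting f(ξ₀) φ_0 leaves the integral of f - f(ξ₀) against the
  -- kernel, and φ_0 → 1 at the boundary.
  suffices h : Tendsto (fun x => poissonIntegral n γ f x / defFun x ^ ((n : ℝ) / 2 - γ) -
      f ξ₀ * radialProfile n γ 0 (‖x‖ ^ 2))
      (𝓝[Metric.ball 0 1] (ξ₀ : EuclideanSpace ℝ (Fin (n + 1)))) (𝓝 0) by
    simpa using h.add (hφ.const_mul (f ξ₀))
  obtain ⟨M, hM⟩ := isCompact_univ.exists_bound_of_continuousOn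
    (hf.sub (continuous_const (y := f ξ₀))).continuousOn
  have hM0 : 0 ≤ M := (norm_nonneg _).trans (hM ξ₀ trivial)
  rw [Metric.tendsto_nhds]
  intro ε hε
  -- The near part is at most (ε/4) φ_0 < ε/2, since φ_0 < 2 close to the sphere; the far part gets
  -- the other ε/2.
  obtain ⟨δ, hδ, hfδ⟩ := Metric.continuousAt_iff.1 hf.continuousAt (ε / 4) (by positivity)
  -- For x within δ/2 of ξ₀ and ξ at distance at least δ from ξ₀, one has |x-ξ| ≥ δ/2, so the far
  -- part is of order ρ^{n/2+γ}. Division by ρ^{n/2-γ} leaves ρ^{2γ}, which tends to 0 because γ >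
  -- 0.
  set A := poissonConst n γ * (M * (((δ / 2) ^ 2)⁻¹) ^ s * (surfaceMeasure n).real Set.univ) with hA
  have h2 : Tendsto (fun x : EuclideanSpace ℝ (Fin (n + 1)) => A * defFun x ^ (2 * γ))
      (𝓝[Metric.ball 0 1] (ξ₀ : EuclideanSpace ℝ (Fin (n + 1)))) (𝓝 0) := by
    simpa using (tendsto_defFun_rpow (by linarith : 0 < 2 * γ) hξ₀).const_mul A
  filter_upwards [self_mem_nhdsWithin, h2.eventually (gt_mem_nhds (by positivity : 0 < ε / 2)),
    hφ.eventually (gt_mem_nhds one_lt_two),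
    mem_nhdsWithin_of_mem_nhds (Metric.ball_mem_nhds _ (half_pos hδ))] with x hx h3 h4 h5
  have hx1 : ‖x‖ < 1 := mem_ball_zero_iff.1 hx
  have hρ := defFun_pos hx1
  have hρa := Real.rpow_pos_of_pos hρ ((n : ℝ) / 2 - γ)
  have hkp (ξ : Metric.sphere (0 : EuclideanSpace ℝ (Fin (n + 1))) 1) :
      0 < ballKernel (ξ : EuclideanSpace ℝ (Fin (n + 1))) x := ballKernel_pos hx1 (by simp)
  have hdiff : poissonIntegral n γ f x / defFun x ^ ((n : ℝ) / 2 - γ) -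
      f ξ₀ * radialProfile n γ 0 (‖x‖ ^ 2) = (poissonConst n γ * ∫ ξ, (f ξ - f ξ₀) *
        ballKernel (ξ : EuclideanSpace ℝ (Fin (n + 1))) x ^ s ∂(surfaceMeasure n)) /
          defFun x ^ ((n : ℝ) / 2 - γ) := by
    have e1 : ∫ ξ, (f ξ - f ξ₀) * ballKernel (ξ : EuclideanSpace ℝ (Fin (n + 1))) x ^ s
        ∂(surfaceMeasure n) = (∫ ξ, f ξ * ballKernel (ξ : EuclideanSpace ℝ (Fin (n + 1))) x ^ s
        ∂(surfaceMeasure n)) - f ξ₀ * ∫ ξ, ballKernel (ξ : EuclideanSpace ℝ (Fin (n + 1))) x ^ s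
        ∂(surfaceMeasure n) := by
      rw [← integral_const_mul, ← integral_sub (integrable_mul_ballKernel_rpow hf hx1 s)
        (integrable_mul_ballKernel_rpow continuous_const hx1 s)]
      exact integral_congr_ae (Eventually.of_forall fun ξ => by ring)
    rw [e1, mul_sub, mul_left_comm, hP1 hx1, poissonIntegral_eq, ← hs, sub_div, mul_div_assoc,
      mul_div_assoc (f ξ₀), mul_div_cancel_left₀ _ hρa.ne', ← mul_div_assoc]
  have hpt (ξ : Metric.sphere (0 : EuclideanSpace ℝ (Fin (n + 1))) 1) :
      ‖(f ξ - f ξ₀) * ballKernel (ξ : EuclideanSpace ℝ (Fin (n + 1))) x ^ s‖ ≤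
        ε / 4 * ballKernel (ξ : EuclideanSpace ℝ (Fin (n + 1))) x ^ s +
          M * ((((δ / 2) ^ 2)⁻¹) ^ s * defFun x ^ s) := by
    have hks := (Real.rpow_pos_of_pos (hkp ξ) s).le
    have hK : 0 ≤ (((δ / 2) ^ 2)⁻¹) ^ s * defFun x ^ s := by positivity
    rw [norm_mul, Real.norm_of_nonneg hks]
    by_cases hd : dist ξ ξ₀ < δ
    · have := (hfδ hd).le
      rw [Real.dist_eq, ← Real.norm_eq_abs] at this
      exact le_add_of_le_of_nonneg (mul_le_mul_of_nonneg_right this hks) (by positivity)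
    · have hfar : δ / 2 ≤ ‖x - ξ‖ := by
        rw [← dist_eq_norm]
        have h6 : dist (ξ : EuclideanSpace ℝ (Fin (n + 1))) ξ₀ ≤
          dist x ξ + dist x ξ₀ := dist_triangle_left _ _ _
        have h7 : dist x (ξ₀ : EuclideanSpace ℝ (Fin (n + 1))) < δ / 2 := h5
        have h8 : δ ≤ dist (ξ : EuclideanSpace ℝ (Fin (n + 1))) ξ₀ := not_lt.1 hd
        linarith
      have hk : ballKernel (ξ : EuclideanSpace ℝ (Fin (n + 1))) x ^ s ≤
          (((δ / 2) ^ 2)⁻¹) ^ s * defFun x ^ s := by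
        rw [← Real.mul_rpow (by positivity) hρ.le, mul_comm]
        refine Real.rpow_le_rpow (hkp ξ).le ?_ hs0.le
        unfold ballKernel
        gcongr
      exact le_add_of_nonneg_of_le (by positivity) (mul_le_mul (hM ξ trivial) hk hks hM0)
  have hint : ‖∫ ξ, (f ξ - f ξ₀) * ballKernel (ξ : EuclideanSpace ℝ (Fin (n + 1))) x ^ s
      ∂(surfaceMeasure n)‖ ≤ ε / 4 * (∫ ξ, ballKernel (ξ : EuclideanSpace ℝ (Fin (n + 1))) x ^ s
        ∂(surfaceMeasure n)) + M * ((((δ / 2) ^ 2)⁻¹) ^ s * defFun x ^ s) *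
          (surfaceMeasure n).real Set.univ := by
    have hi : Integrable (fun ξ : Metric.sphere (0 : EuclideanSpace ℝ (Fin (n + 1))) 1 =>
        ε / 4 * ballKernel (ξ : EuclideanSpace ℝ (Fin (n + 1))) x ^ s) (surfaceMeasure n) :=
      integrable_mul_ballKernel_rpow continuous_const hx1 s
    refine (norm_integral_le_of_norm_le (hi.add (integrable_const _))
      (Eventually.of_forall hpt)).trans_eq ?_
    rw [integral_add' hi (integrable_const _), integral_const_mul, integral_const, smul_eq_mul]
    ring
  rw [hdiff, Real.dist_eq, sub_zero, abs_div, abs_of_pos hρa, abs_mul, abs_of_pos hC,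
    div_lt_iff₀ hρa, ← Real.norm_eq_abs]
  have hrs : defFun x ^ s = defFun x ^ (2 * γ) * defFun x ^ ((n : ℝ) / 2 - γ) := by
    rw [← Real.rpow_add hρ, hs]; ring_nf
  calc _ ≤ poissonConst n γ * (ε / 4 * (∫ ξ, ballKernel (ξ : EuclideanSpace ℝ (Fin (n + 1))) x ^ s
        ∂(surfaceMeasure n)) + M * ((((δ / 2) ^ 2)⁻¹) ^ s * defFun x ^ s) *
          (surfaceMeasure n).real Set.univ) := mul_le_mul_of_nonneg_left hint hC.le
    _ = (ε / 4 * radialProfile n γ 0 (‖x‖ ^ 2) + A * defFun x ^ (2 * γ)) *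
        defFun x ^ ((n : ℝ) / 2 - γ) := by
      rw [mul_add, mul_left_comm, hP1 hx1, hrs, hA]
      ring
    _ < ε * defFun x ^ ((n : ℝ) / 2 - γ) := by
      refine mul_lt_mul_of_pos_right ?_ hρa
      nlinarith

end ApproximateIdentity

/-! ### Spherical harmonics and the harmonic expansion. -/

section SphericalHarmonics

variable {n : ℕ} {γ s : ℝ}

theorem contDiff_eval {d : ℕ} (p : MvPolynomial (Fin d) ℝ) :
    ContDiff ℝ ∞ (fun x : EuclideanSpace ℝ (Fin d) => MvPolynomial.eval (fun i => x i) p) := by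
  induction p using MvPolynomial.induction_on with
  | C a => simpa using contDiff_const
  | add p q hp hq => simpa using hp.add hq
  | mul_X p i hp =>
    have : ContDiff ℝ ∞ (fun x : EuclideanSpace ℝ (Fin d) => x i) := by fun_prop
    simpa using hp.mul this

theorem partialD_eval {d : ℕ} (p : MvPolynomial (Fin d) ℝ) (i : Fin d)
    (x : EuclideanSpace ℝ (Fin d)) :
    partialD i (fun x => MvPolynomial.eval (fun i => x i) p) x =
      MvPolynomial.eval (fun i => x i) (MvPolynomial.pderiv i p) := by
  have hd (p : MvPolynomial (Fin d) ℝ) : DifferentiableAt ℝ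
      (fun x : EuclideanSpace ℝ (Fin d) => MvPolynomial.eval (fun i => x i) p) x :=
    (contDiff_eval p).differentiable (by simp) x
  induction p using MvPolynomial.induction_on with
  | C a => simp [partialD_const]
  | add p q hp hq =>
    simp only [map_add]
    rw [partialD_add i (hd p) (hd q), hp, hq]
  | mul_X p j hp =>
    have h := partialD_mul i (hd p) (v := fun x : EuclideanSpace ℝ (Fin d) => x j) (by fun_prop)
    simp only [map_mul, MvPolynomial.eval_X]
    rw [h, hp, partialD_coord]
    simp only [Derivation.leibniz, MvPolynomial.pderiv_X, smul_eq_mul, map_add, map_mul,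
      MvPolynomial.eval_X]
    congr 2
    by_cases hij : j = i
    · subst hij; simp
    · simp [hij]

theorem lap_eval {d : ℕ} (p : MvPolynomial (Fin d) ℝ) (x : EuclideanSpace ℝ (Fin d)) :
    lap (fun x => MvPolynomial.eval (fun i => x i) p) x =
      MvPolynomial.eval (fun i => x i) (∑ i, MvPolynomial.pderiv i (MvPolynomial.pderiv i p)) := by
  rw [lap, map_sum]
  refine Finset.sum_congr rfl fun i _ => ?_
  rw [← partialD_eval]
  congr 1
  funext y
  exact partialD_eval p i y

theorem eulerD_eval {d l : ℕ} {p : MvPolynomial (Fin d) ℝ} (hp : p.IsHomogeneous l)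
    (x : EuclideanSpace ℝ (Fin d)) :
    eulerD (fun x => MvPolynomial.eval (fun i => x i) p) x =
      l * MvPolynomial.eval (fun i => x i) p := by
  have h := congrArg (MvPolynomial.eval (fun i => x i)) hp.sum_X_mul_pderiv
  simpa [eulerD, partialD_eval] using h

theorem continuous_of_isSphericalHarmonic {l : ℕ}
    {Y : Metric.sphere (0 : EuclideanSpace ℝ (Fin (n + 1))) 1 → ℝ}
    (hY : IsSphericalHarmonic n l Y) : Continuous Y := by
  obtain ⟨p, -, -, h⟩ := hY
  rw [funext h]
  exact (contDiff_eval p).continuous.comp continuous_subtype_val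

/-- Both sides solve the equation, and both quotients by ρ^{n/2-γ} tend to h at the sphere, the
right one because φ_l(1) = 1. Uniqueness in the unit ball concludes. -/
theorem poissonIntegral_of_harmonic {l : ℕ} (hγ : 0 < γ) (hγn : γ < (n : ℝ) / 2)
    {h : EuclideanSpace ℝ (Fin (n + 1)) → ℝ} (hh : ContDiff ℝ 2 h) (hlap : ∀ y, lap h y = 0)
    (heul : ∀ y, eulerD h y = l * h y) {x : EuclideanSpace ℝ (Fin (n + 1))} (hx : ‖x‖ < 1) :
    poissonIntegral n γ (fun ξ => h ξ) x =
      defFun x ^ ((n : ℝ) / 2 - γ) * radialProfile n γ l (‖x‖ ^ 2) * h x := by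
  have hc : Continuous fun ξ : Metric.sphere (0 : EuclideanSpace ℝ (Fin (n + 1))) 1 => h ξ :=
    hh.continuous.comp continuous_subtype_val
  have cP {y : EuclideanSpace ℝ (Fin (n + 1))} (hy : ‖y‖ < 1) :
      ContDiffAt ℝ 2 (poissonIntegral n γ fun ξ => h ξ) y :=
    (contDiffAt_poissonIntegral hc hy).of_le (by norm_cast)
  have cR {y : EuclideanSpace ℝ (Fin (n + 1))} (hy : ‖y‖ < 1) : ContDiffAt ℝ 2
      (fun y => defFun y ^ ((n : ℝ) / 2 - γ) * radialProfile n γ l (‖y‖ ^ 2) * h y) y :=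
    ((contDiffAt_defFun_rpow _ hy).mul
      ((contDiffAt_radialProfile_norm_sq l hγ hy).of_le (by norm_cast))).mul hh.contDiffAt
  have hL {y : EuclideanSpace ℝ (Fin (n + 1))} (hy : ‖y‖ < 1) : scatteringOp n ((n : ℝ) / 2 + γ)
      (fun y => poissonIntegral n γ (fun ξ => h ξ) y -
        defFun y ^ ((n : ℝ) / 2 - γ) * radialProfile n γ l (‖y‖ ^ 2) * h y) y = 0 := by
    rw [scatteringOp_sub hy (cP hy) (cR hy), scatteringOp_poissonIntegral rfl hc hy,
      scatteringOp_radialProfile_mul l rfl hγ hy hh.contDiffAt (hlap y) (heul y), sub_zero]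
  have key := eq_zero_of_scatteringOp_eq_zero (n := n) (γ := γ) (R := 1)
    (w := fun y => poissonIntegral n γ (fun ξ => h ξ) y -
      defFun y ^ ((n : ℝ) / 2 - γ) * radialProfile n γ l (‖y‖ ^ 2) * h y) rfl hγ hγn one_pos le_rfl
    (fun y hy => (cP (mem_ball_zero_iff.1 hy)).sub (cR (mem_ball_zero_iff.1 hy)))
    (fun y hy => hL (mem_ball_zero_iff.1 hy))
    (fun ξ hξ => by
      have h1 := tendsto_poissonIntegral (f := fun ξ => h ξ) hγ hγn hc
        ⟨ξ, mem_sphere_zero_iff_norm.2 hξ⟩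
      have h2 := (tendsto_radialProfile l hγ hγn hξ).mul
        ((hh.continuous.tendsto ξ).mono_left nhdsWithin_le_nhds)
      have h3 := h1.sub h2
      simp only [one_mul, sub_self] at h3
      refine h3.congr' ?_
      filter_upwards [self_mem_nhdsWithin] with y hy
      have := Real.rpow_pos_of_pos (defFun_pos (mem_ball_zero_iff.1 hy)) ((n : ℝ) / 2 - γ)
      rw [sub_div, mul_assoc, mul_div_cancel_left₀ _ this.ne']) x (mem_ball_zero_iff.2 hx)
  exact sub_eq_zero.1 key

theorem eval_smul_of_isHomogeneous {d l : ℕ} {p : MvPolynomial (Fin d) ℝ} (hp : p.IsHomogeneous l)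
    (r : ℝ) (x : EuclideanSpace ℝ (Fin d)) :
    MvPolynomial.eval (fun i => (r • x) i) p = r ^ l * MvPolynomial.eval (fun i => x i) p := by
  rw [MvPolynomial.eval_eq, MvPolynomial.eval_eq, Finset.mul_sum]
  refine Finset.sum_congr rfl fun m hm => ?_
  have h1 : ∑ i ∈ m.support, m i = l := by
    have := hp (MvPolynomial.mem_support_iff.1 hm)
    rwa [Finsupp.weight_apply, Finsupp.sum, Finset.sum_congr rfl fun i _ => by
      rw [Pi.one_apply, smul_eq_mul, mul_one]] at this
  simp only [PiLp.smul_apply, smul_eq_mul, mul_pow, Finset.prod_mul_distrib]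
  rw [Finset.prod_pow_eq_pow_sum, h1]
  ring

theorem poissonIntegral_sphericalHarmonic {l : ℕ} (hγ : 0 < γ) (hγn : γ < (n : ℝ) / 2)
    {Y : Metric.sphere (0 : EuclideanSpace ℝ (Fin (n + 1))) 1 → ℝ}
    (hY : IsSphericalHarmonic n l Y) {r : ℝ} (hr0 : 0 ≤ r) (hr1 : r < 1)
    (ξ : Metric.sphere (0 : EuclideanSpace ℝ (Fin (n + 1))) 1) :
    poissonIntegral n γ Y (r • (ξ : EuclideanSpace ℝ (Fin (n + 1)))) =
      ((1 - r ^ 2) / 2) ^ ((n : ℝ) / 2 - γ) * (radialProfile n γ l (r ^ 2) * r ^ l * Y ξ) := by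
  obtain ⟨p, hp, hharm, h⟩ := hY
  have hn : ‖r • (ξ : EuclideanSpace ℝ (Fin (n + 1)))‖ = r := by
    rw [norm_smul, Real.norm_of_nonneg hr0]; simp
  have hY : Y = fun ξ : Metric.sphere (0 : EuclideanSpace ℝ (Fin (n + 1))) 1 =>
      MvPolynomial.eval (fun i => (ξ : EuclideanSpace ℝ (Fin (n + 1))) i) p := funext h
  have key := poissonIntegral_of_harmonic (l := l) hγ hγn
    (h := fun x => MvPolynomial.eval (fun i => x i) p)
    ((contDiff_eval p).of_le (by norm_cast)) (fun y => by rw [lap_eval, hharm, map_zero])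
    (eulerD_eval hp) (x := r • (ξ : EuclideanSpace ℝ (Fin (n + 1)))) (by rw [hn]; exact hr1)
  rw [hY, key, eval_smul_of_isHomogeneous hp, defFun, hn]
  ring

theorem poissonIntegral_sum {f : ℕ → Metric.sphere (0 : EuclideanSpace ℝ (Fin (n + 1))) 1 → ℝ}
    (hf : ∀ l, Continuous (f l)) {x : EuclideanSpace ℝ (Fin (n + 1))} (hx : ‖x‖ < 1) (N : ℕ) :
    poissonIntegral n γ (fun ξ => ∑ l ∈ Finset.range N, f l ξ) x =
      ∑ l ∈ Finset.range N, poissonIntegral n γ (f l) x := by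
  simp only [poissonIntegral_eq, Finset.sum_mul]
  rw [integral_finsetSum _ fun l _ => integrable_mul_ballKernel_rpow (hf l) hx _, Finset.mul_sum]

/-- For x fixed inside the ball the kernel is bounded on the sphere, so L¹ convergence suffices; it
follows from L² convergence because the measure is finite. -/
theorem tendsto_sum_poissonIntegral {f : Metric.sphere (0 : EuclideanSpace ℝ (Fin (n + 1))) 1 → ℝ}
    {Y : ℕ → Metric.sphere (0 : EuclideanSpace ℝ (Fin (n + 1))) 1 → ℝ} (hf : Continuous f)
    (hY : IsHarmonicExpansion n f Y) {x : EuclideanSpace ℝ (Fin (n + 1))} (hx : ‖x‖ < 1) :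
    Tendsto (fun N => ∑ l ∈ Finset.range N, poissonIntegral n γ (Y l) x) atTop
      (𝓝 (poissonIntegral n γ f x)) := by
  set b : ℝ := (n : ℝ) / 2 + γ
  have hYc (l : ℕ) := continuous_of_isSphericalHarmonic (hY.1 l)
  have hSc (N : ℕ) : Continuous fun ξ => ∑ l ∈ Finset.range N, Y l ξ :=
    continuous_finsetSum _ fun l _ => hYc l
  have hk : Continuous fun ξ : Metric.sphere (0 : EuclideanSpace ℝ (Fin (n + 1))) 1 =>
      ballKernel (ξ : EuclideanSpace ℝ (Fin (n + 1))) x ^ b :=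
    (contDiffOn_ballKernel_rpow b).continuousOn.comp_continuous
      (f := fun ξ : Metric.sphere (0 : EuclideanSpace ℝ (Fin (n + 1))) 1 =>
        (x, (ξ : EuclideanSpace ℝ (Fin (n + 1))))) (by fun_prop) (mem_kernelDomain hx)
  obtain ⟨M, hM⟩ := isCompact_univ.exists_bound_of_continuousOn hk.continuousOn
  have h1 : Tendsto (fun N : ℕ => ∫ ξ, ‖f ξ - ∑ l ∈ Finset.range N, Y l ξ‖ ∂(surfaceMeasure n))
      atTop (𝓝 0) := by
    have hle (N : ℕ) : eLpNorm (fun ξ => f ξ - ∑ l ∈ Finset.range N, Y l ξ) 1 (surfaceMeasure n) ≤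
        eLpNorm (fun ξ => f ξ - ∑ l ∈ Finset.range N, Y l ξ) 2 (surfaceMeasure n) *
          surfaceMeasure n Set.univ ^ (1 / (1 : ENNReal).toReal - 1 / (2 : ENNReal).toReal) :=
      eLpNorm_le_eLpNorm_mul_rpow_measure_univ (by norm_num)
        (hf.sub (hSc N)).aestronglyMeasurable
    have hz : Tendsto (fun N : ℕ => eLpNorm (fun ξ => f ξ - ∑ l ∈ Finset.range N, Y l ξ) 1
        (surfaceMeasure n)) atTop (𝓝 0) := by
      refine tendsto_of_tendsto_of_tendsto_of_le_of_le tendsto_const_nhds ?_ (fun _ => zero_le) hle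
      have := ENNReal.Tendsto.mul_const hY.2 (b := surfaceMeasure n Set.univ ^
        (1 / (1 : ENNReal).toReal - 1 / (2 : ENNReal).toReal)) (.inr (by
          refine (ENNReal.rpow_lt_top_of_nonneg ?_ (measure_ne_top _ _)).ne
          norm_num))
      simpa using this
    have := (ENNReal.tendsto_toReal ENNReal.zero_ne_top).comp hz
    refine this.congr fun N => ?_
    rw [Function.comp_apply, eLpNorm_one_eq_lintegral_enorm]
    exact (integral_norm_eq_lintegral_enorm (hf.sub (hSc N)).aestronglyMeasurable).symm
  have h2 : Tendsto (fun N : ℕ => |poissonConst n γ| * (M *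
      ∫ ξ, ‖f ξ - ∑ l ∈ Finset.range N, Y l ξ‖ ∂(surfaceMeasure n))) atTop (𝓝 0) := by
    simpa using (h1.const_mul M).const_mul |poissonConst n γ|
  rw [tendsto_iff_norm_sub_tendsto_zero]
  refine squeeze_zero (fun _ => norm_nonneg _) (fun N => ?_) h2
  rw [← poissonIntegral_sum hYc hx, poissonIntegral_eq, poissonIntegral_eq, ← mul_sub, norm_mul,
    Real.norm_eq_abs (poissonConst n γ), ← integral_sub (integrable_mul_ballKernel_rpow (hSc N) hx _)
      (integrable_mul_ballKernel_rpow hf hx _)]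
  refine mul_le_mul_of_nonneg_left ?_ (abs_nonneg _)
  rw [← integral_const_mul]
  refine norm_integral_le_of_norm_le ?_ (Eventually.of_forall fun ξ => ?_)
  · have : Continuous fun ξ => M * ‖f ξ - ∑ l ∈ Finset.range N, Y l ξ‖ :=
      continuous_const.mul (hf.sub (hSc N)).norm
    exact this.integrable_of_hasCompactSupport (HasCompactSupport.of_compactSpace _)
  · rw [← sub_mul, norm_mul, mul_comm, norm_sub_rev]
    exact mul_le_mul_of_nonneg_right (hM ξ trivial) (norm_nonneg _)

/-- The partial sums converge at every radius below 1, which identifies the sum. For absolute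
convergence at r, the terms are compared with those at some r' > r, which are bounded; the profile
ratio is bounded in l, so the factor (r/r')^l gives a geometric majorant. -/
theorem poissonIntegral_harmonicExpansion (hγ : 0 < γ) (hγn : γ < (n : ℝ) / 2)
    {f : Metric.sphere (0 : EuclideanSpace ℝ (Fin (n + 1))) 1 → ℝ}
    {Y : ℕ → Metric.sphere (0 : EuclideanSpace ℝ (Fin (n + 1))) 1 → ℝ} (hf : Continuous f)
    (hY : IsHarmonicExpansion n f Y) {r : ℝ} (hr0 : 0 ≤ r) (hr1 : r < 1)
    (ξ : Metric.sphere (0 : EuclideanSpace ℝ (Fin (n + 1))) 1) :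
    Summable (fun l : ℕ => radialProfile n γ l (r ^ 2) * r ^ l * Y l ξ) ∧
      poissonIntegral n γ f (r • (ξ : EuclideanSpace ℝ (Fin (n + 1)))) =
        ((1 - r ^ 2) / 2) ^ ((n : ℝ) / 2 - γ) *
          ∑' l : ℕ, radialProfile n γ l (r ^ 2) * r ^ l * Y l ξ := by
  have hn {r : ℝ} (hr0 : 0 ≤ r) : ‖r • (ξ : EuclideanSpace ℝ (Fin (n + 1)))‖ = r := by
    rw [norm_smul, Real.norm_of_nonneg hr0]; simp
  have hlim {r : ℝ} (hr0 : 0 ≤ r) (hr1 : r < 1) : Tendsto (fun N => ∑ l ∈ Finset.range N,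
      radialProfile n γ l (r ^ 2) * r ^ l * Y l ξ) atTop
      (𝓝 ((((1 - r ^ 2) / 2) ^ ((n : ℝ) / 2 - γ))⁻¹ *
        poissonIntegral n γ f (r • (ξ : EuclideanSpace ℝ (Fin (n + 1)))))) := by
    have hpos : 0 < ((1 - r ^ 2) / 2) ^ ((n : ℝ) / 2 - γ) :=
      Real.rpow_pos_of_pos (by nlinarith) _
    refine ((tendsto_sum_poissonIntegral hf hY ((hn hr0).trans_lt hr1)).const_mul _).congr
      fun N => ?_
    rw [Finset.mul_sum]
    refine Finset.sum_congr rfl fun l _ => ?_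
    rw [poissonIntegral_sphericalHarmonic hγ hγn (hY.1 l) hr0 hr1 ξ,
      inv_mul_cancel_left₀ hpos.ne']
  obtain ⟨r', h1, h2⟩ := exists_between hr1
  have hr' : 0 < r' := hr0.trans_lt h1
  -- The terms are differences of consecutive convergent partial sums, hence tend to 0.
  have hbdd : ∃ B, ∀ l, |radialProfile n γ l (r' ^ 2) * r' ^ l * Y l ξ| ≤ B := by
    have h3 := (hlim hr'.le h2)
    have h4 := ((tendsto_add_atTop_iff_nat 1).2 h3).sub h3
    simp only [Finset.sum_range_succ_sub_sum] at h4
    obtain ⟨B, hB⟩ := h4.norm.bddAbove_range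
    exact ⟨B, fun l => hB ⟨l, rfl⟩⟩
  obtain ⟨B, hB⟩ := hbdd
  have hz : r ^ 2 ∈ Set.Ico (0 : ℝ) 1 := ⟨by positivity, by nlinarith⟩
  have hz' : r' ^ 2 ∈ Set.Ico (0 : ℝ) 1 := ⟨by positivity, by nlinarith⟩
  obtain ⟨M, hM, hMle⟩ := exists_radialProfile_le hγ hγn hz hz'
  have hsum : Summable (fun l : ℕ => radialProfile n γ l (r ^ 2) * r ^ l * Y l ξ) := by
    have hq : r / r' < 1 := (div_lt_one hr').2 h1
    refine Summable.of_norm_bounded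
      ((summable_geometric_of_lt_one (by positivity) hq).mul_left (M * B)) fun l => ?_
    have e1 := radialProfile_pos (n := n) l hγ hγn (Set.Ico_subset_Icc_self hz)
    have e2 := radialProfile_pos (n := n) l hγ hγn (Set.Ico_subset_Icc_self hz')
    have e3 := hB l
    rw [abs_mul, abs_mul, abs_of_pos e2, abs_of_pos (pow_pos hr' l)] at e3
    rw [norm_mul, norm_mul, Real.norm_of_nonneg e1.le, Real.norm_of_nonneg (pow_nonneg hr0 l),
      Real.norm_eq_abs]
    calc _ ≤ M * radialProfile n γ l (r' ^ 2) * r ^ l * |Y l ξ| := by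
          gcongr
          exact hMle l
      _ = M * (radialProfile n γ l (r' ^ 2) * r' ^ l * |Y l ξ|) * (r / r') ^ l := by
          rw [div_pow]; field_simp
      _ ≤ _ := by gcongr
  refine ⟨hsum, ?_⟩
  have hpos : 0 < ((1 - r ^ 2) / 2) ^ ((n : ℝ) / 2 - γ) := Real.rpow_pos_of_pos (by nlinarith) _
  rw [tendsto_nhds_unique hsum.hasSum.tendsto_sum_nat (hlim hr0 hr1), mul_inv_cancel_left₀ hpos.ne']

end SphericalHarmonics

end

noncomputable section
open Filter Topology MeasureTheory

/-! ### A Bessel-type integral: decay, derivative and recurrence. -/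

section BesselIntegral

variable {β w : ℝ}

/-- The Bessel-type integral `∫_0^∞ τ^{β-1} e^{-τ-w/τ} dτ = 2 w^{β/2} K_β(2√w)`. -/
def besselIntegral (β w : ℝ) : ℝ :=
  ∫ τ in Set.Ioi (0 : ℝ), τ ^ (β - 1) * Real.exp (-τ - w / τ)

/-- From e^{w/τ} ≥ (w/τ)^N/N!: the factor e^{-w/τ} compensates any negative power of τ at 0. With N
> -β the right side is a Gamma integrand, so no restriction on β is needed. -/
theorem rpow_mul_exp_neg_sub_div_le (hw : 0 < w) (N : ℕ) {τ : ℝ} (hτ : 0 < τ) :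
    τ ^ β * Real.exp (-τ - w / τ) ≤
      N.factorial / w ^ N * (τ ^ (β + N) * Real.exp (-τ)) := by
  have h1 := Real.pow_div_factorial_le_exp (w / τ) (by positivity) N
  have h2 : Real.exp (-(w / τ)) ≤ N.factorial * τ ^ N / w ^ N := by
    rw [Real.exp_neg]
    refine (inv_anti₀ (by positivity) h1).trans_eq ?_
    rw [div_pow]
    field_simp
  rw [sub_eq_add_neg, Real.exp_add, Real.rpow_add hτ, Real.rpow_natCast]
  calc _ = τ ^ β * Real.exp (-τ) * Real.exp (-(w / τ)) := by ring
    _ ≤ τ ^ β * Real.exp (-τ) * (N.factorial * τ ^ N / w ^ N) := by gcongr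
    _ = _ := by ring

theorem continuousOn_besselIntegrand (β w : ℝ) :
    ContinuousOn (fun τ : ℝ => τ ^ β * Real.exp (-τ - w / τ)) (Set.Ioi 0) := by
  intro τ hτ
  have hτ : τ ≠ 0 := ne_of_gt hτ
  refine ContinuousAt.continuousWithinAt ?_
  refine (Real.continuousAt_rpow_const _ _ (.inl hτ)).mul (ContinuousAt.rexp ?_)
  exact continuousAt_id.neg.sub (continuousAt_const.div continuousAt_id hτ)

theorem integrableOn_besselIntegrand (β : ℝ) (hw : 0 < w) :
    IntegrableOn (fun τ : ℝ => τ ^ β * Real.exp (-τ - w / τ)) (Set.Ioi 0) := by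
  obtain ⟨N, hN⟩ := exists_nat_gt (-β)
  have hg := (Real.GammaIntegral_convergent (s := β + N + 1) (by linarith)).const_mul
    (N.factorial / w ^ N)
  refine Integrable.mono' hg
    ((continuousOn_besselIntegrand β w).aestronglyMeasurable measurableSet_Ioi) ?_
  filter_upwards [ae_restrict_mem measurableSet_Ioi] with τ hτ
  have hτ : 0 < τ := hτ
  rw [Real.norm_of_nonneg (by positivity)]
  refine (rpow_mul_exp_neg_sub_div_le hw N hτ).trans_eq ?_
  rw [add_sub_cancel_right]
  ring

theorem besselIntegral_nonneg (β w : ℝ) : 0 ≤ besselIntegral β w :=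
  setIntegral_nonneg measurableSet_Ioi fun _ hτ =>
    mul_nonneg (Real.rpow_nonneg (le_of_lt hτ) _) (Real.exp_pos _).le

theorem besselIntegral_anti (β : ℝ) {w w' : ℝ} (hw : 0 < w) (h : w ≤ w') :
    besselIntegral β w' ≤ besselIntegral β w := by
  refine setIntegral_mono_on (integrableOn_besselIntegrand _ (hw.trans_le h))
    (integrableOn_besselIntegrand _ hw) measurableSet_Ioi fun τ hτ => ?_
  have hτ : 0 < τ := hτ
  gcongr

theorem hasDerivAt_besselIntegral (β : ℝ) (hw : 0 < w) :
    HasDerivAt (besselIntegral β) (-besselIntegral (β - 1) w) w := by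
  -- For w' within w/2 of w one has w' ≥ w/2, so the integrand at w/2 dominates.
  have hb := integrableOn_besselIntegrand (β - 1 - 1) (half_pos hw)
  have key := hasDerivAt_integral_of_dominated_loc_of_deriv_le (𝕜 := ℝ)
    (μ := volume.restrict (Set.Ioi (0 : ℝ)))
    (F := fun w τ => τ ^ (β - 1) * Real.exp (-τ - w / τ))
    (F' := fun w τ => -(τ ^ (β - 1 - 1) * Real.exp (-τ - w / τ))) (x₀ := w)
    (Metric.ball_mem_nhds w (half_pos hw))
    (Eventually.of_forall fun w =>
      (continuousOn_besselIntegrand _ w).aestronglyMeasurable measurableSet_Ioi)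
    (integrableOn_besselIntegrand _ hw)
    ((continuousOn_besselIntegrand _ w).aestronglyMeasurable measurableSet_Ioi).neg
    (by
      filter_upwards [ae_restrict_mem measurableSet_Ioi] with τ hτ w' hw'
      have hτ : 0 < τ := hτ
      have hw' : w / 2 ≤ w' := by
        have := abs_lt.1 (Metric.mem_ball.1 hw')
        linarith
      rw [norm_neg, Real.norm_of_nonneg (by positivity)]
      gcongr) hb
    (by
      filter_upwards [ae_restrict_mem measurableSet_Ioi] with τ hτ w' _
      have hτ : 0 < τ := hτ
      have h1 : HasDerivAt (fun w : ℝ => -τ - w / τ) (-(1 / τ)) w' := by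
        simpa using ((hasDerivAt_id w').div_const τ).const_sub (-τ)
      refine (h1.exp.const_mul (τ ^ (β - 1))).congr_deriv ?_
      rw [Real.rpow_sub_one hτ.ne' (β - 1)]
      ring)
  refine key.2.congr_deriv ?_
  rw [integral_neg, besselIntegral]

/-- Integration by parts. -/
theorem besselIntegral_recurrence (β : ℝ) (hw : 0 < w) :
    besselIntegral (β + 1) w = β * besselIntegral β w + w * besselIntegral (β - 1) w := by
  have i1 := (integrableOn_besselIntegrand (β - 1) hw).const_mul β
  have i2 := integrableOn_besselIntegrand (β + 1 - 1) hw
  have i3 := (integrableOn_besselIntegrand (β - 1 - 1) hw).const_mul w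
  have i12 : IntegrableOn (fun τ : ℝ => β * (τ ^ (β - 1) * Real.exp (-τ - w / τ)) -
        τ ^ (β + 1 - 1) * Real.exp (-τ - w / τ)) (Set.Ioi 0) := i1.sub i2
  have i123 : IntegrableOn (fun τ : ℝ => β * (τ ^ (β - 1) * Real.exp (-τ - w / τ)) -
        τ ^ (β + 1 - 1) * Real.exp (-τ - w / τ) +
        w * (τ ^ (β - 1 - 1) * Real.exp (-τ - w / τ))) (Set.Ioi 0) := i12.add i3
  have hlim0 : Tendsto (fun τ : ℝ => τ ^ β * Real.exp (-τ - w / τ)) (𝓝[>] 0) (𝓝 0) := by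
    obtain ⟨N, hN⟩ := exists_nat_gt (-β)
    have h : Tendsto (fun τ : ℝ => N.factorial / w ^ N * (τ ^ (β + N) * Real.exp (-τ)))
        (𝓝[>] 0) (𝓝 0) := by
      have h1 : ContinuousAt (fun τ : ℝ => N.factorial / w ^ N * (τ ^ (β + N) * Real.exp (-τ))) 0 :=
        ((Real.continuousAt_rpow_const _ _ (.inr (by linarith))).mul
          (by fun_prop)).const_mul _
      have h2 := h1.tendsto
      rw [Real.zero_rpow (by linarith), zero_mul, mul_zero] at h2
      exact h2.mono_left nhdsWithin_le_nhds
    refine squeeze_zero' ?_ ?_ h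
    · filter_upwards [self_mem_nhdsWithin] with τ hτ
      have hτ : 0 < τ := hτ
      positivity
    · filter_upwards [self_mem_nhdsWithin] with τ hτ using rpow_mul_exp_neg_sub_div_le hw N hτ
  have hlim1 : Tendsto (fun τ : ℝ => τ ^ β * Real.exp (-τ - w / τ)) atTop (𝓝 0) := by
    refine squeeze_zero' ?_ ?_ (tendsto_rpow_mul_exp_neg_mul_atTop_nhds_zero β 1 one_pos)
    · filter_upwards [eventually_gt_atTop 0] with τ hτ
      positivity
    · filter_upwards [eventually_gt_atTop 0] with τ hτ
      have : 0 < w / τ := by positivity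
      gcongr
      linarith
  have hd : ∀ τ ∈ Set.Ioi (0 : ℝ), HasDerivAt (fun τ : ℝ => Real.exp (-τ - w / τ))
      (Real.exp (-τ - w / τ) * (-1 + w / τ ^ 2)) τ := by
    intro τ hτ
    have hτ : τ ≠ 0 := ne_of_gt hτ
    have h1 : HasDerivAt (fun τ : ℝ => -τ - w / τ) (-1 + w / τ ^ 2) τ := by
      refine ((hasDerivAt_id τ).neg.sub ((hasDerivAt_const τ w).div (hasDerivAt_id τ) hτ)).congr_deriv
        ?_
      simp only [id]; ring
    exact h1.exp
  have hsum : Set.EqOn (fun τ : ℝ => β * τ ^ (β - 1) * Real.exp (-τ - w / τ) +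
      τ ^ β * (Real.exp (-τ - w / τ) * (-1 + w / τ ^ 2)))
      (fun τ : ℝ => β * (τ ^ (β - 1) * Real.exp (-τ - w / τ)) -
        τ ^ (β + 1 - 1) * Real.exp (-τ - w / τ) +
        w * (τ ^ (β - 1 - 1) * Real.exp (-τ - w / τ))) (Set.Ioi 0) := by
    intro τ hτ
    have hτ : 0 < τ := hτ
    simp only
    rw [add_sub_cancel_right, Real.rpow_sub_one hτ.ne' (β - 1), Real.rpow_sub_one hτ.ne' β]
    field_simp
    ring
  have key := integral_Ioi_deriv_mul_eq_sub (a := (0 : ℝ)) (u := fun τ : ℝ => τ ^ β)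
    (v := fun τ : ℝ => Real.exp (-τ - w / τ)) (u' := fun τ : ℝ => β * τ ^ (β - 1))
    (fun τ hτ => Real.hasDerivAt_rpow_const (.inl (ne_of_gt hτ))) hd
    (i123.congr_fun hsum.symm measurableSet_Ioi) hlim0 hlim1
  rw [setIntegral_congr_fun measurableSet_Ioi hsum, integral_add i12 i3,
    integral_sub i1 i2, integral_const_mul, integral_const_mul, sub_zero] at key
  simp only [besselIntegral]
  linarith

end BesselIntegral

end

noncomputable section
open Filter Topology MeasureTheory

/-! ### The regular power-series solution and reduction of order. -/

section BesselSeries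

variable {γ : ℝ}

/-- The coefficients of the regular solution of `w P'' + (1 - γ) P' = P`. -/
def besselCoeff (γ : ℝ) : ℕ → ℝ
  | 0 => 1
  | j + 1 => besselCoeff γ j / ((j + 1) * (j + 1 - γ))

theorem besselCoeff_pos (hγ1 : γ < 1) (j : ℕ) : 0 < besselCoeff γ j := by
  induction j with
  | zero => exact one_pos
  | succ j ih =>
    have : 0 < (j : ℝ) + 1 - γ := by linarith [(j.cast_nonneg : (0 : ℝ) ≤ j)]
    rw [besselCoeff]
    positivity

theorem mul_besselCoeff_succ (hγ1 : γ < 1) (j : ℕ) :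
    (j + 1 - γ) * ((j + 1) * besselCoeff γ (j + 1)) = besselCoeff γ j := by
  have : (j : ℝ) + 1 - γ ≠ 0 := by linarith [(j.cast_nonneg : (0 : ℝ) ≤ j)]
  have : (j : ℝ) + 1 ≠ 0 := by positivity
  rw [besselCoeff]
  field_simp

theorem besselCoeff_le (hγ1 : γ < 1) (j : ℕ) :
    besselCoeff γ j ≤ ((1 - γ)⁻¹) ^ j / j.factorial := by
  have h0 : 0 < 1 - γ := by linarith
  induction j with
  | zero => simp [besselCoeff]
  | succ j ih =>
    have hj : (0 : ℝ) ≤ j := j.cast_nonneg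
    rw [besselCoeff, Nat.factorial_succ, pow_succ]
    push_cast
    calc besselCoeff γ j / ((j + 1) * (j + 1 - γ))
        ≤ ((1 - γ)⁻¹) ^ j / j.factorial / ((j + 1) * (1 - γ)) := by
          gcongr
          linarith
      _ = _ := by field_simp

theorem convergesOn_besselCoeff (hγ1 : γ < 1) (R : ℝ) : ConvergesOn (besselCoeff γ) R := by
  intro r hr _
  have h0 : 0 < 1 - γ := by linarith
  refine (Real.summable_pow_div_factorial ((1 - γ)⁻¹ * r)).of_nonneg_of_le
    (fun j => by positivity) fun j => ?_
  rw [abs_of_pos (besselCoeff_pos hγ1 j), mul_pow, mul_div_right_comm]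
  gcongr
  exact besselCoeff_le hγ1 j

/-- The regular solution of `w P'' + (1 - γ) P' = P`. -/
def besselSeries (γ w : ℝ) : ℝ := ∑' j, besselCoeff γ j * w ^ j

theorem contDiff_besselSeries (hγ1 : γ < 1) : ContDiff ℝ ∞ (besselSeries γ) :=
  contDiff_iff_contDiffAt.2 fun x =>
    (convergesOn_besselCoeff hγ1 (|x| + 1)).contDiffOn_infty.contDiffAt
      (Metric.isOpen_ball.mem_nhds (by simp))

theorem besselSeries_zero : besselSeries γ 0 = 1 := by
  rw [besselSeries, tsum_eq_single 0 fun j hj => by simp [hj]]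
  simp [besselCoeff]

theorem besselSeries_pos (hγ1 : γ < 1) {w : ℝ} (hw : 0 ≤ w) : 0 < besselSeries γ w := by
  refine ((convergesOn_besselCoeff hγ1 (|w| + 1)).summable (by simp)).tsum_pos
    (fun j => mul_nonneg (besselCoeff_pos hγ1 j).le (pow_nonneg hw j)) 0 ?_
  simp [besselCoeff]

theorem exists_hasDerivAt_besselSeries (hγ1 : γ < 1) : ∃ P' P'' : ℝ → ℝ,
    (∀ w, HasDerivAt (besselSeries γ) (P' w) w) ∧ (∀ w, HasDerivAt P' (P'' w) w) ∧
      ∀ w, w * P'' w + (1 - γ) * P' w = besselSeries γ w := by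
  have hc (R : ℝ) := convergesOn_besselCoeff hγ1 R
  have hw (w : ℝ) : |w| < |w| + 1 := by linarith
  refine ⟨_, _, fun w => (hc (|w| + 1)).hasDerivAt (hw w),
    fun w => (hc (|w| + 1)).deriv.hasDerivAt (hw w), fun w => ?_⟩
  have h1 := (hc (|w| + 1)).deriv.mul_hasSum (hw w)
  have h2 := ((hc (|w| + 1)).deriv.summable (hw w)).hasSum.mul_left (1 - γ)
  refine (h1.add h2).unique ?_
  refine ((hc (|w| + 1)).summable (hw w)).hasSum.congr_fun fun j => ?_
  rw [← mul_besselCoeff_succ hγ1 j]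
  ring

/-- Reduction of order. -/
theorem exists_hasDerivAt_besselIntegral_div (hγ1 : γ < 1) : ∃ C : ℝ, ∀ w, 0 < w →
    HasDerivAt (fun w => besselIntegral γ w / besselSeries γ w)
      (C * (w ^ (γ - 1) * (besselSeries γ w ^ 2)⁻¹)) w := by
  obtain ⟨P', P'', h1, h2, hode⟩ := exists_hasDerivAt_besselSeries hγ1
  -- D is w^{1-γ} times the Wronskian of the Bessel-type integral k and the series P.
  -- Differentiation lowers β by one up to sign, so the recurrence at γ - 1 reads w k'' + (1-γ) k' =
  -- k, the equation of P. Hence D is constant, and (k/P)' is that constant times w^{γ-1}/P².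
  set D : ℝ → ℝ := fun w => w ^ (1 - γ) *
    (-besselIntegral (γ - 1) w * besselSeries γ w - besselIntegral γ w * P' w) with hD
  have hD' : ∀ w, 0 < w → HasDerivAt D 0 w := by
    intro w hw
    have k1 := hasDerivAt_besselIntegral γ hw
    have k2 := hasDerivAt_besselIntegral (γ - 1) hw
    have hrec := besselIntegral_recurrence (γ - 1) hw
    rw [sub_add_cancel] at hrec
    refine ((Real.hasDerivAt_rpow_const (p := 1 - γ) (.inl hw.ne')).mul
      ((k2.neg.mul (h1 w)).sub (k1.mul (h2 w)))).congr_deriv ?_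
    have hp : w ^ (1 - γ) = w * w ^ (1 - γ - 1) := by
      rw [Real.rpow_sub_one hw.ne']; field_simp
    simp only [Pi.mul_apply, Pi.sub_apply, Pi.neg_apply]
    rw [hp, ← hode w, hrec]
    ring
  refine ⟨D 1, fun w hw => ?_⟩
  have hconst : D w = D 1 := by
    refine (convex_Ioi (0 : ℝ)).is_const_of_fderivWithin_eq_zero (𝕜 := ℝ)
      (fun y hy => (hD' y hy).differentiableAt.differentiableWithinAt) (fun y hy => ?_)
      (Set.mem_Ioi.2 hw) (Set.mem_Ioi.2 one_pos)
    rw [fderivWithin_of_isOpen isOpen_Ioi hy]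
    ext
    simp [(hD' y hy).deriv]
  have hP := besselSeries_pos hγ1 hw.le
  refine ((hasDerivAt_besselIntegral γ hw).div (h1 w) hP.ne').congr_deriv ?_
  rw [← hconst, hD]
  have : w ^ (1 - γ) * w ^ (γ - 1) = 1 := by rw [← Real.rpow_add hw]; simp
  simp only
  field_simp
  linear_combination (-(-besselIntegral (γ - 1) w * besselSeries γ w -
    besselIntegral γ w * P' w)) * this

theorem ConvergesOn.analyticAt {c : ℕ → ℝ} {R : ℝ} (h : ConvergesOn c R) (hR : 0 < R) :
    AnalyticAt ℝ (fun x => ∑' j, c j * x ^ j) 0 := by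
  refine ⟨FormalMultilinearSeries.ofScalars ℝ c, ENNReal.ofReal (R / 2), ?_, by simpa, ?_⟩
  · refine FormalMultilinearSeries.le_radius_of_summable _ ?_
    have := h (R / 2) (by positivity) (by linarith)
    simpa [max_eq_left (half_pos hR).le] using this
  · intro y hy
    have hy : |y| < R := by
      rw [Metric.mem_eball, edist_zero_right, ← ofReal_norm,
        ENNReal.ofReal_lt_ofReal_iff (half_pos hR), Real.norm_eq_abs] at hy
      linarith
    simpa [FormalMultilinearSeries.ofScalars_apply_eq, mul_comm] using (h.summable hy).hasSum

theorem exists_powerSeries_of_analyticAt {q : ℝ → ℝ} (hq : AnalyticAt ℝ q 0) :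
    ∃ m : ℕ → ℝ, ∃ δ > 0, ConvergesOn m δ ∧ ∀ w, |w| < δ → HasSum (fun j => m j * w ^ j) (q w) := by
  obtain ⟨p, r, hp⟩ := hq
  obtain ⟨δ, hδ0, hδ⟩ := ENNReal.lt_iff_exists_nnreal_btwn.1 hp.r_pos
  refine ⟨p.coeff, δ, by exact_mod_cast hδ0, fun t ht0 ht => ?_, fun w hw => ?_⟩
  · lift t to NNReal using ht0
    have := p.summable_norm_mul_pow (r := t)
      (lt_of_lt_of_le ((ENNReal.coe_lt_coe.2 (by exact_mod_cast ht)).trans hδ) hp.r_le)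
    simpa using this
  · have hmem : w ∈ Metric.eball (0 : ℝ) r := by
      rw [Metric.mem_eball, edist_zero_right]
      refine lt_trans ?_ hδ
      rw [← ofReal_norm, Real.norm_eq_abs, ← ENNReal.ofReal_coe_nnreal]
      exact (ENNReal.ofReal_lt_ofReal_iff (by exact_mod_cast hδ0)).2 hw
    have := hp.hasSum hmem
    simpa [FormalMultilinearSeries.apply_eq_pow_smul_coeff, mul_comm] using this

end BesselSeries

/-! ### Regular and singular parts of the Bessel-type integral near 0. -/

section Splitting

variable {γ : ℝ}

open Classical in
/-- The logarithm if `γ` is a natural number, and `1` otherwise. -/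
def resonantLog (γ t : ℝ) : ℝ := if ∃ k : ℕ, γ = k then Real.log t else 1

theorem resonantLog_natCast (k : ℕ) : resonantLog k = Real.log := by
  funext t
  exact if_pos ⟨k, rfl⟩

theorem resonantLog_of_forall_ne (h : ∀ k : ℕ, γ ≠ k) : resonantLog γ = fun _ => 1 := by
  funext t
  exact if_neg fun ⟨k, hk⟩ => h k hk

/-- Termwise integration of w^{γ-1+j} gives w^{γ+j}/(γ+j), that is w^γ times a power series. For 0 ≤
γ < 1 the only exception is γ = j = 0, which produces the logarithm. -/
theorem exists_resonant_primitive (hγ : 0 ≤ γ) {m : ℕ → ℝ} {δ : ℝ}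
    (hm : ConvergesOn m δ) (hγ1 : γ < 1) : ∃ a b : ℝ → ℝ,
      ContDiffOn ℝ ∞ a (Metric.ball 0 δ) ∧ ContDiffOn ℝ ∞ b (Metric.ball 0 δ) ∧
      ∀ w, 0 < w → w < δ → HasDerivAt (fun w => a w + w ^ γ * resonantLog γ w * b w)
        (w ^ (γ - 1) * ∑' j, m j * w ^ j) w := by
  have habs {w : ℝ} (h0 : 0 < w) (h1 : w < δ) : |w| < δ := by rwa [abs_of_pos h0]
  rcases hγ.eq_or_lt with rfl | hγ
  -- Division by zero gives m 0 / 0 = 0, so this series omits the term j = 0, which is accounted for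
  -- by m 0 * log w.
  · have hc : ConvergesOn (fun j => m j / j) δ := fun r hr hrδ =>
      (hm r hr hrδ).of_nonneg_of_le (fun j => by positivity) fun j => by
        refine mul_le_mul_of_nonneg_right ?_ (by positivity)
        rcases j.eq_zero_or_pos with rfl | hj
        · simp
        · rw [abs_div, Nat.abs_cast]
          exact div_le_self (abs_nonneg _) (by exact_mod_cast hj)
    refine ⟨_, fun _ => m 0, hc.contDiffOn_infty, contDiffOn_const, fun w h0 h1 => ?_⟩
    have h := (hc.hasDerivAt (habs h0 h1)).add ((Real.hasDerivAt_log h0.ne').mul_const (m 0))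
    have e1 : resonantLog 0 = Real.log := by exact_mod_cast resonantLog_natCast 0
    simp only [e1, Real.rpow_zero, one_mul]
    refine h.congr_deriv ?_
    rw [(hm.summable (habs h0 h1)).tsum_eq_zero_add, zero_sub, Real.rpow_neg_one, mul_add,
      ← tsum_mul_left, add_comm, pow_zero, mul_one]
    congr 1
    refine tsum_congr fun j => ?_
    have : (j : ℝ) + 1 ≠ 0 := by positivity
    push_cast
    field_simp
    ring
  · have hγj (j : ℕ) : 0 < γ + j := by positivity
    have hc : ConvergesOn (fun j => m j / (γ + j)) δ := fun r hr hrδ =>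
      ((hm r hr hrδ).mul_left γ⁻¹).of_nonneg_of_le (fun j => by positivity) fun j => by
        rw [abs_div, abs_of_pos (hγj j), div_mul_eq_mul_div, div_eq_inv_mul]
        gcongr
        simp
    refine ⟨fun _ => 0, _, contDiffOn_const, hc.contDiffOn_infty, fun w h0 h1 => ?_⟩
    have hne (k : ℕ) : γ ≠ k := by
      rintro rfl
      have h3 : k < 1 := by exact_mod_cast hγ1
      have h4 : 0 < k := by exact_mod_cast hγ
      omega
    simp only [resonantLog_of_forall_ne hne, mul_one, zero_add]
    refine ((Real.hasDerivAt_rpow_const (p := γ) (.inl h0.ne')).mul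
      (hc.hasDerivAt (habs h0 h1))).congr_deriv ?_
    have h2 := hc.mul_hasSum (habs h0 h1)
    have h3 := ((hc.summable (habs h0 h1)).hasSum.mul_left γ).add h2
    rw [show ∑' j, m j * w ^ j = _ from (h3.congr_fun fun j => by
      have := (hγj j).ne'; field_simp).tsum_eq, Real.rpow_sub_one h0.ne']
    field_simp

/-- The quotient of the integral by the regular series P has derivative C w^{γ-1} P^{-2}, where
P^{-2} is analytic at 0 since P(0) = 1. Integrating and multiplying back by P gives the splitting.
The bound γ < 1 keeps the denominators j + 1 - γ of the series positive. -/
theorem exists_splitting_of_lt_one (hγ : 0 ≤ γ) (hγ1 : γ < 1) : ∃ δ > 0, ∃ a b : ℝ → ℝ,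
    ContDiffOn ℝ ∞ a (Metric.ball 0 δ) ∧ ContDiffOn ℝ ∞ b (Metric.ball 0 δ) ∧
    ∀ w, 0 < w → w < δ → besselIntegral γ w = a w + w ^ γ * resonantLog γ w * b w := by
  obtain ⟨C, hC⟩ := exists_hasDerivAt_besselIntegral_div hγ1
  have hPan : AnalyticAt ℝ (besselSeries γ) 0 :=
    (convergesOn_besselCoeff hγ1 1).analyticAt one_pos
  obtain ⟨m, δ, hδ, hm, hsum⟩ := exists_powerSeries_of_analyticAt
    ((hPan.pow 2).inv (by rw [Pi.pow_apply, besselSeries_zero]; norm_num))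
  obtain ⟨a, b, ha, hb, hab⟩ := exists_resonant_primitive hγ hm hγ1
  have hP := (contDiff_besselSeries hγ1).contDiffOn (s := Metric.ball 0 δ)
  set E : ℝ → ℝ := fun w => besselIntegral γ w / besselSeries γ w -
    C * (a w + w ^ γ * resonantLog γ w * b w) with hE
  have hconst : ∀ w ∈ Set.Ioo 0 δ, E w = E (δ / 2) := by
    intro w hw
    have hE' : ∀ y ∈ Set.Ioo 0 δ, HasDerivAt E 0 y := by
      intro y hy
      refine ((hC y hy.1).sub ((hab y hy.1 hy.2).const_mul C)).congr_deriv ?_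
      have := (hsum y (by rw [abs_of_pos hy.1]; exact hy.2)).tsum_eq
      rw [this]
      simp
    refine (convex_Ioo (0 : ℝ) δ).is_const_of_fderivWithin_eq_zero (𝕜 := ℝ)
      (fun y hy => (hE' y hy).differentiableAt.differentiableWithinAt) (fun y hy => ?_)
      hw ⟨by positivity, by linarith⟩
    rw [fderivWithin_of_isOpen isOpen_Ioo hy]
    ext
    simp [(hE' y hy).deriv]
  refine ⟨δ, hδ, fun w => besselSeries γ w * (E (δ / 2) + C * a w),
    fun w => besselSeries γ w * (C * b w), hP.mul (contDiffOn_const.add (contDiffOn_const.mul ha)),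
    hP.mul (contDiffOn_const.mul hb), fun w h0 h1 => ?_⟩
  have h := hconst w ⟨h0, h1⟩
  have hpos := besselSeries_pos hγ1 h0.le
  rw [← h, hE]
  field_simp
  ring

/-- Write k for the integral at γ. The recurrence and the derivative formula give γ k - w k' at γ +
1. On w^γ b the terms with γ cancel and leave -w^{γ+1} b'. When γ is a natural number,
differentiating the logarithm adds -w^γ b, which is smooth and joins the regular part. -/
theorem exists_splitting_succ (hγ : 0 ≤ γ) (h : ∃ δ > 0, ∃ a b : ℝ → ℝ,
    ContDiffOn ℝ ∞ a (Metric.ball 0 δ) ∧ ContDiffOn ℝ ∞ b (Metric.ball 0 δ) ∧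
    ∀ w, 0 < w → w < δ → besselIntegral γ w = a w + w ^ γ * resonantLog γ w * b w) :
    ∃ δ > 0, ∃ a b : ℝ → ℝ,
    ContDiffOn ℝ ∞ a (Metric.ball 0 δ) ∧ ContDiffOn ℝ ∞ b (Metric.ball 0 δ) ∧
    ∀ w, 0 < w → w < δ →
      besselIntegral (γ + 1) w = a w + w ^ (γ + 1) * resonantLog (γ + 1) w * b w := by
  obtain ⟨δ, hδ, a, b, ha, hb, hab⟩ := h
  have hd {g : ℝ → ℝ} (hg : ContDiffOn ℝ ∞ g (Metric.ball 0 δ)) :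
      ContDiffOn ℝ ∞ (deriv g) (Metric.ball 0 δ) :=
    hg.deriv_of_isOpen Metric.isOpen_ball (by simp)
  have hda {g : ℝ → ℝ} (hg : ContDiffOn ℝ ∞ g (Metric.ball 0 δ)) {w : ℝ} (h0 : 0 < w)
      (h1 : w < δ) : HasDerivAt g (deriv g w) w :=
    ((hg.contDiffAt (Metric.isOpen_ball.mem_nhds (by
      simpa [abs_of_pos h0] using h1))).differentiableAt (by simp)).hasDerivAt
  have hk {w D : ℝ} (h0 : 0 < w) (h1 : w < δ)
      (hD : HasDerivAt (fun w => a w + w ^ γ * resonantLog γ w * b w) D w) :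
      besselIntegral (γ + 1) w = γ * (a w + w ^ γ * resonantLog γ w * b w) - w * D := by
    have h2 : HasDerivAt (besselIntegral γ) D w := by
      refine hD.congr_of_eventuallyEq ?_
      filter_upwards [isOpen_Ioo.mem_nhds (⟨h0, h1⟩ : w ∈ Set.Ioo 0 δ)] with y hy
      exact hab y hy.1 hy.2
    rw [← h2.unique (hasDerivAt_besselIntegral γ h0) |>.symm, besselIntegral_recurrence γ h0,
      ← hab w h0 h1]
    ring
  by_cases hres : ∃ k : ℕ, γ = k
  · obtain ⟨k, rfl⟩ := hres
    refine ⟨δ, hδ, fun w => k * a w - w * deriv a w - w ^ k * b w, fun w => -deriv b w,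
      ((contDiffOn_const.mul ha).sub (contDiffOn_id.mul (hd ha))).sub
        ((contDiffOn_id.pow k).mul hb), (hd hb).neg, fun w h0 h1 => ?_⟩
    have e1 : resonantLog ((k : ℝ) + 1) = Real.log := by exact_mod_cast resonantLog_natCast (k + 1)
    have hD := (hda ha h0 h1).add (((Real.hasDerivAt_rpow_const (p := (k : ℝ)) (.inl h0.ne')).mul
      (Real.hasDerivAt_log h0.ne')).mul (hda hb h0 h1))
    rw [hk h0 h1 (by rw [resonantLog_natCast]; exact hD), e1, resonantLog_natCast,
      Real.rpow_sub_one h0.ne', Real.rpow_add_one h0.ne', Real.rpow_natCast]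
    simp only [Pi.mul_apply, Real.rpow_natCast]
    field_simp
    ring
  · have hne (k : ℕ) : γ ≠ k := fun h => hres ⟨k, h⟩
    have hne' (k : ℕ) : γ + 1 ≠ k := by
      rcases k with _ | k
      · intro h
        push_cast at h
        linarith
      · intro h
        refine hne k ?_
        push_cast at h
        linarith
    refine ⟨δ, hδ, fun w => γ * a w - w * deriv a w, fun w => -deriv b w,
      (contDiffOn_const.mul ha).sub (contDiffOn_id.mul (hd ha)), (hd hb).neg, fun w h0 h1 => ?_⟩
    have hD := (hda ha h0 h1).add ((Real.hasDerivAt_rpow_const (p := γ) (.inl h0.ne')).mul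
      (hda hb h0 h1))
    rw [hk h0 h1 (by simp only [resonantLog_of_forall_ne hne, mul_one]; exact hD),
      resonantLog_of_forall_ne hne, resonantLog_of_forall_ne hne', Real.rpow_sub_one h0.ne',
      Real.rpow_add_one h0.ne']
    field_simp
    ring

/-- Descent by unit steps to [0, 1). Integral γ descends to 0, so the value 0 must be admitted as a
base case; it is where the logarithm originates. -/
theorem exists_splitting (hγ : 0 ≤ γ) : ∃ δ > 0, ∃ a b : ℝ → ℝ,
    ContDiffOn ℝ ∞ a (Metric.ball 0 δ) ∧ ContDiffOn ℝ ∞ b (Metric.ball 0 δ) ∧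
    ∀ w, 0 < w → w < δ → besselIntegral γ w = a w + w ^ γ * resonantLog γ w * b w := by
  obtain ⟨k, hk⟩ : ∃ k : ℕ, ⌊γ⌋₊ = k := ⟨_, rfl⟩
  induction k generalizing γ with
  | zero => exact exists_splitting_of_lt_one hγ (Nat.floor_eq_zero.1 hk)
  | succ k ih =>
    have h1 : 1 ≤ γ := by
      have := Nat.floor_le hγ
      rw [hk] at this
      push_cast at this
      linarith [(k.cast_nonneg : (0 : ℝ) ≤ k)]
    have := exists_splitting_succ (γ := γ - 1) (by linarith) (ih (by linarith) (by
      rw [Nat.floor_sub_one, hk]; rfl))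
    simpa using this

end Splitting

end

noncomputable section
open Filter Topology MeasureTheory

/-! ### Smooth functions with bounded derivatives. -/

section BoundedDerivs

/-- Smooth functions all of whose derivatives are bounded. -/
def BoundedDerivs (h : ℝ → ℝ) : Prop :=
  ContDiff ℝ ∞ h ∧ ∀ j, ∃ C, ∀ w, |iteratedDeriv j h w| ≤ C

theorem BoundedDerivs.deriv {h : ℝ → ℝ} (hh : BoundedDerivs h) : BoundedDerivs (deriv h) :=
  ⟨(contDiff_infty_iff_deriv.1 hh.1).2, fun j => by
    obtain ⟨C, hC⟩ := hh.2 (j + 1)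
    exact ⟨C, fun w => by rw [← iteratedDeriv_succ']; exact hC w⟩⟩

theorem BoundedDerivs.bound {h : ℝ → ℝ} (hh : BoundedDerivs h) : ∃ C, ∀ w, |h w| ≤ C := by
  simpa using hh.2 0

theorem BoundedDerivs.hasDerivAt {h : ℝ → ℝ} (hh : BoundedDerivs h) (w : ℝ) :
    HasDerivAt h (_root_.deriv h w) w :=
  (hh.1.differentiable (by simp) w).hasDerivAt

theorem BoundedDerivs.add {h g : ℝ → ℝ} (hh : BoundedDerivs h) (hg : BoundedDerivs g) :
    BoundedDerivs (fun w => h w + g w) := by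
  refine ⟨hh.1.add hg.1, fun j => ?_⟩
  obtain ⟨C, hC⟩ := hh.2 j
  obtain ⟨D, hD⟩ := hg.2 j
  refine ⟨C + D, fun w => ?_⟩
  rw [iteratedDeriv_fun_add (hh.1.contDiffAt.of_le (by exact_mod_cast le_top))
    (hg.1.contDiffAt.of_le (by exact_mod_cast le_top))]
  exact (abs_add_le _ _).trans (add_le_add (hC w) (hD w))

theorem boundedDerivs_of_bound_outside {h : ℝ → ℝ} (hh : ContDiff ℝ ∞ h) {R : ℝ}
    (hb : ∀ j, ∃ C, ∀ w, R < |w| → |iteratedDeriv j h w| ≤ C) : BoundedDerivs h := by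
  refine ⟨hh, fun j => ?_⟩
  obtain ⟨C, hC⟩ := hb j
  obtain ⟨D, hD⟩ := (isCompact_closedBall (0 : ℝ) R).exists_bound_of_continuousOn
    (hh.continuous_iteratedDeriv j (by exact_mod_cast le_top)).continuousOn
  refine ⟨max C D, fun w => ?_⟩
  rcases lt_or_ge R |w| with h1 | h1
  · exact (hC w h1).trans (le_max_left _ _)
  · exact (hD w (by simpa using h1)).trans (le_max_right _ _)

theorem iteratedDeriv_eq_zero_of_eventuallyEq {h : ℝ → ℝ} {w : ℝ} (hw : h =ᶠ[𝓝 w] fun _ => 0)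
    (j : ℕ) : iteratedDeriv j h w = 0 := by
  rw [hw.iteratedDeriv_eq]
  simp

theorem boundedDerivs_of_hasCompactSupport {h : ℝ → ℝ} (hh : ContDiff ℝ ∞ h)
    (hc : HasCompactSupport h) : BoundedDerivs h := by
  obtain ⟨R, hR⟩ := hc.isCompact.isBounded.subset_closedBall 0
  refine boundedDerivs_of_bound_outside hh (R := R) fun j => ⟨0, fun w hw => ?_⟩
  have : w ∉ tsupport h := fun h' => by
    have := hR h'
    rw [mem_closedBall_zero_iff, Real.norm_eq_abs] at this
    linarith
  rw [iteratedDeriv_eq_zero_of_eventuallyEq (notMem_tsupport_iff_eventuallyEq.1 this), abs_zero]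

end BoundedDerivs

/-! ### A global splitting with bounded derivatives. -/

section BesselCutoff

variable {γ : ℝ}

theorem contDiffOn_besselIntegral (γ : ℝ) (N : ℕ) :
    ContDiffOn ℝ N (besselIntegral γ) (Set.Ioi 0) := by
  induction N generalizing γ with
  | zero =>
    exact contDiffOn_zero.2 fun x hx =>
      (hasDerivAt_besselIntegral γ hx).continuousAt.continuousWithinAt
  | succ N ih =>
    push_cast
    rw [contDiffOn_succ_iff_deriv_of_isOpen isOpen_Ioi]
    exact ⟨fun x hx => (hasDerivAt_besselIntegral γ hx).differentiableAt.differentiableWithinAt,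
      by simp, (ih (γ - 1)).neg.congr fun x hx => (hasDerivAt_besselIntegral γ hx).deriv⟩

theorem iteratedDeriv_besselIntegral (γ : ℝ) (j : ℕ) {w : ℝ} (hw : 0 < w) :
    iteratedDeriv j (besselIntegral γ) w = (-1) ^ j * besselIntegral (γ - j) w := by
  induction j generalizing w with
  | zero => simp
  | succ j ih =>
    rw [iteratedDeriv_succ]
    have : iteratedDeriv j (besselIntegral γ) =ᶠ[𝓝 w]
        fun w => (-1) ^ j * besselIntegral (γ - j) w := by
      filter_upwards [isOpen_Ioi.mem_nhds hw] with y hy using ih hy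
    rw [this.deriv_eq, ((hasDerivAt_besselIntegral (γ - j) hw).const_mul _).deriv]
    push_cast
    rw [pow_succ, sub_sub]
    ring

theorem tendsto_besselIntegral_zero (hγ : 0 < γ) :
    Tendsto (besselIntegral γ) (𝓝[>] 0) (𝓝 (besselIntegral γ 0)) := by
  refine tendsto_integral_filter_of_dominated_convergence
    (fun τ => τ ^ (γ - 1) * Real.exp (-τ))
    (Eventually.of_forall fun w =>
      (continuousOn_besselIntegrand _ w).aestronglyMeasurable measurableSet_Ioi) ?_
    (((Real.GammaIntegral_convergent hγ).congr_fun (fun τ _ => mul_comm _ _)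
      measurableSet_Ioi)) ?_
  · filter_upwards [self_mem_nhdsWithin] with w hw
    filter_upwards [ae_restrict_mem measurableSet_Ioi] with τ hτ
    have hτ : 0 < τ := hτ
    have hw : 0 < w := hw
    rw [Real.norm_of_nonneg (by positivity)]
    have : 0 < w / τ := by positivity
    gcongr
    linarith
  · refine Eventually.of_forall fun τ => ?_
    have : Continuous fun w : ℝ => τ ^ (γ - 1) * Real.exp (-τ - w / τ) := by fun_prop
    exact (this.tendsto 0).mono_left nhdsWithin_le_nhds

theorem tendsto_rpow_mul_resonantLog (hγ : 0 < γ) :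
    Tendsto (fun w => w ^ γ * resonantLog γ w) (𝓝[>] 0) (𝓝 0) := by
  unfold resonantLog
  split_ifs
  · exact (tendsto_log_mul_rpow_nhdsGT_zero hγ).congr fun w => mul_comm _ _
  · have := (Real.continuousAt_rpow_const 0 γ (.inr hγ.le)).tendsto
    rw [Real.zero_rpow hγ.ne'] at this
    simpa using this.mono_left nhdsWithin_le_nhds

/-- A cutoff χ localises the splitting near 0, and (1-χ) times the integral is added to the regular
part. Away from 0 the derivatives of the integral are, up to sign, integrals of the same type,
nonincreasing in w and hence bounded. -/
theorem exists_boundedDerivs_splitting (hγ : 0 < γ) : ∃ a b : ℝ → ℝ,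
    BoundedDerivs a ∧ BoundedDerivs b ∧
    ∀ w, 0 ≤ w → besselIntegral γ w = a w + w ^ γ * resonantLog γ w * b w := by
  obtain ⟨δ, hδ, a₀, b₀, ha₀, hb₀, hab⟩ := exists_splitting hγ.le
  let χ : ContDiffBump (0 : ℝ) := ⟨δ / 3, δ / 2, by positivity, by linarith⟩
  have hχ : ContDiff ℝ ∞ χ := χ.contDiff
  have hcut {g : ℝ → ℝ} (hg : ContDiffOn ℝ ∞ g (Metric.ball 0 δ)) :
      BoundedDerivs (fun w => χ w * g w) := by
    have hsub : tsupport (fun w => χ w * g w) ⊆ tsupport χ := tsupport_mul_subset_left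
    refine boundedDerivs_of_hasCompactSupport (contDiff_iff_contDiffAt.2 fun x => ?_)
      χ.hasCompactSupport.mul_right
    by_cases hx : x ∈ tsupport fun w => χ w * g w
    swap
    · exact contDiffAt_const.congr_of_eventuallyEq (notMem_tsupport_iff_eventuallyEq.1 hx)
    have hx' : x ∈ Metric.ball (0 : ℝ) δ := by
      have := hsub hx
      rw [χ.tsupport_eq] at this
      exact Metric.closedBall_subset_ball (half_lt_self hδ) this
    exact hχ.contDiffAt.mul (hg.contDiffAt (Metric.isOpen_ball.mem_nhds hx'))
  -- The extension by 0 to w ≤ 0 is smooth because 1 - χ vanishes near 0.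
  set κ : ℝ → ℝ := fun w => (1 - χ w) * (if 0 < w then besselIntegral γ w else 0) with hκ
  have hκneg {w : ℝ} (hw : w < 0) : κ =ᶠ[𝓝 w] fun _ => 0 := by
    filter_upwards [isOpen_Iio.mem_nhds hw] with y hy
    rw [hκ]
    simp only
    rw [if_neg (not_lt.2 (le_of_lt hy)), mul_zero]
  have hκs : ContDiff ℝ ∞ κ := by
    refine contDiff_iff_contDiffAt.2 fun w => ?_
    rcases lt_trichotomy w 0 with hw | rfl | hw
    · exact contDiffAt_const.congr_of_eventuallyEq (hκneg hw)
    · refine (contDiffAt_const (c := (0 : ℝ))).congr_of_eventuallyEq ?_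
      filter_upwards [χ.eventuallyEq_one] with y hy
      simp [hκ, hy]
    · refine ((contDiffAt_const (c := (1 : ℝ))).sub hχ.contDiffAt).mul ?_
      refine (ContDiffOn.contDiffAt (contDiffOn_infty.2 (contDiffOn_besselIntegral γ))
        (isOpen_Ioi.mem_nhds hw)).congr_of_eventuallyEq ?_
      filter_upwards [isOpen_Ioi.mem_nhds hw] with y hy
      exact if_pos hy
  have hκb : BoundedDerivs κ := by
    refine boundedDerivs_of_bound_outside hκs (R := δ) fun j =>
      ⟨besselIntegral (γ - j) δ, fun w hw => ?_⟩
    rcases lt_or_ge w 0 with hw0 | hw0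
    · rw [iteratedDeriv_eq_zero_of_eventuallyEq (hκneg hw0), abs_zero]
      exact besselIntegral_nonneg _ _
    · rw [abs_of_nonneg hw0] at hw
      have heq : κ =ᶠ[𝓝 w] besselIntegral γ := by
        filter_upwards [isOpen_Ioi.mem_nhds hw] with y hy
        have hy : δ < y := hy
        have h0 : χ y = 0 := χ.zero_of_le_dist (by
          rw [Real.dist_eq, sub_zero, abs_of_pos (hδ.trans hy)]
          change δ / 2 ≤ y
          linarith)
        simp [hκ, h0, hδ.trans hy]
      rw [heq.iteratedDeriv_eq, iteratedDeriv_besselIntegral γ j (hδ.trans hw), abs_mul, abs_pow,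
        abs_neg, abs_one, one_pow, one_mul, abs_of_nonneg (besselIntegral_nonneg _ _)]
      exact besselIntegral_anti _ hδ hw.le
  have hpos : ∀ w, 0 < w → besselIntegral γ w =
      (χ w * a₀ w + κ w) + w ^ γ * resonantLog γ w * (χ w * b₀ w) := by
    intro w hw
    simp only [hκ, if_pos hw]
    rcases lt_or_ge w δ with h1 | h1
    · have := hab w hw h1
      linear_combination χ w * this
    · have h0 : χ w = 0 := χ.zero_of_le_dist (by
        rw [Real.dist_eq, sub_zero, abs_of_pos hw]
        change δ / 2 ≤ w
        linarith)
      rw [h0]; ring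
  have ha := (hcut ha₀).add hκb
  refine ⟨_, _, ha, hcut hb₀, fun w hw => ?_⟩
  -- The value w = 0, which occurs at frequency ζ = 0, is reached by letting w → 0 from the right; γ
  -- > 0 kills the singular term.
  rcases hw.eq_or_lt with rfl | hw
  · have h1 := (ha.1.continuous.tendsto 0).mono_left (nhdsWithin_le_nhds (s := Set.Ioi 0))
    have h2 := (tendsto_rpow_mul_resonantLog hγ).mul
      (((hcut hb₀).1.continuous.tendsto 0).mono_left (nhdsWithin_le_nhds (s := Set.Ioi 0)))
    have h3 := (h1.add h2).congr' (f₂ := besselIntegral γ) (by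
      filter_upwards [self_mem_nhdsWithin] with w hw using (hpos w hw).symm)
    rw [tendsto_nhds_unique (tendsto_besselIntegral_zero hγ) h3, Real.zero_rpow hγ.ne', zero_mul,
      zero_mul, zero_mul]
  · exact hpos w hw

end BesselCutoff

end

noncomputable section
open Filter Topology MeasureTheory

/-! ### Smoothness of oscillatory integrals in (x, t). -/

section OscillatoryIntegral

variable {n : ℕ}

/-- Measurable functions all of whose moments are integrable. -/
def RapidDecay (m : EuclideanSpace ℝ (Fin n) → ℂ) : Prop :=
  AEStronglyMeasurable m volume ∧ ∀ k : ℕ, Integrable (fun ζ => ‖ζ‖ ^ k * ‖m ζ‖)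

theorem RapidDecay.integrable {m : EuclideanSpace ℝ (Fin n) → ℂ} (hm : RapidDecay m) :
    Integrable m := by
  have := hm.2 0
  simp only [pow_zero, one_mul] at this
  exact (integrable_norm_iff hm.1).1 this

theorem RapidDecay.mul {m g : EuclideanSpace ℝ (Fin n) → ℂ} (hm : RapidDecay m)
    (hg : AEStronglyMeasurable g volume) {C : ℝ} {N : ℕ} (hC : ∀ ζ, ‖g ζ‖ ≤ C * (1 + ‖ζ‖ ^ N)) :
    RapidDecay (fun ζ => m ζ * g ζ) := by
  refine ⟨hm.1.mul hg, fun k => ?_⟩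
  refine Integrable.mono' (((hm.2 k).add (hm.2 (k + N))).const_mul C)
    ((continuous_norm.pow k).aestronglyMeasurable.mul (hm.1.mul hg).norm)
    (Eventually.of_forall fun ζ => ?_)
  rw [Real.norm_of_nonneg (by positivity), norm_mul]
  calc ‖ζ‖ ^ k * (‖m ζ‖ * ‖g ζ‖) ≤ ‖ζ‖ ^ k * (‖m ζ‖ * (C * (1 + ‖ζ‖ ^ N))) := by
        gcongr
        exact hC ζ
    _ = _ := by simp only [Pi.add_apply]; ring

/-- The integral `∫ m(ζ) e^{2πi⟨ζ,x⟩} h(t π² |ζ|²) dζ`, as a function of `(x, t)`. -/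
def oscillatoryIntegral (m : EuclideanSpace ℝ (Fin n) → ℂ) (h : ℝ → ℝ)
    (p : EuclideanSpace ℝ (Fin n) × ℝ) : ℂ :=
  ∫ ζ, m ζ * (Complex.exp ((2 * Real.pi * inner ℝ ζ p.1 : ℝ) * Complex.I) *
    (h (p.2 * (Real.pi * ‖ζ‖) ^ 2) : ℂ))

theorem aestronglyMeasurable_oscillatory {m : EuclideanSpace ℝ (Fin n) → ℂ} (hm : RapidDecay m)
    {h : ℝ → ℝ} (hh : Continuous h) (p : EuclideanSpace ℝ (Fin n) × ℝ) :
    AEStronglyMeasurable (fun ζ => m ζ *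
      (Complex.exp ((2 * Real.pi * inner ℝ ζ p.1 : ℝ) * Complex.I) *
        (h (p.2 * (Real.pi * ‖ζ‖) ^ 2) : ℂ))) volume :=
  hm.1.mul (by fun_prop : Continuous fun ζ : EuclideanSpace ℝ (Fin n) =>
    Complex.exp ((2 * Real.pi * inner ℝ ζ p.1 : ℝ) * Complex.I) *
        (h (p.2 * (Real.pi * ‖ζ‖) ^ 2) : ℂ)).aestronglyMeasurable

theorem norm_oscillatory_le {h : ℝ → ℝ} {C : ℝ} (hC : ∀ w, |h w| ≤ C)
    (p : EuclideanSpace ℝ (Fin n) × ℝ) (c : ℂ) (ζ : EuclideanSpace ℝ (Fin n)) :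
    ‖c * (Complex.exp ((2 * Real.pi * inner ℝ ζ p.1 : ℝ) * Complex.I) *
        (h (p.2 * (Real.pi * ‖ζ‖) ^ 2) : ℂ))‖ ≤ C * ‖c‖ := by
  rw [norm_mul, norm_mul, Complex.norm_exp_ofReal_mul_I, one_mul, Complex.norm_real, mul_comm]
  exact mul_le_mul_of_nonneg_right (hC _) (norm_nonneg _)

theorem integrable_oscillatory {m : EuclideanSpace ℝ (Fin n) → ℂ} (hm : RapidDecay m)
    {h : ℝ → ℝ} (hh : BoundedDerivs h) (p : EuclideanSpace ℝ (Fin n) × ℝ) :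
    Integrable (fun ζ => m ζ *
      (Complex.exp ((2 * Real.pi * inner ℝ ζ p.1 : ℝ) * Complex.I) *
        (h (p.2 * (Real.pi * ‖ζ‖) ^ 2) : ℂ))) := by
  obtain ⟨C, hC⟩ := hh.bound
  exact Integrable.mono' (hm.integrable.norm.const_mul C)
    (aestronglyMeasurable_oscillatory hm hh.1.continuous p)
    (Eventually.of_forall fun ζ => norm_oscillatory_le hC p _ ζ)

theorem RapidDecay.mul_coord {m : EuclideanSpace ℝ (Fin n) → ℂ} (hm : RapidDecay m) (i : Fin n) :
    RapidDecay (fun ζ => m ζ * (2 * Real.pi * Complex.I * (ζ i : ℂ))) := by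
  refine hm.mul (C := 2 * Real.pi) (N := 1) ?_ fun ζ => ?_
  · exact (by fun_prop : Continuous fun ζ : EuclideanSpace ℝ (Fin n) =>
      (2 * Real.pi * Complex.I * (ζ i : ℂ))).aestronglyMeasurable
  · have h1 : ‖ζ i‖ ≤ ‖ζ‖ := PiLp.norm_apply_le ζ i
    simp only [norm_mul, Complex.norm_I, Complex.norm_real, Complex.norm_ofNat, mul_one, pow_one,
      Real.norm_of_nonneg Real.pi_pos.le]
    gcongr
    linarith

theorem RapidDecay.mul_norm_sq {m : EuclideanSpace ℝ (Fin n) → ℂ} (hm : RapidDecay m) :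
    RapidDecay (fun ζ => m ζ * (((Real.pi * ‖ζ‖) ^ 2 : ℝ) : ℂ)) := by
  refine hm.mul (C := Real.pi ^ 2) (N := 2) ?_ fun ζ => ?_
  · exact (by fun_prop : Continuous fun ζ : EuclideanSpace ℝ (Fin n) =>
      (((Real.pi * ‖ζ‖) ^ 2 : ℝ) : ℂ)).aestronglyMeasurable
  · rw [Complex.norm_real, Real.norm_of_nonneg (by positivity), mul_pow]
    gcongr
    linarith

/-- The total derivative of the integrand. -/
def oscillatoryFDeriv (m : EuclideanSpace ℝ (Fin n) → ℂ) (h : ℝ → ℝ)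
    (p : EuclideanSpace ℝ (Fin n) × ℝ) (ζ : EuclideanSpace ℝ (Fin n)) :
    EuclideanSpace ℝ (Fin n) × ℝ →L[ℝ] ℂ :=
  ∑ i, ((EuclideanSpace.proj i : EuclideanSpace ℝ (Fin n) →L[ℝ] ℝ).comp
      (ContinuousLinearMap.fst ℝ _ _)).smulRight ((m ζ * (2 * Real.pi * Complex.I * (ζ i : ℂ))) *
        (Complex.exp ((2 * Real.pi * inner ℝ ζ p.1 : ℝ) * Complex.I) *
          (h (p.2 * (Real.pi * ‖ζ‖) ^ 2) : ℂ))) +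
    (ContinuousLinearMap.snd ℝ (EuclideanSpace ℝ (Fin n)) ℝ).smulRight
      ((m ζ * (((Real.pi * ‖ζ‖) ^ 2 : ℝ) : ℂ)) *
        (Complex.exp ((2 * Real.pi * inner ℝ ζ p.1 : ℝ) * Complex.I) *
          ((deriv h (p.2 * (Real.pi * ‖ζ‖) ^ 2) : ℝ) : ℂ)))

theorem hasFDerivAt_oscillatory (m : EuclideanSpace ℝ (Fin n) → ℂ) {h : ℝ → ℝ}
    (hh : BoundedDerivs h) (p : EuclideanSpace ℝ (Fin n) × ℝ) (ζ : EuclideanSpace ℝ (Fin n)) :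
    HasFDerivAt (fun p : EuclideanSpace ℝ (Fin n) × ℝ => m ζ *
      (Complex.exp ((2 * Real.pi * inner ℝ ζ p.1 : ℝ) * Complex.I) *
        (h (p.2 * (Real.pi * ‖ζ‖) ^ 2) : ℂ))) (oscillatoryFDeriv m h p ζ) p := by
  have h1 : HasFDerivAt (fun p : EuclideanSpace ℝ (Fin n) × ℝ => 2 * Real.pi * inner ℝ ζ p.1)
      ((2 * Real.pi) • (innerSL ℝ ζ).comp (ContinuousLinearMap.fst ℝ _ _)) p :=
    (((innerSL ℝ ζ).comp (ContinuousLinearMap.fst ℝ _ ℝ)).hasFDerivAt).const_mul (2 * Real.pi)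
  have h2 : HasFDerivAt (fun p : EuclideanSpace ℝ (Fin n) × ℝ => p.2 * (Real.pi * ‖ζ‖) ^ 2)
      ((Real.pi * ‖ζ‖) ^ 2 • ContinuousLinearMap.snd ℝ (EuclideanSpace ℝ (Fin n)) ℝ) p :=
    (ContinuousLinearMap.snd ℝ (EuclideanSpace ℝ (Fin n)) ℝ).hasFDerivAt.mul_const _
  have h3 := (Complex.ofRealCLM.hasFDerivAt.comp p h1).mul_const Complex.I |>.cexp
  have h4 := Complex.ofRealCLM.hasFDerivAt.comp p ((hh.hasDerivAt _).comp_hasFDerivAt p h2)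
  refine ((h3.mul h4).const_mul (m ζ)).congr_fderiv ?_
  refine ContinuousLinearMap.ext fun v => ?_
  have hin : ((inner ℝ ζ v.1 : ℝ) : ℂ) = ∑ i, (ζ i : ℂ) * (v.1 i : ℂ) := by
    rw [PiLp.inner_apply]
    push_cast
    refine Finset.sum_congr rfl fun i _ => ?_
    simp [mul_comm]
  have hsum (A B : ℂ) : ∑ i, (v.1 i : ℂ) * (A * (2 * Real.pi * Complex.I * (ζ i : ℂ)) * B) =
      A * (2 * Real.pi * Complex.I) * B * ∑ i, (ζ i : ℂ) * (v.1 i : ℂ) := by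
    rw [Finset.mul_sum]
    exact Finset.sum_congr rfl fun i _ => by ring
  simp only [oscillatoryFDeriv, add_apply, smul_apply, sum_apply, ContinuousLinearMap.comp_apply,
    ContinuousLinearMap.coe_fst', ContinuousLinearMap.coe_snd',
    ContinuousLinearMap.smulRight_apply, innerSL_apply_apply, PiLp.proj_apply,
    Complex.ofRealCLM_apply, Complex.real_smul, smul_eq_mul, Complex.ofReal_mul, hin, hsum]
  simp
  ring

theorem hasFDerivAt_oscillatoryIntegral {m : EuclideanSpace ℝ (Fin n) → ℂ} (hm : RapidDecay m)
    {h : ℝ → ℝ} (hh : BoundedDerivs h) (p : EuclideanSpace ℝ (Fin n) × ℝ) :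
    HasFDerivAt (oscillatoryIntegral m h)
      (∑ i, ((EuclideanSpace.proj i : EuclideanSpace ℝ (Fin n) →L[ℝ] ℝ).comp
          (ContinuousLinearMap.fst ℝ _ _)).smulRight
            (oscillatoryIntegral (fun ζ => m ζ * (2 * Real.pi * Complex.I * (ζ i : ℂ))) h p) +
        (ContinuousLinearMap.snd ℝ (EuclideanSpace ℝ (Fin n)) ℝ).smulRight
          (oscillatoryIntegral (fun ζ => m ζ * (((Real.pi * ‖ζ‖) ^ 2 : ℝ) : ℂ)) (deriv h) p)) p := by
  obtain ⟨C, hC⟩ := hh.bound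
  obtain ⟨D, hD⟩ := hh.deriv.bound
  let π (i : Fin n) : EuclideanSpace ℝ (Fin n) × ℝ →L[ℝ] ℝ :=
    (EuclideanSpace.proj i : EuclideanSpace ℝ (Fin n) →L[ℝ] ℝ).comp (ContinuousLinearMap.fst ℝ _ _)
  let τ := ContinuousLinearMap.snd ℝ (EuclideanSpace ℝ (Fin n)) ℝ
  have hc (i : Fin n) (p) := integrable_oscillatory (hm.mul_coord i) hh p
  have hd (p) := integrable_oscillatory hm.mul_norm_sq hh.deriv p
  have hint : Integrable (oscillatoryFDeriv m h p) :=
    (integrable_finsetSum _ fun i _ =>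
      ((ContinuousLinearMap.smulRightL ℝ _ ℂ (π i)).integrable_comp (hc i p))).add
      ((ContinuousLinearMap.smulRightL ℝ _ ℂ τ).integrable_comp (hd p))
  have key := hasFDerivAt_integral_of_dominated_of_fderiv_le (𝕜 := ℝ) (s := Set.univ)
    (bound := fun ζ => ∑ i, ‖π i‖ * (C * ‖m ζ * (2 * Real.pi * Complex.I * (ζ i : ℂ))‖) +
      ‖τ‖ * (D * ‖m ζ * (((Real.pi * ‖ζ‖) ^ 2 : ℝ) : ℂ)‖)) (x₀ := p)
    univ_mem (Eventually.of_forall fun p => aestronglyMeasurable_oscillatory hm hh.1.continuous p)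
    (integrable_oscillatory hm hh p) hint.1
    (Eventually.of_forall fun ζ p _ => by
      refine (norm_add_le _ _).trans (add_le_add ((norm_sum_le _ _).trans
        (Finset.sum_le_sum fun i _ => ?_)) ?_)
      · rw [ContinuousLinearMap.norm_smulRight_apply]
        exact mul_le_mul_of_nonneg_left (norm_oscillatory_le hC p _ ζ) (norm_nonneg _)
      · rw [ContinuousLinearMap.norm_smulRight_apply]
        exact mul_le_mul_of_nonneg_left (norm_oscillatory_le hD p _ ζ) (norm_nonneg _))
    ((integrable_finsetSum _ fun i _ =>
      ((hm.mul_coord i).integrable.norm.const_mul C).const_mul _).add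
      ((hm.mul_norm_sq.integrable.norm.const_mul D).const_mul _))
    (Eventually.of_forall fun ζ p _ => hasFDerivAt_oscillatory m hh p ζ)
  refine key.congr_fderiv ?_
  have e1 (i : Fin n) := (ContinuousLinearMap.smulRightL ℝ _ ℂ (π i)).integral_comp_comm (hc i p)
  have e2 := (ContinuousLinearMap.smulRightL ℝ _ ℂ τ).integral_comp_comm (hd p)
  simp only [oscillatoryFDeriv]
  rw [integral_add, integral_finsetSum]
  · exact congrArg₂ _ (Finset.sum_congr rfl fun i _ => e1 i) e2
  · exact fun i _ => (ContinuousLinearMap.smulRightL ℝ _ ℂ (π i)).integrable_comp (hc i p)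
  · exact integrable_finsetSum _ fun i _ =>
      (ContinuousLinearMap.smulRightL ℝ _ ℂ (π i)).integrable_comp (hc i p)
  · exact (ContinuousLinearMap.smulRightL ℝ _ ℂ τ).integrable_comp (hd p)

/-- A derivative in x multiplies m by 2πi ζ_i; one in t multiplies m by π²|ζ|² and replaces h by h'.
Both classes are stable, so the induction runs over all m and h. Smoothness holds across t = 0,
which is the boundary. -/
theorem contDiff_oscillatoryIntegral {m : EuclideanSpace ℝ (Fin n) → ℂ} (hm : RapidDecay m)
    {h : ℝ → ℝ} (hh : BoundedDerivs h) : ContDiff ℝ ∞ (oscillatoryIntegral m h) := by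
  refine contDiff_infty.2 fun N => ?_
  induction N generalizing m h with
  | zero =>
    exact contDiff_zero.2 (continuous_iff_continuousAt.2 fun p =>
      (hasFDerivAt_oscillatoryIntegral hm hh p).continuousAt)
  | succ N ih =>
    push_cast
    refine contDiff_succ_iff_hasFDerivAt.2
      ⟨_, ?_, fun p => hasFDerivAt_oscillatoryIntegral hm hh p⟩
    exact (ContDiff.sum fun i _ => contDiff_const.smulRight (ih (hm.mul_coord i) hh)).add
      (contDiff_const.smulRight (ih hm.mul_norm_sq hh.deriv))

end OscillatoryIntegral

end

noncomputable section
open Filter Topology MeasureTheory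

/-! ### The Fourier transform of the half-space kernel. -/

section FourierTransformOfKernel

variable {n : ℕ} {γ s ε : ℝ}

theorem integrable_add_norm_sq_rpow (hs : (n : ℝ) / 2 < s) (hε : 0 < ε) :
    Integrable (fun z : EuclideanSpace ℝ (Fin n) => (ε + ‖z‖ ^ 2) ^ (-s)) := by
  have h := integrable_rpow_neg_one_add_norm_sq (E := EuclideanSpace ℝ (Fin n)) (μ := volume)
    (r := 2 * s) (by simp; linarith)
  have hs0 : 0 < s := lt_of_le_of_lt (by positivity) hs
  have hm : 0 < min ε 1 := lt_min hε one_pos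
  have hc : Continuous fun z : EuclideanSpace ℝ (Fin n) => (ε + ‖z‖ ^ 2) ^ (-s) :=
    (by fun_prop : Continuous fun z : EuclideanSpace ℝ (Fin n) => ε + ‖z‖ ^ 2).rpow_const
      fun z => .inl (by positivity)
  refine Integrable.mono' (h.const_mul (min ε 1 ^ (-s))) hc.aestronglyMeasurable
    (Eventually.of_forall fun z => ?_)
  rw [Real.norm_of_nonneg (by positivity), show -(2 * s) / 2 = -s by ring,
    ← Real.mul_rpow hm.le (by positivity)]
  refine Real.rpow_le_rpow_of_nonpos (by positivity) ?_ (by linarith)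
  rw [mul_add, mul_one]
  have : 0 ≤ ‖z‖ ^ 2 := by positivity
  exact add_le_add (min_le_left _ _) (mul_le_of_le_one_left this (min_le_right _ _))

theorem integral_exp_inner_mul_gaussian {t : ℝ} (ht : 0 < t) (ζ : EuclideanSpace ℝ (Fin n)) :
    ∫ z : EuclideanSpace ℝ (Fin n), Complex.exp ((2 * Real.pi * inner ℝ ζ z : ℝ) * Complex.I) *
      (Real.exp (-(t * ‖z‖ ^ 2)) : ℂ) =
      (((Real.pi / t) ^ ((n : ℝ) / 2) * Real.exp (-((Real.pi * ‖ζ‖) ^ 2 / t)) : ℝ) : ℂ) := by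
  have h := GaussianFourier.integral_cexp_neg_mul_sq_norm_add (b := (t : ℂ)) (by simpa)
    (2 * Real.pi * Complex.I) ζ
  have e1 : ∀ z : EuclideanSpace ℝ (Fin n),
      Complex.exp ((2 * Real.pi * inner ℝ ζ z : ℝ) * Complex.I) *
        (Real.exp (-(t * ‖z‖ ^ 2)) : ℂ) =
      Complex.exp (-t * ‖z‖ ^ 2 + 2 * Real.pi * Complex.I * (inner ℝ ζ z : ℝ)) := by
    intro z
    rw [Complex.ofReal_exp, ← Complex.exp_add]
    push_cast
    ring_nf
  simp_rw [e1]
  rw [h, Complex.ofReal_mul, Complex.ofReal_exp, Complex.ofReal_cpow (by positivity)]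
  simp only [finrank_euclideanSpace, Fintype.card_fin]
  push_cast
  congr 2
  have : (t : ℂ) ≠ 0 := by exact_mod_cast ht.ne'
  field_simp
  rw [Complex.I_sq]
  ring

theorem integral_rpow_mul_exp_neg_mul_sub_div (hε : 0 < ε) (γ q : ℝ) :
    ∫ t in Set.Ioi (0 : ℝ), t ^ (γ - 1) * Real.exp (-(ε * t) - q / t) =
      ε ^ (-γ) * besselIntegral γ (ε * q) := by
  have h := integral_comp_mul_left_Ioi
    (fun τ : ℝ => τ ^ (γ - 1) * Real.exp (-τ - ε * q / τ)) 0 hε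
  rw [mul_zero, smul_eq_mul] at h
  have e : Set.EqOn (fun t : ℝ => (ε * t) ^ (γ - 1) * Real.exp (-(ε * t) - ε * q / (ε * t)))
      (fun t => ε ^ (γ - 1) * (t ^ (γ - 1) * Real.exp (-(ε * t) - q / t))) (Set.Ioi 0) := by
    intro t ht
    have ht : 0 < t := ht
    simp only
    rw [Real.mul_rpow hε.le ht.le, mul_div_mul_left _ _ hε.ne', mul_assoc]
  rw [setIntegral_congr_fun measurableSet_Ioi e, integral_const_mul] at h
  have h1 : ε ^ (γ - 1) * ε ^ (-γ) = ε⁻¹ := by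
    rw [← Real.rpow_add hε, ← Real.rpow_neg_one]; ring_nf
  have h2 : ε ^ (γ - 1) ≠ 0 := (Real.rpow_pos_of_pos hε _).ne'
  refine mul_left_cancel₀ h2 (h.trans ?_)
  rw [← mul_assoc, h1, besselIntegral]

/-- The Fourier transform of `(ε + |z|²)^{-s}`, by Gaussian subordination. -/
theorem integral_exp_inner_mul_add_norm_sq_rpow (hγ : 0 < γ) (hs : s = (n : ℝ) / 2 + γ)
    (hε : 0 < ε) (ζ : EuclideanSpace ℝ (Fin n)) :
    ∫ z : EuclideanSpace ℝ (Fin n), Complex.exp ((2 * Real.pi * inner ℝ ζ z : ℝ) * Complex.I) *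
      (((ε + ‖z‖ ^ 2) ^ (-s) : ℝ) : ℂ) =
      ((Real.pi ^ ((n : ℝ) / 2) / Real.Gamma s * (ε ^ (-γ) *
        besselIntegral γ (ε * (Real.pi * ‖ζ‖) ^ 2)) : ℝ) : ℂ) := by
  have hs2 : (n : ℝ) / 2 < s := by linarith
  have hs0 : 0 < s := lt_of_le_of_lt (by positivity) hs2
  have hG := Real.Gamma_pos_of_pos hs0
  have hpos (z : EuclideanSpace ℝ (Fin n)) : 0 < ε + ‖z‖ ^ 2 := by positivity
  -- Subordination: the power is written as a superposition of Gaussians in z. After Fubini each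
  -- Gaussian contributes (π/t)^{n/2}, which lowers t^{s-1} to t^{γ-1}.
  have hgam (z : EuclideanSpace ℝ (Fin n)) :
      ∫ t in Set.Ioi (0 : ℝ), t ^ (s - 1) * Real.exp (-((ε + ‖z‖ ^ 2) * t)) =
        (ε + ‖z‖ ^ 2) ^ (-s) * Real.Gamma s := by
    rw [Real.integral_rpow_mul_exp_neg_mul_Ioi hs0 (hpos z), one_div,
      Real.inv_rpow (hpos z).le, Real.rpow_neg (hpos z).le]
  have hgi (z : EuclideanSpace ℝ (Fin n)) : IntegrableOn
      (fun t : ℝ => t ^ (s - 1) * Real.exp (-((ε + ‖z‖ ^ 2) * t))) (Set.Ioi 0) := by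
    -- A non-integrable function has integral 0 by convention, whereas the value just computed is
    -- positive.
    by_contra hcon
    have := hgam z
    rw [integral_undef hcon] at this
    have h2 := mul_pos (Real.rpow_pos_of_pos (hpos z) (-s)) hG
    linarith
  set Φ : EuclideanSpace ℝ (Fin n) → ℝ → ℂ := fun z t =>
    Complex.exp ((2 * Real.pi * inner ℝ ζ z : ℝ) * Complex.I) *
      ((t ^ (s - 1) * Real.exp (-((ε + ‖z‖ ^ 2) * t)) : ℝ) : ℂ) with hΦ
  have hnorm (z : EuclideanSpace ℝ (Fin n)) {t : ℝ} (ht : t ∈ Set.Ioi (0 : ℝ)) :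
      ‖Φ z t‖ = t ^ (s - 1) * Real.exp (-((ε + ‖z‖ ^ 2) * t)) := by
    have ht : 0 < t := ht
    rw [hΦ, norm_mul, Complex.norm_exp_ofReal_mul_I, one_mul, Complex.norm_real,
      Real.norm_of_nonneg (by positivity)]
  have hint : Integrable (Function.uncurry Φ)
      ((volume : Measure (EuclideanSpace ℝ (Fin n))).prod (volume.restrict (Set.Ioi (0 : ℝ)))) := by
    refine (integrable_prod_iff ?_).2 ⟨Eventually.of_forall fun z => ?_, ?_⟩
    · refine Measurable.aestronglyMeasurable ?_
      simp only [hΦ, Function.uncurry_def]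
      fun_prop
    · simp only [Function.uncurry_apply_pair, hΦ]
      exact Integrable.const_mul (Integrable.ofReal (𝕜 := ℂ) (hgi z))
        (Complex.exp ((2 * Real.pi * inner ℝ ζ z : ℝ) * Complex.I))
    · refine ((integrable_add_norm_sq_rpow hs2 hε).mul_const (Real.Gamma s)).congr
        (Eventually.of_forall fun z => ?_)
      simp only [Function.uncurry_apply_pair]
      rw [setIntegral_congr_fun measurableSet_Ioi fun t ht => hnorm z ht, hgam]
  have hswap := integral_integral_swap hint
  have hleft (z : EuclideanSpace ℝ (Fin n)) : ∫ t in Set.Ioi (0 : ℝ), Φ z t =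
      Complex.exp ((2 * Real.pi * inner ℝ ζ z : ℝ) * Complex.I) *
      (((ε + ‖z‖ ^ 2) ^ (-s) : ℝ) : ℂ) * (Real.Gamma s : ℂ) := by
    simp only [hΦ]
    rw [integral_const_mul, integral_complex_ofReal, hgam]
    push_cast
    ring
  have hright {t : ℝ} (ht : t ∈ Set.Ioi (0 : ℝ)) : ∫ z : EuclideanSpace ℝ (Fin n), Φ z t =
      ((Real.pi ^ ((n : ℝ) / 2) *
        (t ^ (γ - 1) * Real.exp (-(ε * t) - (Real.pi * ‖ζ‖) ^ 2 / t)) : ℝ) : ℂ) := by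
    have ht : 0 < t := ht
    have e (z : EuclideanSpace ℝ (Fin n)) : Φ z t = ((t ^ (s - 1) * Real.exp (-(ε * t)) : ℝ) : ℂ) *
        (Complex.exp ((2 * Real.pi * inner ℝ ζ z : ℝ) * Complex.I) *
          (Real.exp (-(t * ‖z‖ ^ 2)) : ℂ)) := by
      have : Real.exp (-((ε + ‖z‖ ^ 2) * t)) = Real.exp (-(ε * t)) * Real.exp (-(t * ‖z‖ ^ 2)) := by
        rw [← Real.exp_add]; ring_nf
      simp only [hΦ, this]
      push_cast
      ring
    simp_rw [e]
    rw [integral_const_mul, integral_exp_inner_mul_gaussian ht, ← Complex.ofReal_mul]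
    congr 1
    rw [Real.div_rpow Real.pi_pos.le ht.le, sub_eq_add_neg (-(ε * t)), Real.exp_add,
      show s - 1 = (γ - 1) + (n : ℝ) / 2 by rw [hs]; ring, Real.rpow_add ht]
    field_simp
  rw [setIntegral_congr_fun measurableSet_Ioi fun t ht => hright ht, integral_complex_ofReal,
    integral_const_mul, integral_rpow_mul_exp_neg_mul_sub_div hε] at hswap
  simp_rw [hleft] at hswap
  rw [integral_mul_const] at hswap
  have hGc : (Real.Gamma s : ℂ) ≠ 0 := by exact_mod_cast hG.ne'
  rw [← eq_div_iff hGc] at hswap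
  rw [hswap]
  push_cast
  ring

end FourierTransformOfKernel

end

noncomputable section
open Filter Topology MeasureTheory
open scoped FourierTransform

/-! ### Structure of the Poisson integral on the half-space. -/

section HalfSpacePoisson

variable {n : ℕ} {γ s : ℝ}

theorem rapidDecay_schwartzMap (g : SchwartzMap (EuclideanSpace ℝ (Fin n)) ℂ) :
    RapidDecay g :=
  ⟨g.continuous.aestronglyMeasurable, fun k => g.integrable_pow_mul volume k⟩

theorem rpow_le_one_add_pow {γ q : ℝ} (hγ : 0 ≤ γ) {N : ℕ} (hN : γ ≤ N) (hq : 0 ≤ q) :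
    q ^ γ ≤ 1 + q ^ N := by
  rcases le_total q 1 with h | h
  · exact (Real.rpow_le_one hq h hγ).trans (by linarith [pow_nonneg hq N])
  · have := Real.rpow_le_rpow_of_exponent_le h hN
    rw [Real.rpow_natCast] at this
    linarith

theorem abs_rpow_mul_log_le (hγ : 0 < γ) {N : ℕ} (hN : γ + 1 ≤ N) {q : ℝ} (hq : 0 ≤ q) :
    |q ^ γ * Real.log q| ≤ (1 / γ + 1) * (1 + q ^ N) := by
  have hq' : 0 ≤ q ^ N := pow_nonneg hq N
  have hγ' : 0 < 1 / γ := by positivity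
  rcases hq.eq_or_lt with rfl | hq
  · simp only [Real.log_zero, mul_zero, abs_zero]
    positivity
  rcases le_total q 1 with h | h
  · have := (Real.abs_log_mul_self_rpow_lt q γ hq h hγ).le
    rw [mul_comm (q ^ γ)]
    nlinarith
  · rw [abs_mul, abs_of_pos (Real.rpow_pos_of_pos hq γ), abs_of_nonneg (Real.log_nonneg h)]
    calc q ^ γ * Real.log q ≤ q ^ γ * q := by
          have := Real.log_le_self hq.le
          gcongr
      _ = q ^ (γ + 1) := (Real.rpow_add_one hq.ne' γ).symm
      _ ≤ 1 * (1 + q ^ N) := by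
          rw [one_mul]
          exact rpow_le_one_add_pow (by linarith) hN hq.le
      _ ≤ _ := by gcongr; linarith

/-- `RapidDecay` asks for no smoothness of m, so multipliers singular at ζ = 0, such as q^γ and q^γ
log q with q = π²|ζ|², are admissible. -/
theorem RapidDecay.mul_comp_norm_sq {m : EuclideanSpace ℝ (Fin n) → ℂ} (hm : RapidDecay m)
    {g : ℝ → ℝ} (hg : Measurable g) {C : ℝ} (hC : 0 ≤ C) {N : ℕ}
    (hgC : ∀ q, 0 ≤ q → |g q| ≤ C * (1 + q ^ N)) :
    RapidDecay fun ζ => m ζ * (g ((Real.pi * ‖ζ‖) ^ 2) : ℂ) := by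
  refine hm.mul (C := C * (Real.pi ^ 2) ^ N) (N := 2 * N) ?_ fun ζ => ?_
  · exact (Complex.measurable_ofReal.comp (hg.comp (by fun_prop :
      Continuous fun ζ : EuclideanSpace ℝ (Fin n) =>
        (Real.pi * ‖ζ‖) ^ 2).measurable)).aestronglyMeasurable
  · rw [Complex.norm_real, Real.norm_eq_abs, mul_assoc]
    refine (hgC _ (by positivity)).trans (mul_le_mul_of_nonneg_left ?_ hC)
    have h1 : 1 ≤ (Real.pi ^ 2) ^ N :=
      one_le_pow₀ (one_le_pow₀ (by linarith [Real.pi_gt_three]))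
    rw [mul_pow, mul_pow, ← pow_mul ‖ζ‖, mul_add, mul_one]
    linarith

/-- The additivity defect of `resonantLog`. -/
theorem resonantLog_mul {x y : ℝ} (hx : 0 < x) (hy : 0 < y) :
    resonantLog γ (x * y) = resonantLog γ x + (resonantLog γ y - resonantLog γ 1) := by
  unfold resonantLog
  split_ifs
  · rw [Real.log_mul hx.ne' hy.ne', Real.log_one, sub_zero]
  · ring

/-- Inserting Fourier inversion for φ and exchanging integrals turns the convolution into a
frequency integral; m is a constant times the Schwartz function φ̂. -/
theorem exists_rapidDecay_integral_eq {φ : EuclideanSpace ℝ (Fin n) → ℝ} (hφ : ContDiff ℝ ∞ φ)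
    (hc : HasCompactSupport φ) (hγ : 0 < γ) (hs : s = (n : ℝ) / 2 + γ) :
    ∃ m : EuclideanSpace ℝ (Fin n) → ℂ, RapidDecay m ∧
      ∀ x : EuclideanSpace ℝ (Fin n), ∀ ε, 0 < ε →
        ((∫ z, φ z * (ε + ‖x - z‖ ^ 2) ^ (-s) : ℝ) : ℂ) =
          ∫ ζ, m ζ * (Complex.exp ((2 * Real.pi * inner ℝ ζ x : ℝ) * Complex.I) *
            ((ε ^ (-γ) * besselIntegral γ (ε * (Real.pi * ‖ζ‖) ^ 2) : ℝ) : ℂ)) := by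
  have hφc : ContDiff ℝ ∞ fun z => (φ z : ℂ) := Complex.ofRealCLM.contDiff.comp hφ
  have hcc : HasCompactSupport fun z => (φ z : ℂ) := hc.comp_left Complex.ofReal_zero
  set g : SchwartzMap (EuclideanSpace ℝ (Fin n)) ℂ := hcc.toSchwartzMap hφc with hg
  have hgφ (z) : g z = φ z := rfl
  set ĝ : SchwartzMap (EuclideanSpace ℝ (Fin n)) ℂ := 𝓕 g with hĝ
  have hinv (z : EuclideanSpace ℝ (Fin n)) : (φ z : ℂ) =
      ∫ ζ, Complex.exp ((2 * Real.pi * inner ℝ ζ z : ℝ) * Complex.I) * ĝ ζ := by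
    have h1 := g.continuous.fourierInv_fourier_eq g.integrable
      (by rw [← SchwartzMap.fourier_coe]; exact ĝ.integrable)
    have h2 := congrFun h1 z
    rw [Real.fourierInv_eq', ← SchwartzMap.fourier_coe] at h2
    rw [← hgφ, ← h2]
    rfl
  have hC : RapidDecay fun ζ => ĝ ζ * ((Real.pi ^ ((n : ℝ) / 2) / Real.Gamma s : ℝ) : ℂ) := by
    refine (rapidDecay_schwartzMap ĝ).mul aestronglyMeasurable_const
      (C := ‖((Real.pi ^ ((n : ℝ) / 2) / Real.Gamma s : ℝ) : ℂ)‖) (N := 0) fun ζ => ?_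
    rw [pow_zero]
    linarith [norm_nonneg ((Real.pi ^ ((n : ℝ) / 2) / Real.Gamma s : ℝ) : ℂ)]
  refine ⟨_, hC, fun x ε hε => ?_⟩
  have hki : Integrable fun z : EuclideanSpace ℝ (Fin n) =>
      (((ε + ‖x - z‖ ^ 2) ^ (-s) : ℝ) : ℂ) :=
    Integrable.ofReal (𝕜 := ℂ)
      ((integrable_add_norm_sq_rpow (s := s) (by linarith) hε).comp_sub_left x)
  set Ψ : EuclideanSpace ℝ (Fin n) → EuclideanSpace ℝ (Fin n) → ℂ := fun z ζ =>
    Complex.exp ((2 * Real.pi * inner ℝ ζ z : ℝ) * Complex.I) * ĝ ζ *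
      (((ε + ‖x - z‖ ^ 2) ^ (-s) : ℝ) : ℂ) with hΨ
  have hΨi : Integrable (Function.uncurry Ψ) (volume.prod volume) := by
    have h1 := (hki.mul_prod ĝ.integrable (μ := volume) (ν := volume)).bdd_mul
      (f := fun p : EuclideanSpace ℝ (Fin n) × EuclideanSpace ℝ (Fin n) =>
        Complex.exp ((2 * Real.pi * inner ℝ p.2 p.1 : ℝ) * Complex.I)) (c := 1)
      (by fun_prop : Continuous _).aestronglyMeasurable
      (Eventually.of_forall fun p => by rw [Complex.norm_exp_ofReal_mul_I])
    refine h1.congr (Eventually.of_forall fun p => ?_)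
    simp only [Function.uncurry_def, hΨ]
    ring
  have hswap := integral_integral_swap hΨi
  have hleft (z : EuclideanSpace ℝ (Fin n)) : ∫ ζ, Ψ z ζ =
      ((φ z * (ε + ‖x - z‖ ^ 2) ^ (-s) : ℝ) : ℂ) := by
    simp only [hΨ]
    rw [integral_mul_const, ← hinv, Complex.ofReal_mul]
  have hright (ζ : EuclideanSpace ℝ (Fin n)) : ∫ z, Ψ z ζ =
      ĝ ζ * ((Real.pi ^ ((n : ℝ) / 2) / Real.Gamma s : ℝ) : ℂ) *
        (Complex.exp ((2 * Real.pi * inner ℝ ζ x : ℝ) * Complex.I) *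
            ((ε ^ (-γ) * besselIntegral γ (ε * (Real.pi * ‖ζ‖) ^ 2) : ℝ) : ℂ)) := by
    rw [← integral_add_left_eq_self _ x]
    have e (z : EuclideanSpace ℝ (Fin n)) : Ψ (x + z) ζ =
        ĝ ζ * Complex.exp ((2 * Real.pi * inner ℝ ζ x : ℝ) * Complex.I) *
          (Complex.exp ((2 * Real.pi * inner ℝ ζ z : ℝ) * Complex.I) *
            (((ε + ‖z‖ ^ 2) ^ (-s) : ℝ) : ℂ)) := by
      have h1 : Complex.exp ((2 * Real.pi * inner ℝ ζ (x + z) : ℝ) * Complex.I) =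
          Complex.exp ((2 * Real.pi * inner ℝ ζ x : ℝ) * Complex.I) *
            Complex.exp ((2 * Real.pi * inner ℝ ζ z : ℝ) * Complex.I) := by
        rw [← Complex.exp_add, inner_add_right]
        push_cast
        ring_nf
      simp only [hΨ, h1]
      rw [sub_add_cancel_left, norm_neg]
      ring
    simp_rw [e]
    rw [integral_const_mul, integral_exp_inner_mul_add_norm_sq_rpow hγ hs hε]
    push_cast
    ring
  simp_rw [hleft, hright] at hswap
  rw [← hswap, integral_complex_ofReal]

/-- Structure of the Poisson-type integral of a test function on the half-space. -/
theorem exists_contDiff_integral_add_norm_sq_rpow {φ : EuclideanSpace ℝ (Fin n) → ℝ}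
    (hφ : ContDiff ℝ ∞ φ) (hc : HasCompactSupport φ) (hγ : 0 < γ) (hs : s = (n : ℝ) / 2 + γ) :
    ∃ A B : EuclideanSpace ℝ (Fin n) × ℝ → ℝ, ContDiff ℝ ∞ A ∧ ContDiff ℝ ∞ B ∧
      ∀ x : EuclideanSpace ℝ (Fin n), ∀ ε, 0 < ε →
        ∫ z, φ z * (ε + ‖x - z‖ ^ 2) ^ (-s) =
          ε ^ (-γ) * A (x, ε) + resonantLog γ ε * B (x, ε) := by
  obtain ⟨m, hm, hφm⟩ := exists_rapidDecay_integral_eq hφ hc hγ hs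
  obtain ⟨a, b, ha, hb, hab⟩ := exists_boundedDerivs_splitting hγ
  have hre {m : EuclideanSpace ℝ (Fin n) → ℂ} (hm : RapidDecay m) {h : ℝ → ℝ}
      (hh : BoundedDerivs h) : ContDiff ℝ ∞ fun p => (oscillatoryIntegral m h p).re :=
    Complex.reCLM.contDiff.comp (contDiff_oscillatoryIntegral hm hh)
  obtain ⟨N, hN⟩ := exists_nat_ge (γ + 1)
  have hmγ : RapidDecay fun ζ => m ζ * ((((Real.pi * ‖ζ‖) ^ 2) ^ γ : ℝ) : ℂ) :=
    hm.mul_comp_norm_sq (g := fun q => q ^ γ) (by fun_prop) zero_le_one (N := N) fun q hq => by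
      rw [abs_of_nonneg (Real.rpow_nonneg hq γ), one_mul]
      exact rpow_le_one_add_pow hγ.le (by linarith) hq
  -- In log(εq) = log ε + log q the second term depends on the frequency only and is absorbed into
  -- the multiplier g. Without resonance g = 0.
  set g : ℝ → ℝ := fun q => q ^ γ * (resonantLog γ q - resonantLog γ 1) with hg
  have hgm : Measurable g ∧ ∀ q, 0 ≤ q → |g q| ≤ (1 / γ + 1) * (1 + q ^ N) := by
    simp only [hg, resonantLog]
    split_ifs
    · simp only [Real.log_one, sub_zero]
      exact ⟨(by fun_prop : Measurable fun q : ℝ => q ^ γ).mul Real.measurable_log,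
        fun q hq => abs_rpow_mul_log_le hγ hN hq⟩
    · simp only [sub_self, mul_zero, abs_zero]
      exact ⟨measurable_const, fun q hq => by positivity⟩
  have hml : RapidDecay fun ζ => m ζ * (g ((Real.pi * ‖ζ‖) ^ 2) : ℂ) :=
    hm.mul_comp_norm_sq hgm.1 (by positivity) hgm.2
  -- The g-term carries no power of ε, because ε^{-γ} ε^γ = 1. To sit beside ε^{-γ} in A it needs
  -- the factor ε^γ; this is the polynomial ε^{⌊γ⌋} in the resonant case, and otherwise g = 0.
  refine ⟨fun p => (oscillatoryIntegral m a p).re +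
      p.2 ^ ⌊γ⌋₊ * (oscillatoryIntegral (fun ζ => m ζ * (g ((Real.pi * ‖ζ‖) ^ 2) : ℂ)) b p).re,
    fun p => (oscillatoryIntegral
      (fun ζ => m ζ * ((((Real.pi * ‖ζ‖) ^ 2) ^ γ : ℝ) : ℂ)) b p).re,
    (hre hm ha).add ((contDiff_snd.pow _).mul (hre hml hb)), hre hmγ hb, fun x ε hε => ?_⟩
  have i1 := (integrable_oscillatory hm ha (x, ε)).const_mul ((ε ^ (-γ) : ℝ) : ℂ)
  have i2 := integrable_oscillatory hml hb (x, ε)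
  have i3 := (integrable_oscillatory hmγ hb (x, ε)).const_mul ((resonantLog γ ε : ℝ) : ℂ)
  have h : ((∫ z, φ z * (ε + ‖x - z‖ ^ 2) ^ (-s) : ℝ) : ℂ) =
      ((ε ^ (-γ) : ℝ) : ℂ) * oscillatoryIntegral m a (x, ε) +
        (oscillatoryIntegral (fun ζ => m ζ * (g ((Real.pi * ‖ζ‖) ^ 2) : ℂ)) b (x, ε) +
        ((resonantLog γ ε : ℝ) : ℂ) * oscillatoryIntegral
          (fun ζ => m ζ * ((((Real.pi * ‖ζ‖) ^ 2) ^ γ : ℝ) : ℂ)) b (x, ε)) := by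
    have e1 := integral_add i2 i3
    have e2 := integral_add i1 (i2.add i3)
    simp only [Pi.add_apply] at e1 e2
    simp only [oscillatoryIntegral]
    rw [← integral_const_mul, ← integral_const_mul, ← e1, ← e2, hφm x ε hε]
    refine integral_congr_ae (Eventually.of_forall fun ζ => ?_)
    simp only
    set q := (Real.pi * ‖ζ‖) ^ 2
    have hq0 : 0 ≤ q := by positivity
    have hk : ε ^ (-γ) * besselIntegral γ (ε * q) = ε ^ (-γ) * a (ε * q) +
        (g q * b (ε * q) + resonantLog γ ε * (q ^ γ * b (ε * q))) := by
      rw [hab _ (by positivity)]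
      rcases hq0.eq_or_lt with hq | hq
      · rw [← hq]
        simp [hg, Real.zero_rpow hγ.ne']
      · have : ε ^ (-γ) * ε ^ γ = 1 := by rw [← Real.rpow_add hε]; simp
        rw [Real.mul_rpow hε.le hq0, resonantLog_mul hε hq, hg]
        linear_combination (q ^ γ * (resonantLog γ ε + (resonantLog γ q - resonantLog γ 1)) *
          b (ε * q)) * this
    rw [hk]
    push_cast
    ring
  have h' := congrArg Complex.re h
  simp only [Complex.ofReal_re, Complex.add_re, Complex.re_ofReal_mul] at h'
  rw [h', mul_add, ← add_assoc]
  congr 2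
  by_cases hres : ∃ k : ℕ, γ = k
  · obtain ⟨k, rfl⟩ := hres
    rw [Nat.floor_natCast, ← mul_assoc, Real.rpow_neg hε.le, Real.rpow_natCast,
      inv_mul_cancel₀ (by positivity), one_mul]
  · have h0 : g = fun _ => 0 := by
      funext q
      simp [hg, resonantLog_of_forall_ne fun k hk => hres ⟨k, hk⟩]
    simp [h0, oscillatoryIntegral]

end HalfSpacePoisson

end

noncomputable section
open Filter Topology MeasureTheory

/-! ### The surface measure in gnomonic coordinates. -/

section GnomonicCoordinates

variable {n : ℕ}

/-- Polar coordinates with the radial weight cut off at 1: the factor n + 1 compensates ∫_0^1 r^n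
dr. -/
theorem integral_surfaceMeasure_eq (ψ : EuclideanSpace ℝ (Fin (n + 1)) → ℝ) :
    ∫ ξ, ψ ξ ∂(surfaceMeasure n) =
      (n + 1) * ∫ x in Metric.ball 0 1, ψ (‖x‖⁻¹ • x) := by
  have h := (volume : Measure (EuclideanSpace ℝ (Fin (n + 1))))
    |>.measurePreserving_homeomorphUnitSphereProd.integral_comp (Homeomorph.measurableEmbedding _)
      (fun p => ψ p.1 * (Set.Iio (⟨1, Set.mem_Ioi.2 one_pos⟩ : Set.Ioi (0 : ℝ))).indicator (fun _ => (1 : ℝ)) p.2)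
  rw [integral_prod_mul (fun ξ : Metric.sphere (0 : EuclideanSpace ℝ (Fin (n + 1))) 1 => ψ ξ),
    integral_indicator measurableSet_Iio, setIntegral_const, measureReal_def,
    Measure.volumeIoiPow_apply_Iio] at h
  have h1 : (fun x : ({0}ᶜ : Set (EuclideanSpace ℝ (Fin (n + 1)))) =>
      ψ ((homeomorphUnitSphereProd _ x).1) *
        (Set.Iio (⟨1, Set.mem_Ioi.2 one_pos⟩ : Set.Ioi (0 : ℝ))).indicator (fun _ => (1 : ℝ))
          (homeomorphUnitSphereProd _ x).2) =
      fun x : ({0}ᶜ : Set (EuclideanSpace ℝ (Fin (n + 1)))) =>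
        (Metric.ball (0 : EuclideanSpace ℝ (Fin (n + 1))) 1).indicator
        (fun x => ψ (‖x‖⁻¹ • x)) (x : EuclideanSpace ℝ (Fin (n + 1))) := by
    funext x
    have hiff : (homeomorphUnitSphereProd _ x).2 ∈
        Set.Iio (⟨1, Set.mem_Ioi.2 one_pos⟩ : Set.Ioi (0 : ℝ)) ↔
        ‖(x : EuclideanSpace ℝ (Fin (n + 1)))‖ < 1 := by
      rw [Set.mem_Iio, ← Subtype.coe_lt_coe, homeomorphUnitSphereProd_apply_snd_coe]
    by_cases hx : ‖(x : EuclideanSpace ℝ (Fin (n + 1)))‖ < 1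
    · rw [Set.indicator_of_mem (hiff.2 hx),
        Set.indicator_of_mem (mem_ball_zero_iff.2 hx), mul_one,
        homeomorphUnitSphereProd_apply_fst_coe]
    · rw [Set.indicator_of_notMem (mt hiff.1 hx),
        Set.indicator_of_notMem (fun h => hx (mem_ball_zero_iff.1 h)), mul_zero]
  rw [h1, integral_subtype_comap (measurableSet_singleton _).compl, restrict_compl_singleton,
    integral_indicator Metric.isOpen_ball.measurableSet] at h
  rw [h]
  simp only [finrank_euclideanSpace, Fintype.card_fin, add_tsub_cancel_right, one_pow, smul_eq_mul,
    mul_one]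
  rw [ENNReal.toReal_ofReal (by positivity), surfaceMeasure]
  field_simp

/-- The point `(t, z)` of `ℝ^{n+1} = ℝ × ℝ^n`. -/
def consPoint (t : ℝ) (z : EuclideanSpace ℝ (Fin n)) : EuclideanSpace ℝ (Fin (n + 1)) :=
  WithLp.toLp 2 (Fin.cons t z)

theorem consPoint_zero (t : ℝ) (z : EuclideanSpace ℝ (Fin n)) : consPoint t z 0 = t := rfl

theorem consPoint_succ (t : ℝ) (z : EuclideanSpace ℝ (Fin n)) (i : Fin n) :
    consPoint t z i.succ = z i := rfl

theorem norm_sq_consPoint (t : ℝ) (z : EuclideanSpace ℝ (Fin n)) :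
    ‖consPoint t z‖ ^ 2 = t ^ 2 + ‖z‖ ^ 2 := by
  simp [EuclideanSpace.real_norm_sq_eq, Fin.sum_univ_succ, consPoint_zero, consPoint_succ]

theorem smul_consPoint (c t : ℝ) (z : EuclideanSpace ℝ (Fin n)) :
    c • consPoint t z = consPoint (c * t) (c • z) := by
  ext i
  refine Fin.cases ?_ (fun i => ?_) i <;> simp [consPoint_zero, consPoint_succ]

theorem contDiff_consPoint :
    ContDiff ℝ ∞ fun p : ℝ × EuclideanSpace ℝ (Fin n) => consPoint p.1 p.2 := by
  refine contDiff_euclidean.2 fun i => ?_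
  refine Fin.cases ?_ (fun i => ?_) i
  · simp only [consPoint_zero]
    fun_prop
  · simp only [consPoint_succ]
    fun_prop

theorem measurePreserving_consPoint :
    MeasurePreserving (fun p : ℝ × EuclideanSpace ℝ (Fin n) => consPoint p.1 p.2) := by
  have h1 := (volume_preserving_piFinSuccAbove (fun _ : Fin (n + 1) => ℝ) 0).symm
  have h2 := (MeasurePreserving.id (volume : Measure ℝ)).prod (PiLp.volume_preserving_ofLp (Fin n))
  have h3 := (PiLp.volume_preserving_toLp (Fin (n + 1))).comp (h1.comp h2)
  have h4 : (fun p : ℝ × EuclideanSpace ℝ (Fin n) => consPoint p.1 p.2) =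
      WithLp.toLp 2 ∘ (MeasurableEquiv.piFinSuccAbove (fun _ => ℝ) 0).symm ∘
        Prod.map id WithLp.ofLp := by
    funext p
    simp [consPoint, MeasurableEquiv.piFinSuccAbove, Fin.insertNthEquiv]
  rw [h4]
  exact h3

theorem measurableEmbedding_consPoint :
    MeasurableEmbedding fun p : ℝ × EuclideanSpace ℝ (Fin n) => consPoint p.1 p.2 :=
  contDiff_consPoint.continuous.measurableEmbedding fun p q h => by
    have h' (i : Fin (n + 1)) := congrArg (fun x : EuclideanSpace ℝ (Fin (n + 1)) => x i) h
    refine Prod.ext (h' 0) ?_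
    ext i
    exact h' i.succ

theorem integral_eq_integral_consPoint (g : EuclideanSpace ℝ (Fin (n + 1)) → ℝ) :
    ∫ p : ℝ × EuclideanSpace ℝ (Fin n), g (consPoint p.1 p.2) = ∫ x, g x :=
  measurePreserving_consPoint.integral_comp measurableEmbedding_consPoint g

/-- The inverse of the gnomonic projection. -/
def gnomonicInv (w : EuclideanSpace ℝ (Fin n)) : EuclideanSpace ℝ (Fin (n + 1)) :=
  (Real.sqrt (1 + ‖w‖ ^ 2))⁻¹ • consPoint 1 w

theorem norm_consPoint_one (w : EuclideanSpace ℝ (Fin n)) :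
    ‖consPoint 1 w‖ = Real.sqrt (1 + ‖w‖ ^ 2) := by
  rw [← Real.sqrt_sq (norm_nonneg _), norm_sq_consPoint, one_pow]

theorem norm_gnomonicInv (w : EuclideanSpace ℝ (Fin n)) : ‖gnomonicInv w‖ = 1 := by
  have : 0 < Real.sqrt (1 + ‖w‖ ^ 2) := Real.sqrt_pos.2 (by positivity)
  rw [gnomonicInv, norm_smul, norm_consPoint_one, norm_inv, Real.norm_of_nonneg this.le,
    inv_mul_cancel₀ this.ne']

theorem continuous_gnomonicInv : Continuous (gnomonicInv (n := n)) := by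
  have h1 : Continuous fun w : EuclideanSpace ℝ (Fin n) => consPoint 1 w :=
    contDiff_consPoint.continuous.comp (by fun_prop : Continuous fun w => ((1 : ℝ), w))
  have h2 : Continuous fun w : EuclideanSpace ℝ (Fin n) => Real.sqrt (1 + ‖w‖ ^ 2) := by fun_prop
  refine Continuous.smul (h2.inv₀ fun w => ?_) h1
  exact (Real.sqrt_pos.2 (by positivity)).ne'

theorem integrableOn_normalize {ψ : EuclideanSpace ℝ (Fin (n + 1)) → ℝ}
    (hψ : ContinuousOn ψ (Metric.sphere 0 1)) :
    IntegrableOn (fun x => ψ (‖x‖⁻¹ • x)) (Metric.ball 0 1) := by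
  obtain ⟨M, hM⟩ := (isCompact_sphere (0 : EuclideanSpace ℝ (Fin (n + 1))) 1
    ).exists_bound_of_continuousOn hψ
  have hmap : ∀ x ∈ ({0}ᶜ : Set (EuclideanSpace ℝ (Fin (n + 1)))),
      ‖x‖⁻¹ • x ∈ Metric.sphere (0 : EuclideanSpace ℝ (Fin (n + 1))) 1 := fun x hx => by
    rw [mem_sphere_zero_iff_norm, norm_smul, norm_inv, norm_norm,
      inv_mul_cancel₀ (norm_ne_zero_iff.2 hx)]
  have hc : ContinuousOn (fun x => ψ (‖x‖⁻¹ • x))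
      (({0}ᶜ : Set (EuclideanSpace ℝ (Fin (n + 1))))) := by
    refine hψ.comp (ContinuousOn.smul (continuous_norm.continuousOn.inv₀ fun x hx => ?_)
      continuousOn_id) hmap
    exact norm_ne_zero_iff.2 hx
  have hr : (volume : Measure (EuclideanSpace ℝ (Fin (n + 1)))).restrict (Metric.ball 0 1) =
      volume.restrict (Metric.ball 0 1 ∩ {0}ᶜ) := by
    rw [← Measure.restrict_restrict Metric.isOpen_ball.measurableSet, restrict_compl_singleton]
  rw [IntegrableOn, hr]
  have : IsFiniteMeasure ((volume : Measure (EuclideanSpace ℝ (Fin (n + 1)))).restrict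
      (Metric.ball 0 1 ∩ {0}ᶜ)) :=
    isFiniteMeasure_restrict.2
      ((measure_mono Set.inter_subset_left).trans_lt measure_ball_lt_top).ne
  refine Integrable.of_bound ((hc.mono Set.inter_subset_right).aestronglyMeasurable
    (Metric.isOpen_ball.measurableSet.inter (measurableSet_singleton _).compl)) M ?_
  filter_upwards [ae_restrict_mem (Metric.isOpen_ball.measurableSet.inter
    (measurableSet_singleton _).compl)] with x hx
  exact hM _ (hmap x hx.2)

theorem integral_pow_mul_indicator_lt {N : ℝ} (hN : 0 < N) :
    ∫ t in Set.Ioi (0 : ℝ), t ^ n * (Set.Iio N⁻¹).indicator (fun _ => (1 : ℝ)) t =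
      (N ^ (n + 1))⁻¹ / (n + 1) := by
  have h : ∀ t : ℝ, t ^ n * (Set.Iio N⁻¹).indicator (fun _ => (1 : ℝ)) t =
      (Set.Iio N⁻¹).indicator (fun t => t ^ n) t := fun t => by
    by_cases ht : t ∈ Set.Iio N⁻¹ <;> simp [ht]
  simp_rw [h]
  rw [setIntegral_indicator measurableSet_Iio, Set.Ioi_inter_Iio, ← integral_Ioc_eq_integral_Ioo,
    ← intervalIntegral.integral_of_le (by positivity), integral_pow, zero_pow (by omega), sub_zero,
    inv_pow]

theorem integrableOn_pow_mul_indicator_lt (N : ℝ) :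
    IntegrableOn (fun t : ℝ => t ^ n * (Set.Iio N).indicator (fun _ => (1 : ℝ)) t)
      (Set.Ioi (0 : ℝ)) := by
  have h : ∀ t : ℝ, t ^ n * (Set.Iio N).indicator (fun _ => (1 : ℝ)) t =
      (Set.Iio N).indicator (fun t => t ^ n) t := fun t => by
    by_cases ht : t ∈ Set.Iio N <;> simp [ht]
  simp_rw [h]
  rw [IntegrableOn, integrable_indicator_iff measurableSet_Iio, IntegrableOn,
    Measure.restrict_restrict measurableSet_Iio, Set.inter_comm, Set.Ioi_inter_Iio]
  exact ((continuous_pow n).integrableOn_Icc (a := 0) (b := N)).mono_set Set.Ioo_subset_Icc_self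

/-- The surface measure in gnomonic coordinates. -/
theorem integral_surfaceMeasure_gnomonic {ψ : EuclideanSpace ℝ (Fin (n + 1)) → ℝ}
    (hψ : ContinuousOn ψ (Metric.sphere 0 1)) (h0 : ∀ x, x 0 ≤ 0 → ψ x = 0) :
    ∫ ξ, ψ ξ ∂(surfaceMeasure n) =
      ∫ w, ψ (gnomonicInv w) * (Real.sqrt (1 + ‖w‖ ^ 2) ^ (n + 1))⁻¹ := by
  obtain ⟨M, hM⟩ := (isCompact_sphere (0 : EuclideanSpace ℝ (Fin (n + 1))) 1
    ).exists_bound_of_continuousOn hψ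
  have hN (w : EuclideanSpace ℝ (Fin n)) : 0 < Real.sqrt (1 + ‖w‖ ^ 2) :=
    Real.sqrt_pos.2 (by positivity)
  set F : EuclideanSpace ℝ (Fin (n + 1)) → ℝ :=
    (Metric.ball 0 1).indicator fun x => ψ (‖x‖⁻¹ • x) with hF
  have hFi : Integrable F :=
    (integrable_indicator_iff Metric.isOpen_ball.measurableSet).2 (integrableOn_normalize hψ)
  have hFci : Integrable fun p : ℝ × EuclideanSpace ℝ (Fin n) => F (consPoint p.1 p.2) :=
    (measurePreserving_consPoint.integrable_comp_emb measurableEmbedding_consPoint).2 hFi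
  have hneg : ∀ t ∉ Set.Ioi (0 : ℝ), ∫ z, F (consPoint t z) = 0 := by
    intro t ht
    have : ∀ z, F (consPoint t z) = 0 := fun z => by
      by_cases hx : consPoint t z ∈ Metric.ball 0 1
      · rw [hF, Set.indicator_of_mem hx]
        refine h0 _ ?_
        rw [PiLp.smul_apply, consPoint_zero, smul_eq_mul]
        exact mul_nonpos_of_nonneg_of_nonpos (by positivity) (not_lt.1 ht)
      · rw [hF, Set.indicator_of_notMem hx]
    simp [this]
  -- On the slice x_0 = t > 0 the substitution z = t w gives the point t(1, w), with direction
  -- `gnomonicInv w`, Jacobian t^n, and norm below 1 exactly when t < (1+|w|²)^{-1/2}. Integrating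
  -- first in t produces the density.
  set Q : ℝ → EuclideanSpace ℝ (Fin n) → ℝ := fun t w => ψ (gnomonicInv w) *
    (t ^ n * (Set.Iio (Real.sqrt (1 + ‖w‖ ^ 2))⁻¹).indicator (fun _ => (1 : ℝ)) t) with hQ
  have hpos : ∀ t ∈ Set.Ioi (0 : ℝ), ∫ z, F (consPoint t z) = ∫ w, Q t w := by
    intro t ht
    have ht : 0 < t := ht
    have h1 := Measure.integral_comp_smul (volume : Measure (EuclideanSpace ℝ (Fin n)))
      (fun z => F (consPoint t z)) t
    rw [finrank_euclideanSpace, Fintype.card_fin, abs_of_pos (by positivity), smul_eq_mul,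
      eq_inv_mul_iff_mul_eq₀ (by positivity)] at h1
    rw [← h1, ← integral_const_mul]
    refine integral_congr_ae (Eventually.of_forall fun w => ?_)
    have h2 : consPoint t (t • w) = t • consPoint 1 w := by rw [smul_consPoint, mul_one]
    have h3 : ‖consPoint t (t • w)‖ = t * Real.sqrt (1 + ‖w‖ ^ 2) := by
      rw [h2, norm_smul, norm_consPoint_one, Real.norm_of_nonneg ht.le]
    have h4 : ‖consPoint t (t • w)‖ < 1 ↔ t < (Real.sqrt (1 + ‖w‖ ^ 2))⁻¹ := by
      rw [h3, lt_inv_comm₀ ht (hN w), inv_eq_one_div, lt_div_iff₀ ht, mul_comm]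
    simp only [hF, hQ]
    by_cases hlt : t < (Real.sqrt (1 + ‖w‖ ^ 2))⁻¹
    · rw [Set.indicator_of_mem (mem_ball_zero_iff.2 (h4.2 hlt)),
        Set.indicator_of_mem (Set.mem_Iio.2 hlt), h3, h2, smul_smul, mul_inv, mul_assoc,
        mul_comm _ t, ← mul_assoc, inv_mul_cancel₀ ht.ne', one_mul, gnomonicInv]
      ring
    · rw [Set.indicator_of_notMem fun h => hlt (h4.1 (mem_ball_zero_iff.1 h)),
        Set.indicator_of_notMem fun h => hlt (Set.mem_Iio.1 h)]
      ring
  have hψc : Continuous fun w : EuclideanSpace ℝ (Fin n) => ψ (gnomonicInv w) :=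
    hψ.comp_continuous continuous_gnomonicInv fun w =>
      mem_sphere_zero_iff_norm.2 (norm_gnomonicInv w)
  have hQint (w : EuclideanSpace ℝ (Fin n)) : ∫ t in Set.Ioi (0 : ℝ), Q t w =
      ψ (gnomonicInv w) * ((Real.sqrt (1 + ‖w‖ ^ 2) ^ (n + 1))⁻¹ / (n + 1)) := by
    rw [hQ, integral_const_mul, integral_pow_mul_indicator_lt (hN w)]
  have hQi : Integrable (Function.uncurry Q) ((volume.restrict (Set.Ioi (0 : ℝ))).prod volume) := by
    refine (integrable_prod_iff' ?_).2 ⟨Eventually.of_forall fun w => ?_, ?_⟩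
    · have hset : MeasurableSet {p : ℝ × EuclideanSpace ℝ (Fin n) |
          p.1 < (Real.sqrt (1 + ‖p.2‖ ^ 2))⁻¹} :=
        measurableSet_lt measurable_fst (by fun_prop)
      have : Measurable (Function.uncurry Q) := by
        have h1 : Measurable ({p : ℝ × EuclideanSpace ℝ (Fin n) |
          p.1 < (Real.sqrt (1 + ‖p.2‖ ^ 2))⁻¹}.indicator fun _ => (1 : ℝ)) :=
          measurable_const.indicator hset
        exact (hψc.measurable.comp measurable_snd).mul ((measurable_fst.pow_const n).mul h1)
      exact this.aestronglyMeasurable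
    · simp only [Function.uncurry_apply_pair, hQ]
      exact Integrable.const_mul (integrableOn_pow_mul_indicator_lt _) (ψ (gnomonicInv w))
    -- The density (1+|w|²)^{-(n+1)/2} is integrable on ℝ^n because n + 1 > n.
    · have hi := (integrable_rpow_neg_one_add_norm_sq (E := EuclideanSpace ℝ (Fin n))
        (μ := volume) (r := n + 1) (by simp)).const_mul (M / (n + 1))
      have hn (w : EuclideanSpace ℝ (Fin n)) :
          ∫ t in Set.Ioi (0 : ℝ), ‖Function.uncurry Q (t, w)‖ =
            |ψ (gnomonicInv w)| * ((Real.sqrt (1 + ‖w‖ ^ 2) ^ (n + 1))⁻¹ / (n + 1)) := by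
        rw [← integral_pow_mul_indicator_lt (hN w), ← integral_const_mul]
        refine setIntegral_congr_fun measurableSet_Ioi fun t ht => ?_
        have ht : 0 < t := ht
        simp only [Function.uncurry_apply_pair, hQ]
        rw [norm_mul, Real.norm_eq_abs, Real.norm_of_nonneg]
        exact mul_nonneg (by positivity) (Set.indicator_nonneg (fun _ _ => zero_le_one) _)
      simp_rw [hn]
      have hc : Continuous fun w : EuclideanSpace ℝ (Fin n) => |ψ (gnomonicInv w)| *
          ((Real.sqrt (1 + ‖w‖ ^ 2) ^ (n + 1))⁻¹ / (n + 1)) := by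
        have h2 : Continuous fun w : EuclideanSpace ℝ (Fin n) => Real.sqrt (1 + ‖w‖ ^ 2) ^ (n + 1) :=
          by fun_prop
        exact hψc.abs.mul ((h2.inv₀ fun w => (pow_pos (hN w) _).ne').div_const _)
      refine hi.mono' hc.aestronglyMeasurable (Eventually.of_forall fun w => ?_)
      have h3 : (Real.sqrt (1 + ‖w‖ ^ 2) ^ (n + 1))⁻¹ = (1 + ‖w‖ ^ 2) ^ (-((n : ℝ) + 1) / 2) := by
        rw [Real.sqrt_eq_rpow, ← Real.rpow_natCast, ← Real.rpow_mul (by positivity),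
          ← Real.rpow_neg (by positivity)]
        push_cast
        ring_nf
      rw [← h3, Real.norm_of_nonneg (mul_nonneg (abs_nonneg _) (by positivity)),
        div_mul_eq_mul_div, mul_div_assoc]
      exact mul_le_mul_of_nonneg_right
        (hM _ (mem_sphere_zero_iff_norm.2 (norm_gnomonicInv w))) (by positivity)
  have hswap := integral_integral_swap hQi
  rw [integral_surfaceMeasure_eq, ← integral_indicator Metric.isOpen_ball.measurableSet, ← hF,
    ← integral_eq_integral_consPoint, Measure.volume_eq_prod, integral_prod _ hFci,
    ← setIntegral_eq_integral_of_forall_compl_eq_zero hneg,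
    setIntegral_congr_fun measurableSet_Ioi hpos, hswap, ← integral_const_mul]
  refine integral_congr_ae (Eventually.of_forall fun w => ?_)
  simp only [hQint]
  field_simp

end GnomonicCoordinates

end

noncomputable section
open Filter Topology MeasureTheory

/-! ### The surface measure in stereographic coordinates. -/

section StereographicCoordinates

variable {n : ℕ}

/-- The inverse of the stereographic projection from `-e₀`. -/
def stereoInv (z : EuclideanSpace ℝ (Fin n)) : EuclideanSpace ℝ (Fin (n + 1)) :=
  (1 + ‖z‖ ^ 2)⁻¹ • consPoint (1 - ‖z‖ ^ 2) ((2 : ℝ) • z)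

theorem norm_stereoInv (z : EuclideanSpace ℝ (Fin n)) : ‖stereoInv z‖ = 1 := by
  have h1 : 0 < 1 + ‖z‖ ^ 2 := by positivity
  rw [← Real.sqrt_sq (norm_nonneg _), stereoInv, norm_smul, mul_pow, norm_sq_consPoint, norm_smul,
    Real.norm_of_nonneg (by positivity : 0 ≤ (1 + ‖z‖ ^ 2)⁻¹), Real.norm_ofNat]
  rw [show ((1 + ‖z‖ ^ 2)⁻¹) ^ 2 * ((1 - ‖z‖ ^ 2) ^ 2 + (2 * ‖z‖) ^ 2) = 1 by
    field_simp; ring, Real.sqrt_one]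

theorem stereoInv_zero_coord (z : EuclideanSpace ℝ (Fin n)) :
    stereoInv z 0 = (1 - ‖z‖ ^ 2) / (1 + ‖z‖ ^ 2) := by
  rw [stereoInv, PiLp.smul_apply, consPoint_zero, smul_eq_mul, inv_mul_eq_div]

theorem contDiff_stereoInv : ContDiff ℝ ∞ (stereoInv (n := n)) := by
  have h1 : ContDiff ℝ ∞ fun z : EuclideanSpace ℝ (Fin n) => 1 + ‖z‖ ^ 2 :=
    contDiff_const.add (contDiff_norm_sq ℝ)
  have h2 : ContDiff ℝ ∞ fun z : EuclideanSpace ℝ (Fin n) => (1 - ‖z‖ ^ 2, (2 : ℝ) • z) :=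
    (contDiff_const.sub (contDiff_norm_sq ℝ)).prodMk (contDiff_id.const_smul 2)
  exact (h1.inv fun z => by positivity).smul (contDiff_consPoint.comp h2)

/-- The passage from stereographic to gnomonic coordinates. -/
def stereoToGnomonic (z : EuclideanSpace ℝ (Fin n)) : EuclideanSpace ℝ (Fin n) :=
  (2 * (1 - ‖z‖ ^ 2)⁻¹) • z

theorem sqrt_one_add_norm_sq_stereoToGnomonic {z : EuclideanSpace ℝ (Fin n)} (hz : ‖z‖ < 1) :
    Real.sqrt (1 + ‖stereoToGnomonic z‖ ^ 2) = (1 + ‖z‖ ^ 2) / (1 - ‖z‖ ^ 2) := by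
  have h1 : 0 < 1 - ‖z‖ ^ 2 := by nlinarith [norm_nonneg z]
  rw [stereoToGnomonic, norm_smul, mul_pow, Real.norm_of_nonneg (by positivity),
    show 1 + (2 * (1 - ‖z‖ ^ 2)⁻¹) ^ 2 * ‖z‖ ^ 2 = ((1 + ‖z‖ ^ 2) / (1 - ‖z‖ ^ 2)) ^ 2 by
      field_simp; ring, Real.sqrt_sq (by positivity)]

theorem gnomonicInv_stereoToGnomonic {z : EuclideanSpace ℝ (Fin n)} (hz : ‖z‖ < 1) :
    gnomonicInv (stereoToGnomonic z) = stereoInv z := by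
  have h1 : 0 < 1 - ‖z‖ ^ 2 := by nlinarith [norm_nonneg z]
  rw [gnomonicInv, sqrt_one_add_norm_sq_stereoToGnomonic hz, stereoInv, stereoToGnomonic,
    smul_consPoint, smul_consPoint, smul_smul, smul_smul]
  congr 1
  · field_simp
  · congr 1
    field_simp

/-- At polar angle θ from e₀ the stereographic radius is tan(θ/2) and the gnomonic radius tan θ. The
half-angle formula gives the inverse w ↦ w/(1 + √(1+|w|²)). -/
theorem stereoToGnomonic_image :
    stereoToGnomonic '' Metric.ball (0 : EuclideanSpace ℝ (Fin n)) 1 = Set.univ := by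
  refine Set.eq_univ_of_forall fun w => ?_
  set r := Real.sqrt (1 + ‖w‖ ^ 2) with hr
  have hr2 : r ^ 2 = 1 + ‖w‖ ^ 2 := Real.sq_sqrt (by positivity)
  have hr0 : 0 < r := Real.sqrt_pos.2 (by positivity)
  have hT : ‖(1 + r)⁻¹ • w‖ ^ 2 = (r - 1) / (1 + r) := by
    rw [norm_smul, mul_pow, Real.norm_of_nonneg (by positivity),
      show ‖w‖ ^ 2 = (r - 1) * (1 + r) by linarith]
    field_simp
  refine ⟨(1 + r)⁻¹ • w, ?_, ?_⟩
  · rw [mem_ball_zero_iff]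
    have : ‖(1 + r)⁻¹ • w‖ ^ 2 < 1 := by
      rw [hT, div_lt_one (by positivity)]
      linarith
    exact (sq_lt_one_iff₀ (norm_nonneg _)).1 this
  · rw [stereoToGnomonic, hT, smul_smul]
    have : 2 * (1 - (r - 1) / (1 + r))⁻¹ * (1 + r)⁻¹ = 1 := by
      have h2 : 1 - (r - 1) / (1 + r) = 2 / (1 + r) := by field_simp; ring
      rw [h2]
      field_simp
    rw [this, one_smul]

theorem injOn_stereoToGnomonic :
    Set.InjOn stereoToGnomonic (Metric.ball (0 : EuclideanSpace ℝ (Fin n)) 1) := by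
  intro z hz w hw h
  have hz := mem_ball_zero_iff.1 hz
  have hw := mem_ball_zero_iff.1 hw
  have key {z : EuclideanSpace ℝ (Fin n)} (hz : ‖z‖ < 1) :
      (1 + Real.sqrt (1 + ‖stereoToGnomonic z‖ ^ 2))⁻¹ • stereoToGnomonic z = z := by
    have h1 : 0 < 1 - ‖z‖ ^ 2 := by nlinarith [norm_nonneg z]
    rw [sqrt_one_add_norm_sq_stereoToGnomonic hz, stereoToGnomonic, smul_smul]
    have h2 : 1 + (1 + ‖z‖ ^ 2) / (1 - ‖z‖ ^ 2) = 2 / (1 - ‖z‖ ^ 2) := by field_simp; ring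
    rw [h2, show (2 / (1 - ‖z‖ ^ 2))⁻¹ * (2 * (1 - ‖z‖ ^ 2)⁻¹) = 1 by field_simp, one_smul]
  rw [← key hz, ← key hw, h]

/-- The derivative is 2/(1-|z|²) times the transvection v ↦ v + 2/(1-|z|²) ⟨z,v⟩ z, whose
determinant is 1 + 2|z|²/(1-|z|²). -/
theorem hasFDerivAt_stereoToGnomonic {z : EuclideanSpace ℝ (Fin n)} (hz : ‖z‖ < 1) :
    ∃ A : EuclideanSpace ℝ (Fin n) →L[ℝ] EuclideanSpace ℝ (Fin n),
      HasFDerivAt stereoToGnomonic A z ∧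
      A.det = (2 / (1 - ‖z‖ ^ 2)) ^ n * ((1 + ‖z‖ ^ 2) / (1 - ‖z‖ ^ 2)) := by
  have h1 : 0 < 1 - ‖z‖ ^ 2 := by nlinarith [norm_nonneg z]
  have h2 : HasFDerivAt (fun z : EuclideanSpace ℝ (Fin n) => 1 - ‖z‖ ^ 2)
      (-(2 • innerSL ℝ z)) z := (hasStrictFDerivAt_norm_sq z).hasFDerivAt.const_sub 1
  have h3 := ((hasDerivAt_inv h1.ne').comp_hasFDerivAt z h2).const_mul 2 |>.smul (hasFDerivAt_id z)
  refine ⟨_, h3, ?_⟩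
  have h4 : (((2 * (1 - ‖z‖ ^ 2)⁻¹) • ContinuousLinearMap.id ℝ (EuclideanSpace ℝ (Fin n)) +
      ((2 : ℝ) • (-((1 - ‖z‖ ^ 2) ^ 2)⁻¹) • -(2 • innerSL ℝ z)).smulRight z :
      EuclideanSpace ℝ (Fin n) →L[ℝ] EuclideanSpace ℝ (Fin n)) :
        EuclideanSpace ℝ (Fin n) →ₗ[ℝ] EuclideanSpace ℝ (Fin n)) =
      (2 / (1 - ‖z‖ ^ 2)) • LinearMap.transvection
        ((2 / (1 - ‖z‖ ^ 2)) • (innerSL ℝ z : EuclideanSpace ℝ (Fin n) →ₗ[ℝ] ℝ)) z := by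
    refine LinearMap.ext fun v => ?_
    simp [LinearMap.transvection, smul_smul]
    have e1 : 2 * (1 - ‖z‖ ^ 2)⁻¹ = 2 / (1 - ‖z‖ ^ 2) := by field_simp
    have e2 : ∀ b : ℝ, 2 * ((1 - ‖z‖ ^ 2) ^ 2)⁻¹ * (2 * b) =
      2 / (1 - ‖z‖ ^ 2) * (2 / (1 - ‖z‖ ^ 2) * b) := fun b => by field_simp
    rw [e1, e2]
  have h5 : ContinuousLinearMap.det (((2 * (1 - ‖z‖ ^ 2)⁻¹) •
      ContinuousLinearMap.id ℝ (EuclideanSpace ℝ (Fin n)) +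
      ((2 : ℝ) • (-((1 - ‖z‖ ^ 2) ^ 2)⁻¹) • -(2 • innerSL ℝ z)).smulRight z :
      EuclideanSpace ℝ (Fin n) →L[ℝ] EuclideanSpace ℝ (Fin n))) =
      (2 / (1 - ‖z‖ ^ 2)) ^ n * ((1 + ‖z‖ ^ 2) / (1 - ‖z‖ ^ 2)) := by
    rw [ContinuousLinearMap.det, h4, LinearMap.det_smul, LinearMap.transvection.det,
      finrank_euclideanSpace, Fintype.card_fin]
    simp only [LinearMap.smul_apply, ContinuousLinearMap.coe_coe, innerSL_apply_apply,
      real_inner_self_eq_norm_sq, smul_eq_mul]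
    congr 1
    field_simp
    ring
  exact h5

/-- The surface measure in stereographic coordinates. -/
theorem integral_surfaceMeasure_stereo {ψ : EuclideanSpace ℝ (Fin (n + 1)) → ℝ}
    (hψ : ContinuousOn ψ (Metric.sphere 0 1)) (h0 : ∀ x, x 0 ≤ 0 → ψ x = 0) :
    ∫ ξ, ψ ξ ∂(surfaceMeasure n) =
      ∫ z, ψ (stereoInv z) * (2 / (1 + ‖z‖ ^ 2)) ^ n := by
  choose! A hA hdet using fun (z : EuclideanSpace ℝ (Fin n)) (hz : ‖z‖ < 1) =>
    hasFDerivAt_stereoToGnomonic hz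
  have h := integral_image_eq_integral_abs_det_fderiv_smul
    (volume : Measure (EuclideanSpace ℝ (Fin n))) Metric.isOpen_ball.measurableSet
    (fun z hz => (hA z (mem_ball_zero_iff.1 hz)).hasFDerivWithinAt) injOn_stereoToGnomonic
    fun w => ψ (gnomonicInv w) * (Real.sqrt (1 + ‖w‖ ^ 2) ^ (n + 1))⁻¹
  rw [stereoToGnomonic_image, setIntegral_univ] at h
  rw [integral_surfaceMeasure_gnomonic hψ h0, h]
  rw [← setIntegral_eq_integral_of_forall_compl_eq_zero (s := Metric.ball 0 1)
    (f := fun z => ψ (stereoInv z) * (2 / (1 + ‖z‖ ^ 2)) ^ n)]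
  -- The Jacobian times the gnomonic density ((1-|z|²)/(1+|z|²))^{n+1} simplifies to (2/(1+|z|²))^n.
  · refine setIntegral_congr_fun Metric.isOpen_ball.measurableSet fun z hz => ?_
    have hz := mem_ball_zero_iff.1 hz
    have h1 : 0 < 1 - ‖z‖ ^ 2 := by nlinarith [norm_nonneg z]
    rw [hdet z hz, gnomonicInv_stereoToGnomonic hz, sqrt_one_add_norm_sq_stereoToGnomonic hz,
      abs_of_pos (by positivity), smul_eq_mul, div_pow, div_pow, div_pow, pow_succ, pow_succ]
    field_simp
    ring
  -- Outside the unit ball the point `stereoInv z` lies in the hemisphere x_0 ≤ 0, where ψ vanishes.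
  · intro z hz
    have hz : 1 ≤ ‖z‖ := by simpa using hz
    rw [h0, zero_mul]
    rw [stereoInv_zero_coord]
    exact div_nonpos_of_nonpos_of_nonneg (by nlinarith) (by positivity)

end StereographicCoordinates

end

noncomputable section
open Filter Topology MeasureTheory

/-! ### The required boundary form, locally. -/

section SmoothSplitting

variable {n : ℕ} {γ : ℝ}

/-- Near the point `e`, and inside the unit ball, `u` has the form
`F ρ^{n/2-γ} + H ρ^{n/2+γ} (log ρ)` with `F` and `H` smooth. -/
def HasSmoothSplitting (γ : ℝ) (u : EuclideanSpace ℝ (Fin (n + 1)) → ℝ)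
    (e : EuclideanSpace ℝ (Fin (n + 1))) : Prop :=
  ∃ U : Set (EuclideanSpace ℝ (Fin (n + 1))), IsOpen U ∧ e ∈ U ∧
    ∃ F H : EuclideanSpace ℝ (Fin (n + 1)) → ℝ, ContDiffOn ℝ ∞ F U ∧ ContDiffOn ℝ ∞ H U ∧
      ∀ x ∈ U, ‖x‖ < 1 → u x = F x * defFun x ^ ((n : ℝ) / 2 - γ) +
        H x * (defFun x ^ ((n : ℝ) / 2 + γ) * resonantLog γ (defFun x))

variable {u v : EuclideanSpace ℝ (Fin (n + 1)) → ℝ} {e : EuclideanSpace ℝ (Fin (n + 1))}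

theorem HasSmoothSplitting.add (hu : HasSmoothSplitting γ u e) (hv : HasSmoothSplitting γ v e) :
    HasSmoothSplitting γ (fun x => u x + v x) e := by
  obtain ⟨U, hU, heU, F, H, hF, hH, h⟩ := hu
  obtain ⟨V, hV, heV, F', H', hF', hH', h'⟩ := hv
  refine ⟨U ∩ V, hU.inter hV, ⟨heU, heV⟩, F + F', H + H',
    (hF.mono Set.inter_subset_left).add (hF'.mono Set.inter_subset_right),
    (hH.mono Set.inter_subset_left).add (hH'.mono Set.inter_subset_right), fun x hx hx1 => ?_⟩
  beta_reduce
  rw [h x hx.1 hx1, h' x hx.2 hx1, Pi.add_apply, Pi.add_apply]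
  ring

theorem HasSmoothSplitting.const_mul (c : ℝ) (hu : HasSmoothSplitting γ u e) :
    HasSmoothSplitting γ (fun x => c * u x) e := by
  obtain ⟨U, hU, heU, F, H, hF, hH, h⟩ := hu
  refine ⟨U, hU, heU, fun x => c * F x, fun x => c * H x, contDiffOn_const.mul hF,
    contDiffOn_const.mul hH, fun x hx hx1 => ?_⟩
  beta_reduce
  rw [h x hx hx1]
  ring

theorem HasSmoothSplitting.congr (hu : HasSmoothSplitting γ u e)
    (h : ∀ x, ‖x‖ < 1 → v x = u x) : HasSmoothSplitting γ v e := by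
  obtain ⟨U, hU, heU, F, H, hF, hH, h'⟩ := hu
  exact ⟨U, hU, heU, F, H, hF, hH, fun x hx hx1 => by rw [h x hx1, h' x hx hx1]⟩

/-- Without resonance G itself serves as H. If γ = k is a natural number, the second slot carries a
logarithm, but ρ^{n/2+k} = ρ^{2k} ρ^{n/2-k} and the smooth factor ρ^{2k} G goes into F. -/
theorem hasSmoothSplitting_of_eq_mul_rpow {U : Set (EuclideanSpace ℝ (Fin (n + 1)))}
    (hU : IsOpen U) (he : e ∈ U) {G : EuclideanSpace ℝ (Fin (n + 1)) → ℝ}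
    (hG : ContDiffOn ℝ ∞ G U)
    (h : ∀ x ∈ U, ‖x‖ < 1 → u x = G x * defFun x ^ ((n : ℝ) / 2 + γ)) :
    HasSmoothSplitting γ u e := by
  by_cases hk : ∃ k : ℕ, γ = k
  · obtain ⟨k, hk⟩ := hk
    refine ⟨U, hU, he, fun x => G x * defFun x ^ (2 * k), fun _ => 0,
      hG.mul (contDiff_defFun.pow _).contDiffOn, contDiffOn_const, fun x hx hx1 => ?_⟩
    rw [h x hx hx1, zero_mul, add_zero, mul_assoc, ← Real.rpow_natCast,
      ← Real.rpow_add (defFun_pos hx1), hk]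
    push_cast
    ring_nf
  · push Not at hk
    refine ⟨U, hU, he, fun _ => 0, G, contDiffOn_const, hG, fun x hx hx1 => ?_⟩
    rw [h x hx hx1, resonantLog_of_forall_ne hk, zero_mul, zero_add, mul_one]

theorem HasSmoothSplitting.comp_linearIsometryEquiv (hu : HasSmoothSplitting γ u e)
    (R : EuclideanSpace ℝ (Fin (n + 1)) ≃ₗᵢ[ℝ] EuclideanSpace ℝ (Fin (n + 1))) :
    HasSmoothSplitting γ (fun x => u (R.symm x)) (R e) := by
  obtain ⟨U, hU, heU, F, H, hF, hH, h⟩ := hu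
  have hR : ContDiffOn ℝ ∞ R.symm (R.symm ⁻¹' U) := R.symm.contDiff.contDiffOn
  refine ⟨R.symm ⁻¹' U, hU.preimage R.symm.continuous, by simpa using heU,
    fun x => F (R.symm x), fun x => H (R.symm x), hF.comp hR fun x hx => hx,
    hH.comp hR fun x hx => hx, fun x hx hx1 => ?_⟩
  have hd : defFun (R.symm x) = defFun x := by simp [defFun]
  beta_reduce
  rw [h _ hx (by simpa using hx1), hd]

theorem contDiffOn_resonantLog {X : Type*} [NormedAddCommGroup X] [NormedSpace ℝ X] {g : X → ℝ}
    {U : Set X} (hg : ContDiffOn ℝ ∞ g U) (h0 : ∀ x ∈ U, 0 < g x) :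
    ContDiffOn ℝ ∞ (fun x => resonantLog γ (g x)) U := by
  unfold resonantLog
  split_ifs
  · exact hg.log fun x hx => (h0 x hx).ne'
  · exact contDiffOn_const

/-- The last `n` coordinates of a point of `ℝ^{n+1}`. -/
def tailPoint (x : EuclideanSpace ℝ (Fin (n + 1))) : EuclideanSpace ℝ (Fin n) :=
  WithLp.toLp 2 fun i => x i.succ

theorem consPoint_tailPoint (x : EuclideanSpace ℝ (Fin (n + 1))) :
    consPoint (x 0) (tailPoint x) = x := by
  ext i
  exact Fin.cases rfl (fun i => rfl) i

theorem contDiff_tailPoint : ContDiff ℝ ∞ (tailPoint (n := n)) := by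
  refine contDiff_euclidean.2 fun i => ?_
  simp only [tailPoint]
  fun_prop

theorem inner_consPoint (a b : ℝ) (v w : EuclideanSpace ℝ (Fin n)) :
    inner ℝ (consPoint a v) (consPoint b w) = a * b + inner ℝ v w := by
  simp [PiLp.inner_apply, Fin.sum_univ_succ, consPoint_zero, consPoint_succ, mul_comm]

/-- The squared distance to the point `-e₀`. -/
def antipodeDistSq (x : EuclideanSpace ℝ (Fin (n + 1))) : ℝ := 1 + 2 * x 0 + ‖x‖ ^ 2

theorem contDiff_antipodeDistSq : ContDiff ℝ ∞ (antipodeDistSq (n := n)) := by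
  have h : ContDiff ℝ ∞ fun x : EuclideanSpace ℝ (Fin (n + 1)) => 1 + 2 * x 0 := by fun_prop
  exact h.add (contDiff_norm_sq ℝ)

theorem antipodeDistSq_pos {x : EuclideanSpace ℝ (Fin (n + 1))} (hx : ‖x‖ < 1) :
    0 < antipodeDistSq x := by
  have h1 : |x 0| ≤ ‖x‖ := PiLp.norm_apply_le x 0
  have h2 := neg_abs_le (x 0)
  rw [antipodeDistSq]
  nlinarith

/-- The passage from the ball to the half-space, in terms of the stereographic projection. -/
theorem norm_sub_stereoInv_sq (x : EuclideanSpace ℝ (Fin (n + 1))) (hx : 0 < antipodeDistSq x)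
    (z : EuclideanSpace ℝ (Fin n)) :
    (1 + ‖z‖ ^ 2) * ‖x - stereoInv z‖ ^ 2 = antipodeDistSq x *
      ((2 / antipodeDistSq x * defFun x) ^ 2 +
        ‖(2 / antipodeDistSq x) • tailPoint x - z‖ ^ 2) := by
  have h1 : 0 < 1 + ‖z‖ ^ 2 := by positivity
  have h2 : ‖x‖ ^ 2 = x 0 ^ 2 + ‖tailPoint x‖ ^ 2 := by
    conv_lhs => rw [← consPoint_tailPoint x, norm_sq_consPoint]
  have h3 : inner ℝ x (stereoInv z) = (1 + ‖z‖ ^ 2)⁻¹ *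
      (x 0 * (1 - ‖z‖ ^ 2) + 2 * inner ℝ (tailPoint x) z) := by
    conv_lhs => rw [← consPoint_tailPoint x]
    rw [stereoInv, inner_smul_right, inner_consPoint, inner_smul_right]
  rw [norm_sub_sq_real, norm_sub_sq_real, norm_stereoInv, h3, norm_smul, mul_pow,
    real_inner_smul_left, mul_pow ‖2 / antipodeDistSq x‖ ‖tailPoint x‖,
    Real.norm_of_nonneg (by positivity), defFun]
  have h4 : ‖tailPoint x‖ ^ 2 = ‖x‖ ^ 2 - x 0 ^ 2 := by linarith
  rw [h4]
  have h5 : ‖x‖ ^ 2 = antipodeDistSq x - 1 - 2 * x 0 := by rw [antipodeDistSq]; ring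
  rw [h5]
  field_simp
  ring

/-- An integral of powers of the ball kernel against a density supported in the hemisphere around
`e₀`. -/
theorem hasSmoothSplitting_integral_of_support (hγ : 0 < γ)
    {g : Metric.sphere (0 : EuclideanSpace ℝ (Fin (n + 1))) 1 → ℝ}
    (hg : ContMDiff (𝓡 n) 𝓘(ℝ, ℝ) ∞ g)
    (h0 : ∀ ξ : Metric.sphere (0 : EuclideanSpace ℝ (Fin (n + 1))) 1,
      (ξ : EuclideanSpace ℝ (Fin (n + 1))) 0 ≤ 0 → g ξ = 0)
    (he : 0 < antipodeDistSq e) :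
    HasSmoothSplitting γ (fun x => ∫ ξ, g ξ *
      ballKernel (ξ : EuclideanSpace ℝ (Fin (n + 1))) x ^ ((n : ℝ) / 2 + γ) ∂(surfaceMeasure n))
      e := by
  have := Fact.mk (@finrank_euclideanSpace_fin ℝ _ (n + 1))
  have hS (z : EuclideanSpace ℝ (Fin n)) :
      stereoInv z ∈ Metric.sphere (0 : EuclideanSpace ℝ (Fin (n + 1))) 1 :=
    mem_sphere_zero_iff_norm.2 (norm_stereoInv z)
  -- φ collects the density, the stereographic Jacobian and the z-dependent factor of the
  -- transformed kernel. It is supported in the closed unit ball because g vanishes on the lower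
  -- hemisphere.
  set φ : EuclideanSpace ℝ (Fin n) → ℝ := fun z => g ⟨stereoInv z, hS z⟩ *
    (((1 + ‖z‖ ^ 2) / 2) ^ ((n : ℝ) / 2 + γ) * (2 / (1 + ‖z‖ ^ 2)) ^ n) with hφ
  have hT : ContDiff ℝ ∞ fun z : EuclideanSpace ℝ (Fin n) => 1 + ‖z‖ ^ 2 :=
    contDiff_const.add (contDiff_norm_sq ℝ)
  have hφs : ContDiff ℝ ∞ φ := by
    have h1 : ContDiff ℝ ∞ fun z : EuclideanSpace ℝ (Fin n) => g ⟨stereoInv z, hS z⟩ :=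
      (hg.comp (contDiff_stereoInv.contMDiff.codRestrict_sphere hS)).contDiff
    refine h1.mul (ContDiff.mul ?_ ?_)
    · exact (hT.div_const 2).rpow_const_of_ne fun z => by positivity
    · exact (contDiff_const.div hT fun z => by positivity).pow n
  have hφc : HasCompactSupport φ := by
    refine HasCompactSupport.of_support_subset_isCompact (isCompact_closedBall 0 1) fun z hz => ?_
    rw [mem_closedBall_zero_iff]
    by_contra! hlt
    refine hz ?_
    have h1 : stereoInv z 0 ≤ 0 := by
      rw [stereoInv_zero_coord]
      exact div_nonpos_of_nonpos_of_nonneg (by nlinarith) (by positivity)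
    simp only [hφ, h0 ⟨stereoInv z, hS z⟩ h1, zero_mul]
  obtain ⟨A, B, hA, hB, hAB⟩ := exists_contDiff_integral_add_norm_sq_rpow hφs hφc hγ
    (rfl : (n : ℝ) / 2 + γ = (n : ℝ) / 2 + γ)
  -- In half-space coordinates x becomes (κ x', κρ), with κ smooth and positive off the projection
  -- centre -e₀; the height y = κρ is thus a smooth positive multiple of ρ.
  set κ : EuclideanSpace ℝ (Fin (n + 1)) → ℝ := fun x => 2 / antipodeDistSq x with hκ
  set U : Set (EuclideanSpace ℝ (Fin (n + 1))) := {x | 0 < antipodeDistSq x} with hUdef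
  have hU : IsOpen U := isOpen_lt continuous_const contDiff_antipodeDistSq.continuous
  have hκ0 : ∀ x ∈ U, 0 < κ x := fun x hx => div_pos two_pos hx
  have hκs : ContDiffOn ℝ ∞ κ U :=
    contDiffOn_const.div contDiff_antipodeDistSq.contDiffOn fun x hx => ne_of_gt hx
  have hκr (a : ℝ) : ContDiffOn ℝ ∞ (fun x => κ x ^ a) U :=
    hκs.rpow_const_of_ne fun x hx => (hκ0 x hx).ne'
  have hp : ContDiffOn ℝ ∞ (fun x => (κ x • tailPoint x, (κ x * defFun x) ^ 2)) U :=
    (hκs.smul contDiff_tailPoint.contDiffOn).prodMk ((hκs.mul contDiff_defFun.contDiffOn).pow 2)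
  have hA' := hA.comp_contDiffOn hp
  have hB' := hB.comp_contDiffOn hp
  have key (x : EuclideanSpace ℝ (Fin (n + 1))) (hx : ‖x‖ < 1) :
      ∫ ξ, g ξ * ballKernel (ξ : EuclideanSpace ℝ (Fin (n + 1))) x ^ ((n : ℝ) / 2 + γ)
        ∂(surfaceMeasure n) = (κ x * defFun x) ^ ((n : ℝ) / 2 + γ) *
          ∫ z, φ z * ((κ x * defFun x) ^ 2 + ‖κ x • tailPoint x - z‖ ^ 2) ^
            (-((n : ℝ) / 2 + γ)) := by
    have hD := antipodeDistSq_pos hx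
    have hy : 0 < κ x * defFun x := mul_pos (hκ0 x hD) (defFun_pos hx)
    -- The change of variables takes functions on the ambient space, so g is extended by 0 off the
    -- sphere; continuity is needed on the sphere only.
    set ψ : EuclideanSpace ℝ (Fin (n + 1)) → ℝ := fun v =>
      Function.extend Subtype.val g 0 v * ballKernel v x ^ ((n : ℝ) / 2 + γ) with hψ
    have hext (ξ : Metric.sphere (0 : EuclideanSpace ℝ (Fin (n + 1))) 1) :
        Function.extend Subtype.val g 0 (ξ : EuclideanSpace ℝ (Fin (n + 1))) = g ξ :=
      Subtype.val_injective.extend_apply g 0 ξ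
    have hψc : ContinuousOn ψ (Metric.sphere 0 1) := by
      have h1 : ContinuousOn (Function.extend Subtype.val g 0)
          (Metric.sphere (0 : EuclideanSpace ℝ (Fin (n + 1))) 1) := by
        rw [continuousOn_iff_continuous_domRestrict]
        exact hg.continuous.congr fun ξ => (hext ξ).symm
      refine h1.mul fun v hv => ?_
      have hne : 0 < ‖x - v‖ ^ 2 := by
        have : x ≠ v := by
          rintro rfl
          exact hx.ne (mem_sphere_zero_iff_norm.1 hv)
        exact pow_pos (norm_pos_iff.2 (sub_ne_zero.2 this)) 2
      have hc : ContinuousAt (fun v => ballKernel v x) v :=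
        continuousAt_const.mul ((by fun_prop : ContinuousAt (fun v => ‖x - v‖ ^ 2) v).inv₀ hne.ne')
      exact (hc.rpow_const (.inl (mul_pos (defFun_pos hx) (inv_pos.2 hne)).ne')).continuousWithinAt
    have hψ0 : ∀ v, v 0 ≤ 0 → ψ v = 0 := fun v hv => by
      by_cases hmem : v ∈ Metric.sphere (0 : EuclideanSpace ℝ (Fin (n + 1))) 1
      · simp only [hψ]
        rw [hext ⟨v, hmem⟩, h0 ⟨v, hmem⟩ hv, zero_mul]
      · simp only [hψ]
        rw [Function.extend_apply' _ _ _ (by rintro ⟨ξ, rfl⟩; exact hmem ξ.2), Pi.zero_apply,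
          zero_mul]
    have h1 := integral_surfaceMeasure_stereo hψc hψ0
    simp only [hψ, hext] at h1
    rw [h1, ← integral_const_mul]
    refine integral_congr_ae (Eventually.of_forall fun z => ?_)
    have hQ : 0 < (κ x * defFun x) ^ 2 + ‖κ x • tailPoint x - z‖ ^ 2 := by positivity
    have hT0 : 0 < 1 + ‖z‖ ^ 2 := by positivity
    have h2 : ballKernel (stereoInv z) x = κ x * defFun x * ((1 + ‖z‖ ^ 2) / 2) *
        ((κ x * defFun x) ^ 2 + ‖κ x • tailPoint x - z‖ ^ 2)⁻¹ := by
      have h3 := norm_sub_stereoInv_sq x hD z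
      have h4 : ‖x - stereoInv z‖ ^ 2 = (1 + ‖z‖ ^ 2)⁻¹ * (antipodeDistSq x *
          ((κ x * defFun x) ^ 2 + ‖κ x • tailPoint x - z‖ ^ 2)) := by
        rw [← h3, inv_mul_cancel_left₀ hT0.ne']
      rw [ballKernel, h4, mul_inv, mul_inv, inv_inv]
      simp only [hκ]
      field_simp
    beta_reduce
    rw [h2, hext ⟨stereoInv z, hS z⟩, Real.mul_rpow (by positivity) (by positivity),
      Real.mul_rpow hy.le (by positivity), Real.inv_rpow hQ.le, ← Real.rpow_neg hQ.le]
    simp only [hφ]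
    ring
  -- With ε = (κρ)², the prefactor (κρ)^{n/2+γ} ε^{-γ} equals (κρ)^{n/2-γ}, and log ε contributes 2
  -- log ρ.
  have hmain : HasSmoothSplitting γ (fun x =>
      κ x ^ ((n : ℝ) / 2 - γ) * A (κ x • tailPoint x, (κ x * defFun x) ^ 2) *
        defFun x ^ ((n : ℝ) / 2 - γ) +
      2 * κ x ^ ((n : ℝ) / 2 + γ) * B (κ x • tailPoint x, (κ x * defFun x) ^ 2) *
        (defFun x ^ ((n : ℝ) / 2 + γ) * resonantLog γ (defFun x))) e :=
    ⟨U, hU, he, _, _, (hκr _).mul hA', (contDiffOn_const.mul (hκr _)).mul hB', fun x _ _ => rfl⟩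
  -- The part of `resonantLog` at ε not proportional to that at ρ is smooth and multiplies
  -- ρ^{n/2+γ}. The term -2 · `resonantLog γ 1` is the additivity defect, so one formula covers both
  -- cases.
  have hrest : HasSmoothSplitting γ (fun x => κ x ^ ((n : ℝ) / 2 + γ) *
      (resonantLog γ (κ x ^ 2) - 2 * resonantLog γ 1) *
      B (κ x • tailPoint x, (κ x * defFun x) ^ 2) * defFun x ^ ((n : ℝ) / 2 + γ)) e :=
    hasSmoothSplitting_of_eq_mul_rpow hU he (((hκr _).mul ((contDiffOn_resonantLog (hκs.pow 2)
      fun x hx => pow_pos (hκ0 x hx) 2).sub contDiffOn_const)).mul hB') fun x _ _ => rfl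
  refine (hmain.add hrest).congr fun x hx => ?_
  have hd := defFun_pos hx
  have hk := hκ0 x (antipodeDistSq_pos hx)
  have hy : 0 < κ x * defFun x := mul_pos hk hd
  have h1 : (κ x * defFun x) ^ ((n : ℝ) / 2 + γ) * ((κ x * defFun x) ^ 2) ^ (-γ) =
      κ x ^ ((n : ℝ) / 2 - γ) * defFun x ^ ((n : ℝ) / 2 - γ) := by
    rw [← Real.rpow_natCast, ← Real.rpow_mul hy.le, ← Real.rpow_add hy, ← Real.mul_rpow hk.le hd.le]
    push_cast
    ring_nf
  have h2 : resonantLog γ ((κ x * defFun x) ^ 2) = 2 * resonantLog γ (defFun x) +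
      (resonantLog γ (κ x ^ 2) - 2 * resonantLog γ 1) := by
    rw [show (κ x * defFun x) ^ 2 = defFun x * (defFun x * κ x ^ 2) by ring,
      resonantLog_mul hd (by positivity), resonantLog_mul hd (by positivity)]
    ring
  rw [key x hx, hAB _ _ (by positivity), mul_add, ← mul_assoc, h1, h2,
    Real.mul_rpow hk.le hd.le]
  ring

end SmoothSplitting

end

noncomputable section
open Filter Topology MeasureTheory

/-! ### The required boundary form of the Poisson integral, globally. -/

section PoissonStructure

variable {n : ℕ} {γ s : ℝ}

theorem contMDiff_comp_sphereMap
    {f : Metric.sphere (0 : EuclideanSpace ℝ (Fin (n + 1))) 1 → ℝ}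
    (hf : ContMDiff (𝓡 n) 𝓘(ℝ, ℝ) ∞ f)
    (R : EuclideanSpace ℝ (Fin (n + 1)) ≃ₗᵢ[ℝ] EuclideanSpace ℝ (Fin (n + 1))) :
    ContMDiff (𝓡 n) 𝓘(ℝ, ℝ) ∞ fun ξ => f (sphereMap R ξ) := by
  have := Fact.mk (@finrank_euclideanSpace_fin ℝ _ (n + 1))
  have h : ContMDiff (𝓡 n) 𝓘(ℝ, EuclideanSpace ℝ (Fin (n + 1))) ∞
      fun ξ : Metric.sphere (0 : EuclideanSpace ℝ (Fin (n + 1))) 1 =>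
        R (ξ : EuclideanSpace ℝ (Fin (n + 1))) :=
    R.contDiff.contMDiff.comp contMDiff_coe_sphere
  exact hf.comp (h.codRestrict_sphere fun ξ => by simp)

theorem poissonIntegral_comp_sphereMap
    (f : Metric.sphere (0 : EuclideanSpace ℝ (Fin (n + 1))) 1 → ℝ)
    (R : EuclideanSpace ℝ (Fin (n + 1)) ≃ₗᵢ[ℝ] EuclideanSpace ℝ (Fin (n + 1)))
    (x : EuclideanSpace ℝ (Fin (n + 1))) :
    poissonIntegral n γ (fun ξ => f (sphereMap R ξ)) x = poissonIntegral n γ f (R x) := by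
  rw [poissonIntegral_eq, poissonIntegral_eq,
    ← integral_sphereMap R fun ξ : Metric.sphere (0 : EuclideanSpace ℝ (Fin (n + 1))) 1 =>
      f ξ * ballKernel (ξ : EuclideanSpace ℝ (Fin (n + 1))) (R x) ^ ((n : ℝ) / 2 + γ)]
  congr 1
  refine integral_congr_ae (Eventually.of_forall fun ξ => ?_)
  have h1 : ‖R x - R ξ‖ = ‖x - ξ‖ := by rw [← map_sub, R.norm_map]
  simp [ballKernel, defFun, sphereMap, h1]

/-- A smooth cutoff near the point `e₀` of the sphere. -/
def poleCutoff (t : ℝ) : ℝ := Real.smoothTransition (4 * t - 1)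

theorem contDiff_poleCutoff : ContDiff ℝ ∞ poleCutoff :=
  Real.smoothTransition.contDiff.comp (by fun_prop : ContDiff ℝ ∞ fun t : ℝ => 4 * t - 1)

theorem poleCutoff_of_nonpos {t : ℝ} (ht : t ≤ 0) : poleCutoff t = 0 :=
  Real.smoothTransition.zero_of_nonpos (by linarith)

theorem poleCutoff_of_half_le {t : ℝ} (ht : 1 / 2 ≤ t) : poleCutoff t = 1 :=
  Real.smoothTransition.one_of_one_le (by linarith)

/-- An integral of powers of the ball kernel against a density supported away from `e₀`. -/
theorem hasSmoothSplitting_integral_of_cutoff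
    {f : Metric.sphere (0 : EuclideanSpace ℝ (Fin (n + 1))) 1 → ℝ} (hf : Continuous f)
    {e : EuclideanSpace ℝ (Fin (n + 1))} (he : 1 / 2 < e 0) :
    HasSmoothSplitting γ (fun x => ∫ ξ, ((1 - poleCutoff ((ξ : EuclideanSpace ℝ (Fin (n + 1))) 0)) *
      f ξ) * ballKernel (ξ : EuclideanSpace ℝ (Fin (n + 1))) x ^ ((n : ℝ) / 2 + γ)
        ∂(surfaceMeasure n)) e := by
  set U : Set (EuclideanSpace ℝ (Fin (n + 1))) := {x | 1 / 2 < x 0} with hUdef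
  have hU : IsOpen U := isOpen_lt continuous_const (by fun_prop)
  -- The kernel is singular only on the diagonal, and for ξ_0 > 1/2 the cutoff factor vanishes
  -- identically, so the product is smooth on the union, also for x beyond the sphere.
  set W : Set (EuclideanSpace ℝ (Fin (n + 1)) × EuclideanSpace ℝ (Fin (n + 1))) :=
    {p | p.1 ≠ p.2} ∪ {p | 1 / 2 < p.2 0} with hWdef
  have hW2 : IsOpen {p : EuclideanSpace ℝ (Fin (n + 1)) × EuclideanSpace ℝ (Fin (n + 1)) |
      1 / 2 < p.2 0} := isOpen_lt continuous_const (by fun_prop)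
  have hW : IsOpen W := (isOpen_ne_fun continuous_fst continuous_snd).union hW2
  have hUW : ∀ x ∈ U, ∀ ξ : Metric.sphere (0 : EuclideanSpace ℝ (Fin (n + 1))) 1,
      (x, (ξ : EuclideanSpace ℝ (Fin (n + 1)))) ∈ W := fun x hx ξ => by
    by_cases h : x = ξ
    · exact .inr (by rw [Set.mem_ofPred_eq, ← h]; exact hx)
    · exact .inl h
  have hK : ContDiffOn ℝ ∞ (fun p : EuclideanSpace ℝ (Fin (n + 1)) ×
      EuclideanSpace ℝ (Fin (n + 1)) =>
        (1 - poleCutoff (p.2 0)) * (‖p.1 - p.2‖ ^ 2) ^ (-((n : ℝ) / 2 + γ))) W := by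
    rintro p (hp | hp)
    · have h1 : ContDiff ℝ ∞ fun p : EuclideanSpace ℝ (Fin (n + 1)) ×
          EuclideanSpace ℝ (Fin (n + 1)) => ‖p.1 - p.2‖ ^ 2 :=
        (contDiff_fst.sub contDiff_snd).norm_sq ℝ
      have h2 : ContDiff ℝ ∞ fun p : EuclideanSpace ℝ (Fin (n + 1)) ×
          EuclideanSpace ℝ (Fin (n + 1)) => 1 - poleCutoff (p.2 0) :=
        contDiff_const.sub (contDiff_poleCutoff.comp (by fun_prop))
      exact (h2.contDiffAt.mul (h1.contDiffAt.rpow_const_of_ne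
        (pow_ne_zero 2 (norm_ne_zero_iff.2 (sub_ne_zero.2 hp))))).contDiffWithinAt
    · refine ((contDiffAt_const (c := (0 : ℝ))).congr_of_eventuallyEq ?_).contDiffWithinAt
      filter_upwards [hW2.mem_nhds hp] with q hq
      rw [poleCutoff_of_half_le (le_of_lt hq), sub_self, zero_mul]
  refine hasSmoothSplitting_of_eq_mul_rpow hU he (contDiffOn_integral_of_compact
    (μ := surfaceMeasure n) hU hW hf continuous_subtype_val hUW hK) fun x _ hx => ?_
  beta_reduce
  rw [← integral_mul_const]
  refine integral_congr_ae (Eventually.of_forall fun ξ => ?_)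
  beta_reduce
  rw [ballKernel, Real.mul_rpow (defFun_pos hx).le (by positivity), Real.inv_rpow (by positivity),
    ← Real.rpow_neg (by positivity), smul_eq_mul]
  ring

/-- The cutoff writes f as a part supported in the hemisphere around the pole, handled by
stereographic projection, plus a part vanishing near the pole, whose integral is a smooth multiple
of ρ^{n/2+γ} there. -/
theorem hasSmoothSplitting_poissonIntegral_pole (hγ : 0 < γ)
    {f : Metric.sphere (0 : EuclideanSpace ℝ (Fin (n + 1))) 1 → ℝ}
    (hf : ContMDiff (𝓡 n) 𝓘(ℝ, ℝ) ∞ f) :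
    HasSmoothSplitting γ (poissonIntegral n γ f) (EuclideanSpace.single 0 1) := by
  have := Fact.mk (@finrank_euclideanSpace_fin ℝ _ (n + 1))
  set e : EuclideanSpace ℝ (Fin (n + 1)) := EuclideanSpace.single 0 1 with he
  have he0 : e 0 = 1 := by simp [he]
  have hχ : ContMDiff (𝓡 n) 𝓘(ℝ, ℝ) ∞
      fun ξ : Metric.sphere (0 : EuclideanSpace ℝ (Fin (n + 1))) 1 =>
        poleCutoff ((ξ : EuclideanSpace ℝ (Fin (n + 1))) 0) :=
    (contDiff_poleCutoff.comp (by fun_prop : ContDiff ℝ ∞ fun x : EuclideanSpace ℝ (Fin (n + 1)) =>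
      x 0)).contMDiff.comp contMDiff_coe_sphere
  have h1 := hasSmoothSplitting_integral_of_support (e := e) hγ (hχ.mul hf)
    (fun ξ hξ => by rw [Pi.mul_apply, poleCutoff_of_nonpos hξ, zero_mul])
    (by rw [antipodeDistSq, he0]; positivity)
  have h2 := hasSmoothSplitting_integral_of_cutoff (γ := γ) (e := e) hf.continuous
    (by rw [he0]; norm_num)
  refine ((h1.add h2).const_mul (poissonConst n γ)).congr fun x hx => ?_
  have hχc : Continuous fun ξ : Metric.sphere (0 : EuclideanSpace ℝ (Fin (n + 1))) 1 =>
      poleCutoff ((ξ : EuclideanSpace ℝ (Fin (n + 1))) 0) := hχ.continuous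
  have hc : Continuous fun ξ : Metric.sphere (0 : EuclideanSpace ℝ (Fin (n + 1))) 1 =>
      (1 - poleCutoff ((ξ : EuclideanSpace ℝ (Fin (n + 1))) 0)) * f ξ :=
    (continuous_const.sub hχc).mul hf.continuous
  rw [poissonIntegral_eq, ← integral_add
    (integrable_mul_ballKernel_rpow (hχ.mul hf).continuous hx _)
    (integrable_mul_ballKernel_rpow hc hx _)]
  congr 1
  refine integral_congr_ae (Eventually.of_forall fun ξ => ?_)
  simp only [Pi.mul_apply]
  ring

/-- Inside the ball everything is put into F, at the sphere a rotation reduces to the pole, and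
outside the condition is void. Covering all points of the space lets the gluing produce F and H
smooth everywhere. -/
theorem hasSmoothSplitting_poissonIntegral (hγ : 0 < γ)
    {f : Metric.sphere (0 : EuclideanSpace ℝ (Fin (n + 1))) 1 → ℝ}
    (hf : ContMDiff (𝓡 n) 𝓘(ℝ, ℝ) ∞ f) (x : EuclideanSpace ℝ (Fin (n + 1))) :
    HasSmoothSplitting γ (poissonIntegral n γ f) x := by
  rcases lt_trichotomy ‖x‖ 1 with hx | hx | hx
  · refine ⟨Metric.ball 0 1, Metric.isOpen_ball, mem_ball_zero_iff.2 hx,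
      fun x => poissonIntegral n γ f x * defFun x ^ (-((n : ℝ) / 2 - γ)), fun _ => 0, ?_,
      contDiffOn_const, fun y _ hy => ?_⟩
    · intro y hy
      have hy := mem_ball_zero_iff.1 hy
      exact ((contDiffAt_poissonIntegral hf.continuous hy).mul
        (contDiffAt_defFun_rpow _ hy)).contDiffWithinAt
    · rw [mul_assoc, ← Real.rpow_add (defFun_pos hy), neg_add_cancel, Real.rpow_zero]
      ring
  · obtain ⟨R, hR⟩ := exists_linearIsometryEquiv (n := n)
      (x := EuclideanSpace.single 0 1) (y := x) (by simp [hx])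
    have h := (hasSmoothSplitting_poissonIntegral_pole hγ
      (contMDiff_comp_sphereMap hf R)).comp_linearIsometryEquiv R
    rw [hR] at h
    refine h.congr fun y _ => ?_
    rw [poissonIntegral_comp_sphereMap, R.apply_symm_apply]
  · refine ⟨{y | 1 < ‖y‖}, isOpen_lt continuous_const continuous_norm, hx, fun _ => 0, fun _ => 0,
      contDiffOn_const, contDiffOn_const, fun y hy hy1 => absurd hy1 (not_lt.2 (le_of_lt hy))⟩

theorem secondTerm_eq_resonantLog (hs : s = (n : ℝ) / 2 + γ) (t : ℝ) :
    secondTerm n s t = t ^ ((n : ℝ) / 2 + γ) * resonantLog γ t := by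
  subst hs
  have h : (∃ k : ℕ, (n : ℝ) / 2 + γ = (n : ℝ) / 2 + k) ↔ ∃ k : ℕ, γ = k :=
    exists_congr fun k => add_right_inj _
  by_cases hk : ∃ k : ℕ, γ = k
  · rw [secondTerm, if_pos (h.2 hk), resonantLog, if_pos hk]
  · rw [secondTerm, if_neg (mt h.1 hk), resonantLog, if_neg hk, mul_one]

/-- The Poisson integral of a smooth function has the form required in the scattering Poisson
problem. -/
theorem exists_smooth_poissonIntegral_eq (hγ : 0 < γ) (hs : s = (n : ℝ) / 2 + γ)
    {f : Metric.sphere (0 : EuclideanSpace ℝ (Fin (n + 1))) 1 → ℝ}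
    (hf : ContMDiff (𝓡 n) 𝓘(ℝ, ℝ) ∞ f) :
    ∃ F H : EuclideanSpace ℝ (Fin (n + 1)) → ℝ, ContDiff ℝ ∞ F ∧ ContDiff ℝ ∞ H ∧
      ∀ x, ‖x‖ < 1 → poissonIntegral n γ f x =
        F x * defFun x ^ ((n : ℝ) / 2 - γ) + H x * secondTerm n s (defFun x) := by
  -- For each x the admissible values of (F, H) form an affine, hence convex, set, so a smooth
  -- partition of unity glues the local pairs.
  obtain ⟨g, hg⟩ := exists_contMDiffMap_forall_mem_convex_of_local
    𝓘(ℝ, EuclideanSpace ℝ (Fin (n + 1))) (n := ⊤)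
    (t := fun x : EuclideanSpace ℝ (Fin (n + 1)) => {p : ℝ × ℝ | ‖x‖ < 1 →
      poissonIntegral n γ f x = p.1 * defFun x ^ ((n : ℝ) / 2 - γ) +
        p.2 * secondTerm n s (defFun x)})
    (fun x p hp q hq a b _ _ hab hx => by
      have h1 := hp hx
      have h2 := hq hx
      simp only [Prod.fst_add, Prod.snd_add, Prod.smul_fst, Prod.smul_snd, smul_eq_mul]
      linear_combination a * h1 + b * h2 - poissonIntegral n γ f x * hab)
    (fun x => by
      obtain ⟨U, hU, hxU, F, H, hF, hH, h⟩ := hasSmoothSplitting_poissonIntegral hγ hf x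
      refine ⟨U, hU.mem_nhds hxU, fun x => (F x, H x), (hF.prodMk hH).contMDiffOn,
        fun y hy hy1 => ?_⟩
      rw [h y hy hy1, secondTerm_eq_resonantLog hs])
  have hgs : ContDiff ℝ ∞ g := g.contMDiff.contDiff
  exact ⟨fun x => (g x).1, fun x => (g x).2, hgs.fst, hgs.snd, fun x hx => hg x hx⟩

end PoissonStructure

end

noncomputable section
open Filter Topology MeasureTheory

/-! ### Existence and uniqueness for the boundary problem. -/

section PoissonProblem

variable {n : ℕ} {γ s : ℝ} {f : Metric.sphere (0 : EuclideanSpace ℝ (Fin (n + 1))) 1 → ℝ}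

theorem tendsto_secondTerm_div (hγ : 0 < γ) (hs : s = (n : ℝ) / 2 + γ)
    {ξ : EuclideanSpace ℝ (Fin (n + 1))} (hξ : ‖ξ‖ = 1) :
    Tendsto (fun x => secondTerm n s (defFun x) / defFun x ^ ((n : ℝ) / 2 - γ))
      (𝓝[Metric.ball 0 1] ξ) (𝓝 0) := by
  have key : Tendsto (fun t : ℝ => secondTerm n s t / t ^ ((n : ℝ) / 2 - γ)) (𝓝[>] 0) (𝓝 0) := by
    have hpow {t : ℝ} (ht : 0 < t) : t ^ s / t ^ ((n : ℝ) / 2 - γ) = t ^ (2 * γ) := by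
      rw [← Real.rpow_sub ht, hs]; ring_nf
    unfold secondTerm
    split_ifs
    · refine (tendsto_log_mul_rpow_nhdsGT_zero (by linarith : 0 < 2 * γ)).congr' ?_
      filter_upwards [self_mem_nhdsWithin] with t ht
      rw [← hpow ht]; ring
    · have h : Tendsto (fun t : ℝ => t ^ (2 * γ)) (𝓝[>] 0) (𝓝 0) := by
        have := (Real.continuousAt_rpow_const 0 (2 * γ) (.inr (by linarith))).tendsto
        rw [Real.zero_rpow (by linarith)] at this
        exact this.mono_left nhdsWithin_le_nhds
      refine h.congr' ?_
      filter_upwards [self_mem_nhdsWithin] with t ht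
      rw [← hpow ht]
  refine key.comp (tendsto_nhdsWithin_iff.2 ⟨tendsto_defFun hξ, ?_⟩)
  filter_upwards [self_mem_nhdsWithin] with x hx
  exact defFun_pos (mem_ball_zero_iff.1 hx)

/-- A function `F ρ^{n-s} + H ρ^s` (or `F ρ^{n-s} + H ρ^s log ρ`), divided by `ρ^{n-s}`, has
boundary values `F`. -/
theorem tendsto_div_of_eq_add_secondTerm (hγ : 0 < γ) (hs : s = (n : ℝ) / 2 + γ)
    {u F H : EuclideanSpace ℝ (Fin (n + 1)) → ℝ}
    (hF : ContinuousOn F (Metric.closedBall 0 1)) (hH : ContinuousOn H (Metric.closedBall 0 1))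
    (hu : ∀ x ∈ Metric.ball (0 : EuclideanSpace ℝ (Fin (n + 1))) 1,
      u x = F x * defFun x ^ ((n : ℝ) / 2 - γ) + H x * secondTerm n s (defFun x))
    {ξ : EuclideanSpace ℝ (Fin (n + 1))} (hξ : ‖ξ‖ = 1) :
    Tendsto (fun x => u x / defFun x ^ ((n : ℝ) / 2 - γ)) (𝓝[Metric.ball 0 1] ξ) (𝓝 (F ξ)) := by
  have hmem : ξ ∈ Metric.closedBall (0 : EuclideanSpace ℝ (Fin (n + 1))) 1 := by simp [hξ]
  have hF' : Tendsto F (𝓝[Metric.ball 0 1] ξ) (𝓝 (F ξ)) :=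
    (hF ξ hmem).mono_left (nhdsWithin_mono _ Metric.ball_subset_closedBall)
  have hH' : Tendsto H (𝓝[Metric.ball 0 1] ξ) (𝓝 (H ξ)) :=
    (hH ξ hmem).mono_left (nhdsWithin_mono _ Metric.ball_subset_closedBall)
  have h := hF'.add (hH'.mul (tendsto_secondTerm_div hγ hs hξ))
  rw [mul_zero, add_zero] at h
  refine h.congr' ?_
  filter_upwards [self_mem_nhdsWithin] with x hx
  have := Real.rpow_pos_of_pos (defFun_pos (mem_ball_zero_iff.1 hx)) ((n : ℝ) / 2 - γ)
  rw [hu x hx, add_div, mul_div_cancel_right₀ _ this.ne', mul_div_assoc]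

theorem contDiffAt_of_eq_add_secondTerm {u F H : EuclideanSpace ℝ (Fin (n + 1)) → ℝ} {a : ℝ}
    (hF : ContDiffOn ℝ ∞ F (Metric.closedBall 0 1)) (hH : ContDiffOn ℝ ∞ H (Metric.closedBall 0 1))
    (hu : ∀ x ∈ Metric.ball (0 : EuclideanSpace ℝ (Fin (n + 1))) 1,
      u x = F x * defFun x ^ a + H x * secondTerm n s (defFun x))
    {x : EuclideanSpace ℝ (Fin (n + 1))} (hx : x ∈ Metric.ball 0 1) : ContDiffAt ℝ 2 u x := by
  have hnhds : Metric.closedBall (0 : EuclideanSpace ℝ (Fin (n + 1))) 1 ∈ 𝓝 x :=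
    mem_of_superset (Metric.isOpen_ball.mem_nhds hx) Metric.ball_subset_closedBall
  have hx1 := mem_ball_zero_iff.1 hx
  have h2 : ContDiffAt ℝ 2 (fun x => secondTerm n s (defFun x)) x := by
    unfold secondTerm
    split_ifs
    · exact (contDiffAt_defFun_rpow s hx1).mul
        (contDiff_defFun.contDiffAt.log (defFun_pos hx1).ne')
    · exact contDiffAt_defFun_rpow s hx1
  refine ((((hF.contDiffAt hnhds).of_le (by norm_cast)).mul (contDiffAt_defFun_rpow a hx1)).add
    (((hH.contDiffAt hnhds).of_le (by norm_cast)).mul h2)).congr_of_eventuallyEq ?_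
  filter_upwards [Metric.isOpen_ball.mem_nhds hx] with y hy
  exact hu y hy

/-- For any solution the quotient u/ρ^{n-s} tends to F = f, as it does for Pf, so the difference is
covered by uniqueness. Conversely Pf has the required form, and the equation depends only on the
values of u in the open ball. -/
theorem isPoissonSolution_iff (hγ : 0 < γ) (hγn : γ < (n : ℝ) / 2) (hs : s = (n : ℝ) / 2 + γ)
    (hf : ContMDiff (𝓡 n) 𝓘(ℝ, ℝ) ∞ f) (u : EuclideanSpace ℝ (Fin (n + 1)) → ℝ) :
    IsPoissonSolution n s f u ↔
      ∀ x ∈ Metric.ball (0 : EuclideanSpace ℝ (Fin (n + 1))) 1, u x = poissonIntegral n γ f x := by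
  have hns : (n : ℝ) - s = (n : ℝ) / 2 - γ := by rw [hs]; ring
  have hc := hf.continuous
  constructor
  · rintro ⟨hpde, F, H, hF, hH, hu, hFf⟩ x hx
    rw [hns] at hu
    have cu {y : EuclideanSpace ℝ (Fin (n + 1))} (hy : y ∈ Metric.ball 0 1) :=
      contDiffAt_of_eq_add_secondTerm hF hH hu hy
    have cP {y : EuclideanSpace ℝ (Fin (n + 1))} (hy : y ∈ Metric.ball 0 1) :
        ContDiffAt ℝ 2 (poissonIntegral n γ f) y :=
      (contDiffAt_poissonIntegral hc (mem_ball_zero_iff.1 hy)).of_le (by norm_cast)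
    refine sub_eq_zero.1 (eq_zero_of_scatteringOp_eq_zero (n := n) (γ := γ) (R := 1)
      (w := fun y => u y - poissonIntegral n γ f y) hs hγ hγn one_pos le_rfl
      (fun y hy => (cu hy).sub (cP hy)) (fun y hy => ?_) (fun ξ hξ => ?_) x hx)
    · have hy1 := mem_ball_zero_iff.1 hy
      rw [scatteringOp_sub hy1 (cu hy) (cP hy), scatteringOp_poissonIntegral hs hc hy1, sub_zero]
      exact hpde y hy
    · have h := (tendsto_div_of_eq_add_secondTerm hγ hs hF.continuousOn hH.continuousOn hu hξ).sub
        (tendsto_poissonIntegral hγ hγn hc ⟨ξ, mem_sphere_zero_iff_norm.2 hξ⟩)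
      rw [hFf ⟨ξ, mem_sphere_zero_iff_norm.2 hξ⟩, sub_self] at h
      exact h.congr fun y => (sub_div _ _ _).symm
  · intro hu
    obtain ⟨F, H, hF, hH, hP⟩ := exists_smooth_poissonIntegral_eq hγ hs hf
    refine ⟨fun x hx => ?_, F, H, hF.contDiffOn, hH.contDiffOn, fun x hx => ?_, fun ξ => ?_⟩
    · have hx1 := mem_ball_zero_iff.1 hx
      have h := scatteringOp_poissonIntegral hs hc hx1
      rw [← scatteringOp_congr (s := s) hx1
        ((contDiffAt_poissonIntegral hc hx1).of_le (by norm_cast)) (v := u)] at h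
      · exact h
      · filter_upwards [Metric.isOpen_ball.mem_nhds hx] with y hy
        exact (hu y hy).symm
    · rw [hu x hx, hns]
      exact hP x (mem_ball_zero_iff.1 hx)
    -- The gluing gives no direct control of F on the sphere; F = f follows by computing the limit
    -- of Pf/ρ^{n/2-γ} in two ways.
    · have hξ : ‖(ξ : EuclideanSpace ℝ (Fin (n + 1)))‖ = 1 := by simp
      have h1 := tendsto_div_of_eq_add_secondTerm hγ hs hF.continuous.continuousOn
        hH.continuous.continuousOn (fun x hx => hP x (mem_ball_zero_iff.1 hx)) hξ
      have hne : (𝓝[Metric.ball 0 1] (ξ : EuclideanSpace ℝ (Fin (n + 1)))).NeBot := by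
        rw [← mem_closure_iff_nhdsWithin_neBot, closure_ball _ one_ne_zero]
        simp
      exact tendsto_nhds_unique h1 (tendsto_poissonIntegral hγ hγn hc ξ)

end PoissonProblem

end

theorem theorem3p1 (n : ℕ) (γ : ℝ) (hγ : 0 < γ) (hγn : γ < (n : ℝ) / 2)
    (s : ℝ) (hs : s = (n : ℝ) / 2 + γ)
    (f : Metric.sphere (0 : EuclideanSpace ℝ (Fin (n + 1))) 1 → ℝ)
    (hf : ContMDiff (𝓡 n) 𝓘(ℝ, ℝ) ∞ f) :
    (∀ u : EuclideanSpace ℝ (Fin (n + 1)) → ℝ,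
      IsPoissonSolution n s f u ↔
        ∀ x ∈ Metric.ball (0 : EuclideanSpace ℝ (Fin (n + 1))) 1,
          u x = poissonIntegral n γ f x) ∧
    (∀ Y : ℕ → Metric.sphere (0 : EuclideanSpace ℝ (Fin (n + 1))) 1 → ℝ,
      IsHarmonicExpansion n f Y →
      ∀ r : ℝ, 0 ≤ r → r < 1 →
      ∀ ξ : Metric.sphere (0 : EuclideanSpace ℝ (Fin (n + 1))) 1,
        Summable (fun l : ℕ => radialProfile n γ l (r ^ 2) * r ^ l * Y l ξ) ∧
        poissonIntegral n γ f (r • (ξ : EuclideanSpace ℝ (Fin (n + 1)))) =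
          ((1 - r ^ 2) / 2) ^ ((n : ℝ) - s) *
            ∑' l : ℕ, radialProfile n γ l (r ^ 2) * r ^ l * Y l ξ) ∧
    (∀ l : ℕ, radialProfile n γ l 1 = 1) := by
  have hns : (n : ℝ) - s = (n : ℝ) / 2 - γ := by rw [hs]; ring
  refine ⟨fun u => isPoissonSolution_iff hγ hγn hs hf u, fun Y hY r hr0 hr1 ξ => ?_,
    fun l => radialProfile_one l hγ hγn⟩
  rw [hns]
  exact poissonIntegral_harmonicExpansion hγ hγn hf.continuous hY hr0 hr1 ξ
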